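/- Let $\mathfrak H$ be an infinite-dimensional separable complex Hilbert space and $X_1=\{\varphi\in\mathfrak H:\|\varphi\|\le 1\}$. For $n\in\mathbb N=\{0,1,2,\dots\}$ let $\vee^n\mathfrak H=S_n\mathfrak H^{\otimes n}$ be the symmetric subspace of the Hilbert tensor power, and let $\mathscr L^1(\vee^n\mathfrak H)$ be the Banach space of trace-class operators on it, with the trace norm; it is the dual of the space $\mathscr L^\infty(\vee^n\mathfrak H)$ of compact operators under $(T,A)\mapsto \mathrm{Tr}[TA]$, which gives its weak-$*$ topology. A normal state on $\vee^n\mathfrak H$ is a non-negative $\varrho_n\in\mathscr L^1(\vee^n\mathfrak H)$ with $\mathrm{Tr}\,\varrho_n=1$; for $k\le n$ its reduced density matrix is the unique non-negative $\varrho_n^{(k)}\in\mathscr L^1(\vee^k\mathfrak H)$ such that $\mathrm{Tr}[\varrho_n\,(A\otimes 1^{(n-k)})]=\mathrm{Tr}[\varrho_n^{(k)}A]$ for all bounded operators $A$ on $\vee^k\mathfrak H$. A symmetric hierarchy is a sequence $(\gamma^{(k)})_{k\in\mathbb N}\in\prod_k\mathscr L^1(\vee^k\mathfrak H)$ for which there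 are a sequence $(\varrho_n)_{n\in\mathbb N}$ of normal states on $\vee^n\mathfrak H$ and a subsequence $(\varrho_{n_i})_i$ such that, for every $k$, $\varrho_{n_i}^{(k)}\to\gamma^{(k)}$ weakly-$*$ as $i\to\infty$. Let $\mathscr H(\mathfrak H)$ be the set of symmetric hierarchies. Let $\mathscr M(\mathfrak H)$ be the set of Borel probability measures $\mu$ on $X_1$ that are $U(1)$-invariant, i.e. invariant under $\varphi\mapsto e^{i\theta}\varphi$ for all $\theta\in\mathbb R$. The weak (resp. strong) narrow topology on $\mathscr M(\mathfrak H)$ is the coarsest one for which $\mu\mapsto\int f\,d\mu$ is continuous for every bounded $f:X_1\to\mathbb R$ that is continuous for the weak (resp. norm) topology of $\mathfrak H$ on $X_1$. Then for every $\mu\in\mathscr M(\mathfrak H)$ and $k\in\mathbb N$ the map $\varphi\mapsto|\varphi^{\otimes k}\rangle\langle\varphi^{\otimes k}|$ is Bochner integrable in $\mathscr L^1(\vee^k\mathfrak H)$ with respect to $\mu$, and $$\Phi:\mathscr M(\mathfrak H)\to\mathscr H(\mathfrak H),\qquad \Phi(\mu)=\Big(\int_{X_1}|\varphi^{\otimes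 k}\rangle\langle\varphi^{\otimes k}|\,d\mu(\varphi)\Big)_{k\in\mathbb N},$$ is a well-defined bijection. Moreover $\Phi$ is a homeomorphism in each of the two cases: 1. $\mathscr M(\mathfrak H)$ has the weak narrow topology, and $\mathscr H(\mathfrak H)$ has the topology induced by the product over $k$ of the weak-$*$ topologies of $\mathscr L^1(\vee^k\mathfrak H)$; 2. $\mathscr M(\mathfrak H)$ has the strong narrow topology, and $\mathscr H(\mathfrak H)$ has the topology induced by the product over $k$ of the trace-norm topologies of $\mathscr L^1(\vee^k\mathfrak H)$. -/

import Mathlib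

open MeasureTheory Filter Topology
open scoped ENNReal InnerProductSpace

namespace SymHier

section TraceClass

variable (K : Type*) [NormedAddCommGroup K] [InnerProductSpace ℂ K]

variable {K} in
/-- The trace norm `‖T‖₁ = Tr |T| ∈ [0, ∞]` of a bounded operator on a Hilbert space, as the supremum
of `∑ i, |⟨e i, T (f i)⟩|` over all pairs of finite orthonormal systems. -/
noncomputable def traceNorm (T : K →L[ℂ] K) : ℝ≥0∞ :=
  ⨆ (n : ℕ) (e : Fin n → K) (f : Fin n → K) (_ : Orthonormal ℂ e) (_ : Orthonormal ℂ f),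
    ∑ i, ‖⟪e i, T (f i)⟫_ℂ‖ₑ

variable {K}

lemma le_traceNorm (T : K →L[ℂ] K) {n : ℕ} {e f : Fin n → K} (he : Orthonormal ℂ e)
    (hf : Orthonormal ℂ f) : ∑ i, ‖⟪e i, T (f i)⟫_ℂ‖ₑ ≤ traceNorm T :=
  le_iSup_of_le n <| le_iSup_of_le e <| le_iSup_of_le f <| le_iSup_of_le he <|
    le_iSup_of_le hf le_rfl

lemma traceNorm_le {T : K →L[ℂ] K} {C : ℝ≥0∞}
    (h : ∀ (n : ℕ) (e f : Fin n → K), Orthonormal ℂ e → Orthonormal ℂ f →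
      ∑ i, ‖⟪e i, T (f i)⟫_ℂ‖ₑ ≤ C) : traceNorm T ≤ C :=
  iSup_le fun n => iSup_le fun e => iSup_le fun f => iSup_le fun he => iSup_le fun hf =>
    h n e f he hf

lemma traceNorm_zero : traceNorm (0 : K →L[ℂ] K) = 0 :=
  le_antisymm (traceNorm_le fun n e f _ _ => by simp) bot_le

lemma traceNorm_add_le (S T : K →L[ℂ] K) : traceNorm (S + T) ≤ traceNorm S + traceNorm T := by
  refine traceNorm_le fun n e f he hf => ?_
  calc ∑ i, ‖⟪e i, (S + T) (f i)⟫_ℂ‖ₑ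
      ≤ ∑ i, (‖⟪e i, S (f i)⟫_ℂ‖ₑ + ‖⟪e i, T (f i)⟫_ℂ‖ₑ) := by
        refine Finset.sum_le_sum fun i _ => ?_
        rw [_root_.add_apply, inner_add_right]
        exact enorm_add_le _ _
    _ ≤ _ := by
        rw [Finset.sum_add_distrib]
        exact add_le_add (le_traceNorm S he hf) (le_traceNorm T he hf)

lemma traceNorm_smul_le (c : ℂ) (T : K →L[ℂ] K) : traceNorm (c • T) ≤ ‖c‖ₑ * traceNorm T := by
  refine traceNorm_le fun n e f he hf => ?_
  calc ∑ i, ‖⟪e i, (c • T) (f i)⟫_ℂ‖ₑ = ‖c‖ₑ * ∑ i, ‖⟪e i, T (f i)⟫_ℂ‖ₑ := by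
        rw [Finset.mul_sum]
        refine Finset.sum_congr rfl fun i _ => ?_
        rw [_root_.smul_apply, inner_smul_right, enorm_mul]
    _ ≤ _ := by gcongr; exact le_traceNorm T he hf

lemma traceNorm_smul (c : ℂ) (T : K →L[ℂ] K) : traceNorm (c • T) = ‖c‖ₑ * traceNorm T := by
  refine le_antisymm (traceNorm_smul_le c T) ?_
  rcases eq_or_ne c 0 with rfl | hc
  · simp
  · have h := traceNorm_smul_le c⁻¹ (c • T)
    rw [inv_smul_smul₀ hc, enorm_inv hc] at h
    have hc' : ‖c‖ₑ ≠ 0 := by simpa using hc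
    calc ‖c‖ₑ * traceNorm T ≤ ‖c‖ₑ * (‖c‖ₑ⁻¹ * traceNorm (c • T)) := by gcongr
      _ = traceNorm (c • T) := by
        rw [← mul_assoc, ENNReal.mul_inv_cancel hc' (by simp), one_mul]

lemma enorm_inner_le_traceNorm (T : K →L[ℂ] K) {e f : K} (he : ‖e‖ = 1) (hf : ‖f‖ = 1) :
    ‖⟪e, T f⟫_ℂ‖ₑ ≤ traceNorm T := by
  have h := le_traceNorm T (n := 1) (e := fun _ => e) (f := fun _ => f)
    ⟨fun _ => he, fun i j hij => (hij (Subsingleton.elim _ _)).elim⟩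
    ⟨fun _ => hf, fun i j hij => (hij (Subsingleton.elim _ _)).elim⟩
  simpa using h

/-- The operator norm is bounded by the trace norm. -/
lemma enorm_le_traceNorm (T : K →L[ℂ] K) : ‖T‖ₑ ≤ traceNorm T := by
  by_cases htop : traceNorm T = ⊤
  · simp [htop]
  rw [← ENNReal.ofReal_toReal htop, ← ofReal_norm]
  refine ENNReal.ofReal_le_ofReal (T.opNorm_le_bound ENNReal.toReal_nonneg fun x => ?_)
  rcases eq_or_ne x 0 with rfl | hx
  · simp
  rcases eq_or_ne (T x) 0 with hTx | hTx
  · rw [hTx, norm_zero]; positivity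
  have hx' : (‖x‖ : ℂ) ≠ 0 := by simpa using hx
  have hT' : (‖T x‖ : ℂ) ≠ 0 := by simpa using hTx
  have h := enorm_inner_le_traceNorm T (e := ((‖T x‖ : ℂ)⁻¹) • T x) (f := ((‖x‖ : ℂ)⁻¹) • x)
    (by simp [norm_smul, hTx]) (by simp [norm_smul, hx])
  have h2 := ENNReal.toReal_mono htop h
  rw [toReal_enorm] at h2
  have h3 : ‖⟪((‖T x‖ : ℂ)⁻¹) • T x, T (((‖x‖ : ℂ)⁻¹) • x)⟫_ℂ‖ = ‖T x‖ / ‖x‖ := by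
    rw [map_smul, inner_smul_left, inner_smul_right, inner_self_eq_norm_sq_to_K]
    have h0 : ‖T x‖ ≠ 0 := by simpa using hTx
    simp only [norm_mul, map_inv₀, norm_inv, norm_pow, RCLike.norm_conj, Complex.norm_real,
      norm_norm, Complex.coe_algebraMap]
    field_simp
  rw [h3, div_le_iff₀ (norm_pos_iff.2 hx)] at h2
  exact h2

/-- The rank-one operator `|x⟩⟨y|` has finite trace norm. -/
lemma traceNorm_rankOne_le (x y : K) :
    traceNorm (InnerProductSpace.rankOne ℂ x y) ≤ ‖x‖ₑ * ‖y‖ₑ := by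
  refine traceNorm_le fun n e f he hf => ?_
  have h1 : ∑ i, ‖⟪e i, x⟫_ℂ‖ * ‖⟪f i, y⟫_ℂ‖ ≤ ‖x‖ * ‖y‖ := by
    refine (Real.sum_mul_le_sqrt_mul_sqrt _ _ _).trans ?_
    refine mul_le_mul ?_ ?_ (Real.sqrt_nonneg _) (norm_nonneg _)
    · exact Real.sqrt_le_iff.2 ⟨norm_nonneg _, he.sum_inner_products_le x⟩
    · exact Real.sqrt_le_iff.2 ⟨norm_nonneg _, hf.sum_inner_products_le y⟩
  calc ∑ i, ‖⟪e i, InnerProductSpace.rankOne ℂ x y (f i)⟫_ℂ‖ₑ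
      = ENNReal.ofReal (∑ i, ‖⟪e i, x⟫_ℂ‖ * ‖⟪f i, y⟫_ℂ‖) := by
        rw [ENNReal.ofReal_sum_of_nonneg (fun i _ => by positivity)]
        refine Finset.sum_congr rfl fun i _ => ?_
        rw [InnerProductSpace.rankOne_apply, inner_smul_right, ← ofReal_norm, norm_mul,
          norm_inner_symm (f i) y, mul_comm]
    _ ≤ ENNReal.ofReal (‖x‖ * ‖y‖) := ENNReal.ofReal_le_ofReal h1
    _ = _ := by rw [ENNReal.ofReal_mul (norm_nonneg _), ofReal_norm, ofReal_norm]

variable (K) in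
/-- The trace-class operators, as a subspace of the bounded operators. -/
def traceClassSubmodule : Submodule ℂ (K →L[ℂ] K) where
  carrier := {T | traceNorm T < ∞}
  add_mem' hS hT := (traceNorm_add_le _ _).trans_lt (ENNReal.add_lt_top.2 ⟨hS, hT⟩)
  zero_mem' := by simp [traceNorm_zero]
  smul_mem' c T hT := by
    simp only [Set.mem_ofPred_eq, traceNorm_smul]
    exact ENNReal.mul_lt_top (by simp) hT

variable (K) in
/-- The space `𝓛¹(K)` of trace-class operators; its topology and norm are those of the trace norm
(not of the operator norm). -/
def TraceClass : Type _ := traceClassSubmodule K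

namespace TraceClass

instance : AddCommGroup (TraceClass K) := inferInstanceAs (AddCommGroup (traceClassSubmodule K))
instance : Module ℂ (TraceClass K) := inferInstanceAs (Module ℂ (traceClassSubmodule K))

/-- The underlying bounded operator. -/
def op (T : TraceClass K) : K →L[ℂ] K := Subtype.val T

/-- A bounded operator of finite trace norm, as an element of `𝓛¹(K)`. -/
def mk (T : K →L[ℂ] K) (hT : traceNorm T < ∞) : TraceClass K :=
  (⟨T, hT⟩ : traceClassSubmodule K)

@[simp] lemma op_mk (T : K →L[ℂ] K) (hT : traceNorm T < ∞) : (mk T hT).op = T := rfl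

lemma traceNorm_op_lt_top (T : TraceClass K) : traceNorm T.op < ∞ := Subtype.property T

@[ext] lemma ext {S T : TraceClass K} (h : S.op = T.op) : S = T := Subtype.ext h

@[simp] lemma op_zero : (0 : TraceClass K).op = 0 := rfl
@[simp] lemma op_add (S T : TraceClass K) : (S + T).op = S.op + T.op := rfl
@[simp] lemma op_sub (S T : TraceClass K) : (S - T).op = S.op - T.op := rfl
@[simp] lemma op_smul (c : ℂ) (T : TraceClass K) : (c • T).op = c • T.op := rfl

noncomputable instance : Norm (TraceClass K) := ⟨fun T => (traceNorm T.op).toReal⟩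

lemma norm_def (T : TraceClass K) : ‖T‖ = (traceNorm T.op).toReal := rfl

lemma opNorm_le (T : TraceClass K) : ‖T.op‖ ≤ ‖T‖ := by
  have h := ENNReal.toReal_mono T.traceNorm_op_lt_top.ne (enorm_le_traceNorm T.op)
  rwa [toReal_enorm] at h

variable (K) in
lemma normCore : NormedSpace.Core ℂ (TraceClass K) where
  norm_nonneg T := ENNReal.toReal_nonneg
  norm_smul c T := by
    rw [norm_def, norm_def, op_smul, traceNorm_smul, ENNReal.toReal_mul, toReal_enorm]
  norm_triangle S T := by
    rw [norm_def, norm_def, norm_def, op_add,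
      ← ENNReal.toReal_add S.traceNorm_op_lt_top.ne T.traceNorm_op_lt_top.ne]
    exact ENNReal.toReal_mono
      (ENNReal.add_lt_top.2 ⟨S.traceNorm_op_lt_top, T.traceNorm_op_lt_top⟩).ne
      (traceNorm_add_le _ _)
  norm_eq_zero_iff T := by
    constructor
    · intro h
      have h1 := opNorm_le T
      rw [h] at h1
      exact ext (norm_le_zero_iff.1 h1)
    · rintro rfl
      rw [norm_def, op_zero, traceNorm_zero, ENNReal.toReal_zero]

noncomputable instance : NormedAddCommGroup (TraceClass K) := NormedAddCommGroup.ofCore (normCore K)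
noncomputable instance : NormedSpace ℂ (TraceClass K) := NormedSpace.ofCore (normCore K)

lemma enorm_eq (T : TraceClass K) : ‖T‖ₑ = traceNorm T.op := by
  rw [← ofReal_norm, norm_def, ENNReal.ofReal_toReal T.traceNorm_op_lt_top.ne]

/-- `𝓛¹(K)` is a Banach space, so that Bochner integrals in it make sense. -/
instance [CompleteSpace K] : CompleteSpace (TraceClass K) := by
  refine Metric.complete_of_cauchySeq_tendsto fun u hu => ?_
  have hcau : CauchySeq fun n => (u n).op := by
    rw [Metric.cauchySeq_iff'] at hu ⊢
    intro ε hε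
    obtain ⟨N, hN⟩ := hu ε hε
    refine ⟨N, fun n hn => lt_of_le_of_lt ?_ (hN n hn)⟩
    rw [dist_eq_norm, dist_eq_norm, ← op_sub]
    exact opNorm_le _
  obtain ⟨T, hT⟩ := cauchySeq_tendsto_of_complete hcau
  have key : ∀ ε : ℝ, 0 < ε → ∃ N, ∀ n ≥ N, traceNorm ((u n).op - T) ≤ ENNReal.ofReal ε := by
    intro ε hε
    obtain ⟨N, hN⟩ := Metric.cauchySeq_iff.1 hu ε hε
    refine ⟨N, fun n hn => traceNorm_le fun m e f he hf => ?_⟩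
    have hlim : Tendsto (fun p => ∑ i, ‖⟪e i, ((u n).op - (u p).op) (f i)⟫_ℂ‖ₑ) atTop
        (𝓝 (∑ i, ‖⟪e i, ((u n).op - T) (f i)⟫_ℂ‖ₑ)) := by
      refine tendsto_finsetSum _ fun i _ => ?_
      refine Tendsto.enorm ?_
      refine Tendsto.inner tendsto_const_nhds ?_
      have h1 : Tendsto (fun p => (u n).op - (u p).op) atTop (𝓝 ((u n).op - T)) :=
        tendsto_const_nhds.sub hT
      exact ((ContinuousLinearMap.apply ℂ K (f i)).continuous.tendsto _).comp h1
    refine le_of_tendsto hlim (eventually_atTop.2 ⟨N, fun p hp => ?_⟩)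
    refine (le_traceNorm _ he hf).trans ?_
    rw [← op_sub, ← enorm_eq, ← ofReal_norm, ← dist_eq_norm]
    exact ENNReal.ofReal_le_ofReal (hN n hn p hp).le
  have hTmem : traceNorm T < ∞ := by
    obtain ⟨N, hN⟩ := key 1 one_pos
    have h2 : T = (u N).op + (-1 : ℂ) • ((u N).op - T) := by simp
    rw [h2]
    refine (traceNorm_add_le _ _).trans_lt (ENNReal.add_lt_top.2
      ⟨(u N).traceNorm_op_lt_top, ?_⟩)
    rw [traceNorm_smul]
    exact ENNReal.mul_lt_top (by simp) ((hN N le_rfl).trans_lt ENNReal.ofReal_lt_top)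
  refine ⟨mk T hTmem, Metric.tendsto_atTop.2 fun ε hε => ?_⟩
  obtain ⟨N, hN⟩ := key (ε / 2) (half_pos hε)
  refine ⟨N, fun n hn => ?_⟩
  rw [dist_eq_norm, norm_def, op_sub, op_mk]
  have h3 := ENNReal.toReal_mono ENNReal.ofReal_ne_top (hN n hn)
  rw [ENNReal.toReal_ofReal (half_pos hε).le] at h3
  exact lt_of_le_of_lt h3 (half_lt_self hε)

/-- The rank-one operator `|x⟩⟨x|` as a trace-class operator. -/
noncomputable def dyad (x : K) : TraceClass K :=
  mk (InnerProductSpace.rankOne ℂ x x) <|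
    (traceNorm_rankOne_le x x).trans_lt (ENNReal.mul_lt_top (by simp) (by simp))

@[simp] lemma dyad_op_apply (x y : K) : (dyad x).op y = ⟪x, y⟫_ℂ • x := rfl

end TraceClass

lemma summable_trace {T : K →L[ℂ] K} (hT : traceNorm T < ∞) {ι : Type*} {b : ι → K}
    (hb : Orthonormal ℂ b) : Summable fun i => ‖⟪b i, T (b i)⟫_ℂ‖ := by
  refine summable_of_sum_le (c := (traceNorm T).toReal) (fun i => norm_nonneg _) fun s => ?_
  let v : Fin s.card → K := fun i => b (s.equivFin.symm i)
  have hv : Orthonormal ℂ v :=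
    hb.comp (fun i => (s.equivFin.symm i : ι))
      (Subtype.val_injective.comp s.equivFin.symm.injective)
  have h := ENNReal.toReal_mono hT.ne (le_traceNorm T hv hv)
  rw [ENNReal.toReal_sum (fun i _ => by simp)] at h
  simp only [toReal_enorm] at h
  refine le_trans (le_of_eq ?_) h
  rw [← Finset.sum_coe_sort s]
  exact (s.equivFin.symm.sum_comp fun i : s => ‖⟪b i, T (b i)⟫_ℂ‖).symm

variable [CompleteSpace K]

variable (K) in
/-- The index set of a fixed orthonormal basis of the Hilbert space `K`. -/
noncomputable def basisIndex : Set K := (exists_hilbertBasis ℂ K).choose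

variable (K) in
/-- A fixed orthonormal basis of the Hilbert space `K`. -/
noncomputable def basis : HilbertBasis (basisIndex K) ℂ K :=
  (exists_hilbertBasis ℂ K).choose_spec.choose

/-- The trace `Tr T = ∑ i, ⟨e i, T (e i)⟩` over an orthonormal basis; for trace-class `T` the series
converges absolutely and its sum does not depend on the basis. -/
noncomputable def trace (T : K →L[ℂ] K) : ℂ := ∑' i, ⟪basis K i, T (basis K i)⟫_ℂ

variable (K) in
/-- The weak-∗ topology on `𝓛¹(K)`, as the dual of the compact operators under `⟨T, A⟩ = Tr (T A)`. -/
@[reducible] noncomputable def weakStarTopology : TopologicalSpace (TraceClass K) :=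
  ⨅ A : {A : K →L[ℂ] K // IsCompactOperator A},
    TopologicalSpace.induced (fun T : TraceClass K => trace (T.op ∘L A.1)) inferInstance

/-- A normal state (density operator): a non-negative trace-class operator of trace one. -/
def IsNormalState (ϱ : TraceClass K) : Prop := ϱ.op.IsPositive ∧ trace ϱ.op = 1

end TraceClass


section TensorPower

variable {H : Type*} [NormedAddCommGroup H] [InnerProductSpace ℂ H] [CompleteSpace H]

variable (H) in
/-- The Hilbert tensor power `H^{⊗n}`, realised as `ℓ²` over the multi-indices `I`: the coordinates
of a tensor are those with respect to the orthonormal basis `e (I 0) ⊗ ⋯ ⊗ e (I (n-1))`, where `e` is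
a fixed orthonormal basis of `H`. By `inner_tensor` and `dense_span_tensor` below, this is the
completion of the algebraic tensor power for the usual inner product. -/
abbrev TensorPower (n : ℕ) : Type _ := lp (fun _ : Fin n → basisIndex H => ℂ) 2

lemma summable_prod_pi {ι : Type*} (n : ℕ) (g : Fin n → ι → ℂ)
    (hg : ∀ j, Summable fun i => ‖g j i‖) :
    (Summable fun I : Fin n → ι => ‖∏ j, g j (I j)‖) ∧
      HasSum (fun I : Fin n → ι => ∏ j, g j (I j)) (∏ j, ∑' i, g j i) := by
  induction n with
  | zero =>
    refine ⟨(hasSum_fintype _).summable, ?_⟩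
    convert hasSum_fintype (fun I : Fin 0 → ι => ∏ j, g j (I j)) using 1
    simp
  | succ n ih =>
    obtain ⟨h1, h2⟩ := ih (fun j => g j.succ) (fun j => hg j.succ)
    let e := Fin.consEquiv (fun _ : Fin (n + 1) => ι)
    have hfun : ∀ p : ι × (Fin n → ι),
        ∏ j, g j (e p j) = g 0 p.1 * ∏ j : Fin n, g j.succ (p.2 j) := by
      intro p
      rw [Fin.prod_univ_succ]
      simp [e, Fin.consEquiv]
    have hs : Summable fun p : ι × (Fin n → ι) => ‖g 0 p.1 * ∏ j : Fin n, g j.succ (p.2 j)‖ :=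
      Summable.mul_norm (f := g 0) (g := fun I : Fin n → ι => ∏ j : Fin n, g j.succ (I j)) (hg 0) h1
    have h3 : HasSum (fun p : ι × (Fin n → ι) => g 0 p.1 * ∏ j : Fin n, g j.succ (p.2 j))
        ((∑' i, g 0 i) * ∏ j : Fin n, ∑' i, g j.succ i) :=
      HasSum.mul (f := g 0) (g := fun I : Fin n → ι => ∏ j : Fin n, g j.succ (I j))
        (Summable.hasSum (Summable.of_norm (hg 0))) h2 (Summable.of_norm hs)
    rw [Fin.prod_univ_succ]
    constructor
    · rw [← e.summable_iff]
      refine hs.congr fun p => ?_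
      rw [Function.comp_apply, hfun]
    · rw [← e.hasSum_iff]
      have h4 : (fun I : Fin (n + 1) → ι => ∏ j, g j (I j)) ∘ e =
          fun p => g 0 p.1 * ∏ j : Fin n, g j.succ (p.2 j) := funext hfun
      rw [h4]
      exact h3

lemma summable_coord (f g : H) :
    Summable fun i => ‖⟪f, basis H i⟫_ℂ * ⟪basis H i, g⟫_ℂ‖ :=
  ((basis H).summable_inner_mul_inner f g).norm

lemma memℓp_tensor {n : ℕ} (f : Fin n → H) :
    Memℓp (fun I : Fin n → basisIndex H => ∏ j, ⟪basis H (I j), f j⟫_ℂ) 2 := by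
  refine memℓp_gen ?_
  refine (summable_prod_pi n _ fun j => summable_coord (f j) (f j)).1.congr fun I => ?_
  simp only [ENNReal.toReal_ofNat, Real.rpow_ofNat]
  rw [norm_prod, norm_prod, ← Finset.prod_pow]
  refine Finset.prod_congr rfl fun j _ => ?_
  rw [norm_mul, norm_inner_symm, sq]

/-- The elementary tensor `f 0 ⊗ ⋯ ⊗ f (n-1)`. -/
noncomputable def tensor {n : ℕ} (f : Fin n → H) : TensorPower H n :=
  ⟨fun I => ∏ j, ⟪basis H (I j), f j⟫_ℂ, memℓp_tensor f⟩

lemma tensor_apply {n : ℕ} (f : Fin n → H) (I : Fin n → basisIndex H) :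
    tensor f I = ∏ j, ⟪basis H (I j), f j⟫_ℂ := rfl

/-- The inner product of elementary tensors. -/
lemma inner_tensor {n : ℕ} (f g : Fin n → H) :
    ⟪tensor f, tensor g⟫_ℂ = ∏ j, ⟪f j, g j⟫_ℂ := by
  rw [lp.inner_eq_tsum]
  have h := (summable_prod_pi n _ fun j => summable_coord (f j) (g j)).2
  simp only [(basis H).tsum_inner_mul_inner] at h
  rw [← h.tsum_eq]
  refine tsum_congr fun I => ?_
  rw [tensor_apply, tensor_apply, Finset.prod_mul_distrib, RCLike.inner_apply, map_prod, mul_comm]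
  simp only [inner_conj_symm]

/-- Elementary tensors are total in the tensor power. -/
lemma dense_span_tensor (n : ℕ) :
    (Submodule.span ℂ (Set.range (tensor : (Fin n → H) → TensorPower H n))).topologicalClosure
      = ⊤ := by
  classical
  rw [Submodule.topologicalClosure_eq_top_iff, Submodule.eq_bot_iff]
  intro ψ hψ
  rw [Submodule.mem_orthogonal] at hψ
  ext I
  have h := hψ (tensor fun j => basis H (I j)) (Submodule.subset_span ⟨_, rfl⟩)
  have h2 : tensor (fun j => basis H (I j)) = lp.single 2 I (1 : ℂ) := by
    ext J
    rw [tensor_apply, lp.single_apply]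
    have hb : ∀ i j, ⟪basis H i, basis H j⟫_ℂ = if i = j then 1 else 0 :=
      orthonormal_iff_ite.1 (basis H).orthonormal
    simp only [hb]
    by_cases hJ : J = I
    · subst hJ; simp
    · obtain ⟨j, hj⟩ := Function.ne_iff.1 hJ
      rw [Finset.prod_eq_zero (Finset.mem_univ j) (by simp [hj])]
      simp [hJ]
  rw [h2, lp.inner_single_left] at h
  simpa using h

/-- The unitary `U_π` on the tensor power, given by `f 0 ⊗ ⋯ ⊗ f (n-1) ↦ f (π 0) ⊗ ⋯ ⊗ f (π (n-1))`
(see `permOp_tensor`). -/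
noncomputable def permOp {n : ℕ} (π : Equiv.Perm (Fin n)) : TensorPower H n →ₗᵢ[ℂ] TensorPower H n where
  toFun ψ := ⟨fun I => ψ (I ∘ π.symm), memℓp_gen <|
    ((Equiv.arrowCongr π (Equiv.refl _)).summable_iff (f := fun I => ‖ψ I‖ ^ _)).2
      ((lp.memℓp ψ).summable (by simp))⟩
  map_add' ψ χ := rfl
  map_smul' c ψ := rfl
  norm_map' ψ := by
    rw [lp.norm_eq_tsum_rpow (by simp), lp.norm_eq_tsum_rpow (by simp)]
    congr 1
    exact (Equiv.arrowCongr π (Equiv.refl _)).tsum_eq (fun I => ‖ψ I‖ ^ _)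

lemma permOp_apply {n : ℕ} (π : Equiv.Perm (Fin n)) (ψ : TensorPower H n)
    (I : Fin n → basisIndex H) : permOp π ψ I = ψ (I ∘ π.symm) := rfl

lemma permOp_tensor {n : ℕ} (π : Equiv.Perm (Fin n)) (f : Fin n → H) :
    permOp π (tensor f) = tensor fun j => f (π j) := by
  ext I
  rw [permOp_apply, tensor_apply, tensor_apply]
  exact (Equiv.prod_comp π fun j => ⟪basis H ((I ∘ π.symm) j), f j⟫_ℂ).symm.trans (by simp)

lemma permOp_permOp {n : ℕ} (π σ : Equiv.Perm (Fin n)) (ψ : TensorPower H n) :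
    permOp π (permOp σ ψ) = permOp (σ * π) ψ := by
  ext I
  rfl

variable (H) in
/-- The symmetrisation `S_n = (1/n!) ∑_π U_π`. -/
noncomputable def symOp (n : ℕ) : TensorPower H n →L[ℂ] TensorPower H n :=
  ((n.factorial : ℂ)⁻¹) • ∑ π : Equiv.Perm (Fin n), (permOp π).toContinuousLinearMap

lemma symOp_apply {n : ℕ} (ψ : TensorPower H n) :
    symOp H n ψ = ((n.factorial : ℂ)⁻¹) • ∑ π : Equiv.Perm (Fin n), permOp π ψ := by
  simp [symOp]

variable (H) in
/-- The symmetric tensor power `∨ⁿ H = S_n H^{⊗n}`. -/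
noncomputable def symPower (n : ℕ) : Submodule ℂ (TensorPower H n) := (symOp H n).range

/-- `∨ⁿ H` consists of the tensors fixed by all the `U_π`. -/
lemma mem_symPower_iff {n : ℕ} {ψ : TensorPower H n} :
    ψ ∈ symPower H n ↔ ∀ π : Equiv.Perm (Fin n), permOp π ψ = ψ := by
  constructor
  · rintro ⟨χ, rfl⟩ π
    change permOp π (symOp H n χ) = symOp H n χ
    rw [symOp_apply, map_smul, map_sum]
    simp only [permOp_permOp]
    congr 1
    exact Equiv.sum_comp (Equiv.mulRight π) fun σ => permOp σ χ
  · intro h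
    refine ⟨ψ, ?_⟩
    change symOp H n ψ = ψ
    rw [symOp_apply]
    simp only [h, Finset.sum_const, Finset.card_univ, Fintype.card_perm, Fintype.card_fin]
    rw [← Nat.cast_smul_eq_nsmul ℂ, smul_smul, inv_mul_cancel₀, one_smul]
    exact_mod_cast n.factorial_ne_zero

lemma isClosed_symPower (n : ℕ) : IsClosed (symPower H n : Set (TensorPower H n)) := by
  have h : (symPower H n : Set (TensorPower H n)) =
      ⋂ π : Equiv.Perm (Fin n), {ψ | permOp π ψ = ψ} := by
    ext ψ
    simp [mem_symPower_iff]
  rw [h]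
  exact isClosed_iInter fun π => isClosed_eq (permOp π).continuous continuous_id

instance (n : ℕ) : CompleteSpace (symPower H n) := (isClosed_symPower n).completeSpace_coe

/-- The vector `φ^{⊗n}` of `∨ⁿ H`. -/
noncomputable def tensorPow (n : ℕ) (φ : H) : symPower H n :=
  ⟨tensor fun _ => φ, mem_symPower_iff.2 fun π => permOp_tensor π _⟩

/-- An operator on `∨ⁿ H`, extended to `H^{⊗n}` by zero on the orthogonal complement. -/
noncomputable def extendOp {n : ℕ} (A : symPower H n →L[ℂ] symPower H n) :
    TensorPower H n →L[ℂ] TensorPower H n :=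
  (symPower H n).subtypeL ∘L A ∘L (symPower H n).orthogonalProjectionOnto

lemma enorm_sq_eq_tsum {ι : Type*} (ψ : lp (fun _ : ι => ℂ) 2) :
    ‖ψ‖ₑ ^ 2 = ∑' i, ‖ψ i‖ₑ ^ 2 := by
  have h := lp.norm_rpow_eq_tsum (p := 2) (by simp) ψ
  have hs := (lp.memℓp ψ).summable (by simp)
  simp only [ENNReal.toReal_ofNat, Real.rpow_ofNat] at h hs
  rw [← ofReal_norm, ← ENNReal.ofReal_pow (norm_nonneg _), h,
    ENNReal.ofReal_tsum_of_nonneg (fun i => by positivity) hs]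
  refine tsum_congr fun i => ?_
  rw [ENNReal.ofReal_pow (norm_nonneg _), ofReal_norm]

lemma memℓp_two_of_tsum {ι : Type*} {ψ : ι → ℂ} (h : ∑' i, ‖ψ i‖ₑ ^ 2 ≠ ∞) : Memℓp ψ 2 := by
  refine memℓp_gen ?_
  refine (ENNReal.summable_toReal h).congr fun i => ?_
  simp

lemma enorm_le_of_tsum_le {ι : Type*} (ψ : lp (fun _ : ι => ℂ) 2) (C : ℝ≥0∞)
    (h : ∑' i, ‖ψ i‖ₑ ^ 2 ≤ C ^ 2) : ‖ψ‖ₑ ≤ C := by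
  rw [← enorm_sq_eq_tsum] at h
  exact (ENNReal.pow_le_pow_left_iff two_ne_zero).1 h

/-- For fixed last `m` indices `J`, the tensor `ψ(·, J)` in `H^{⊗k}`. -/
noncomputable def slice {k m : ℕ} (J : Fin m → basisIndex H) (ψ : TensorPower H (k + m)) :
    TensorPower H k :=
  ⟨fun I => ψ (Fin.append I J), memℓp_gen <|
    ((lp.memℓp ψ).summable (by simp)).comp_injective (i := fun I => Fin.append I J)
      fun I I' h => funext fun i => by simpa using congrFun h (Fin.castAdd m i)⟩

lemma tsum_append {k m : ℕ} {ι : Type*} (F : (Fin (k + m) → ι) → ℝ≥0∞) :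
    ∑' I, F I = ∑' (J : Fin m → ι) (I : Fin k → ι), F (Fin.append I J) := by
  rw [← (Fin.appendEquiv k m).tsum_eq, ENNReal.tsum_prod', ENNReal.tsum_comm]
  rfl

lemma tsum_ampl {k m : ℕ} (A : TensorPower H k →L[ℂ] TensorPower H k) (ψ : TensorPower H (k + m)) :
    ∑' I : Fin (k + m) → basisIndex H,
      ‖A (slice (fun j => I (Fin.natAdd k j)) ψ) (fun i => I (Fin.castAdd m i))‖ₑ ^ 2
      ≤ (‖A‖ₑ * ‖ψ‖ₑ) ^ 2 := by
  rw [tsum_append, mul_pow, enorm_sq_eq_tsum ψ, tsum_append (fun I => ‖ψ I‖ₑ ^ 2),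
    ← ENNReal.tsum_mul_left]
  refine ENNReal.tsum_le_tsum fun J => ?_
  simp only [Fin.append_left, Fin.append_right]
  calc ∑' I : Fin k → basisIndex H, ‖A (slice J ψ) I‖ₑ ^ 2 = ‖A (slice J ψ)‖ₑ ^ 2 :=
        (enorm_sq_eq_tsum _).symm
    _ ≤ (‖A‖ₑ * ‖slice J ψ‖ₑ) ^ 2 := by gcongr; exact A.le_opENorm _
    _ = ‖A‖ₑ ^ 2 * ∑' I : Fin k → basisIndex H, ‖ψ (Fin.append I J)‖ₑ ^ 2 := by
        rw [mul_pow, enorm_sq_eq_tsum]; rfl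

/-- The coordinates of `(A ⊗ 1^{(m)}) ψ`. -/
noncomputable def ampliationFun {k : ℕ} (m : ℕ) (A : TensorPower H k →L[ℂ] TensorPower H k)
    (ψ : TensorPower H (k + m)) : TensorPower H (k + m) :=
  ⟨fun I => A (slice (fun j => I (Fin.natAdd k j)) ψ) (fun i => I (Fin.castAdd m i)),
    memℓp_two_of_tsum <| ne_top_of_le_ne_top
      (ENNReal.pow_ne_top (ENNReal.mul_ne_top (by simp) (by simp))) (tsum_ampl A ψ)⟩

lemma norm_ampliationFun_le {k m : ℕ} (A : TensorPower H k →L[ℂ] TensorPower H k)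
    (ψ : TensorPower H (k + m)) : ‖ampliationFun m A ψ‖ ≤ ‖A‖ * ‖ψ‖ := by
  have h := enorm_le_of_tsum_le (ampliationFun m A ψ) _ (tsum_ampl A ψ)
  have h2 := ENNReal.toReal_mono (ENNReal.mul_ne_top (by simp) (by simp)) h
  rwa [ENNReal.toReal_mul, toReal_enorm, toReal_enorm, toReal_enorm] at h2

/-- The operator `A ⊗ 1^{(m)}` on `H^{⊗(k+m)}`: it applies `A` in the first `k` tensor factors
(see `ampliation_tensor`). -/
noncomputable def ampliation {k : ℕ} (m : ℕ) (A : TensorPower H k →L[ℂ] TensorPower H k) :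
    TensorPower H (k + m) →L[ℂ] TensorPower H (k + m) :=
  LinearMap.mkContinuous
    { toFun := ampliationFun m A
      map_add' := fun ψ χ => by
        ext I
        have h : slice (fun j => I (Fin.natAdd k j)) (ψ + χ) =
          slice (fun j => I (Fin.natAdd k j)) ψ + slice (fun j => I (Fin.natAdd k j)) χ := rfl
        change A _ _ = A _ _ + A _ _
        rw [h, map_add]; rfl
      map_smul' := fun c ψ => by
        ext I
        have h : slice (fun j => I (Fin.natAdd k j)) (c • ψ) =
          c • slice (fun j => I (Fin.natAdd k j)) ψ := rfl
        change A _ _ = c • A _ _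
        rw [h, map_smul]; rfl } ‖A‖ (norm_ampliationFun_le A)

lemma ampliation_apply {k m : ℕ} (A : TensorPower H k →L[ℂ] TensorPower H k)
    (ψ : TensorPower H (k + m)) (I : Fin (k + m) → basisIndex H) :
    ampliation m A ψ I =
      A (slice (fun j => I (Fin.natAdd k j)) ψ) (fun i => I (Fin.castAdd m i)) := rfl

/-- `(A ⊗ 1) (f ⊗ g) = (A f) ⊗ g`, read off in coordinates. -/
lemma ampliation_tensor {k m : ℕ} (A : TensorPower H k →L[ℂ] TensorPower H k)
    (f : Fin k → H) (g : Fin m → H) (I : Fin k → basisIndex H) (J : Fin m → basisIndex H) :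
    ampliation m A (tensor (Fin.append f g)) (Fin.append I J) = A (tensor f) I * tensor g J := by
  rw [ampliation_apply A]
  simp only [Fin.append_left, Fin.append_right]
  have h : slice J (tensor (Fin.append f g)) = tensor g J • tensor f := by
    ext I
    change tensor (Fin.append f g) (Fin.append I J) = tensor g J * tensor f I
    simp only [tensor_apply]
    rw [Fin.prod_univ_add, mul_comm]
    simp
  rw [h, map_smul]
  exact mul_comm _ _

end TensorPower

section Hierarchy

variable {H : Type*} [NormedAddCommGroup H] [InnerProductSpace ℂ H] [CompleteSpace H]

/-- `r` is the `k`-particle reduced density matrix of the normal state `ϱ` on `∨^{k+m} H`: a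
non-negative trace-class operator on `∨ᵏ H` with `Tr[ϱ (A ⊗ 1^{(m)})] = Tr[r A]` for all bounded `A`. -/
def IsReducedDensity {k m : ℕ} (ϱ : TraceClass (symPower H (k + m)))
    (r : TraceClass (symPower H k)) : Prop :=
  r.op.IsPositive ∧ ∀ A : symPower H k →L[ℂ] symPower H k,
    trace (extendOp ϱ.op ∘L ampliation m (extendOp A)) = trace (r.op ∘L A)

variable (H) in
/-- The set of symmetric hierarchies: sequences `(γ k)` of trace-class operators on `∨ᵏ H` such that,
for some sequence `ϱ n` of normal states on `∨ⁿ H` with reduced density matrices `r n k` (`k ≤ n`) and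
some subsequence `s`, `r (s i) k` converges weak-∗ to `γ k` for every `k`. -/
def symHierarchies : Set (∀ k : ℕ, TraceClass (symPower H k)) :=
  {γ | ∃ (ϱ : ∀ n : ℕ, TraceClass (symPower H n)) (r : ℕ → ∀ k : ℕ, TraceClass (symPower H k))
      (s : ℕ → ℕ),
    (∀ n, IsNormalState (ϱ n)) ∧
    (∀ k m : ℕ, IsReducedDensity (ϱ (k + m)) (r (k + m) k)) ∧
    StrictMono s ∧
    ∀ (k : ℕ) (A : symPower H k →L[ℂ] symPower H k), IsCompactOperator A →
      Tendsto (fun i => trace ((r (s i) k).op ∘L A)) atTop (𝓝 (trace ((γ k).op ∘L A)))}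

variable (H) in
/-- The product over `k` of the weak-∗ topologies of `𝓛¹(∨ᵏ H)`, on the symmetric hierarchies. -/
@[reducible] noncomputable def hierarchyWeakStar : TopologicalSpace (symHierarchies H) :=
  TopologicalSpace.induced Subtype.val
    (@Pi.topologicalSpace ℕ (fun k => TraceClass (symPower H k))
      fun k => weakStarTopology (symPower H k))

variable (H) in
/-- The product over `k` of the trace-norm topologies of `𝓛¹(∨ᵏ H)`, on the symmetric hierarchies. -/
@[reducible] noncomputable def hierarchyNorm : TopologicalSpace (symHierarchies H) :=
  TopologicalSpace.induced Subtype.val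
    (Pi.topologicalSpace : TopologicalSpace (∀ k : ℕ, TraceClass (symPower H k)))

end Hierarchy

section Measures

variable (H : Type*) [NormedAddCommGroup H] [InnerProductSpace ℂ H]

/-- The closed unit ball of `H`. As a type it carries the norm topology and its Borel sets. -/
abbrev UnitBall : Type _ := Metric.closedBall (0 : H) 1

/-- The weak topology of `H`, restricted to the closed unit ball. -/
@[reducible] noncomputable def ballWeak : TopologicalSpace (UnitBall H) :=
  TopologicalSpace.induced (fun x => toWeakSpace ℂ H x.1) inferInstance

variable {H} in
/-- The rotation `x ↦ e^{iθ} x` of the closed unit ball. -/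
noncomputable def rotate (θ : ℝ) (x : UnitBall H) : UnitBall H :=
  ⟨Complex.exp (θ * Complex.I) • x.1, by
    have h := x.2
    rw [mem_closedBall_zero_iff] at h ⊢
    rwa [norm_smul, Complex.norm_exp_ofReal_mul_I, one_mul]⟩

variable [MeasurableSpace H]

/-- The `U(1)`-invariant Borel probability measures on the closed unit ball. -/
def InvMeasure : Type _ :=
  {μ : ProbabilityMeasure (UnitBall H) //
    ∀ θ : ℝ, Measure.map (rotate θ) (μ : Measure (UnitBall H)) = μ}

variable [BorelSpace H]

/-- The strong narrow topology: convergence of `∫ f dμ` for `f` bounded and norm continuous. -/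
@[reducible] noncomputable def strongNarrow : TopologicalSpace (InvMeasure H) :=
  TopologicalSpace.induced Subtype.val
    (inferInstance : TopologicalSpace (ProbabilityMeasure (UnitBall H)))

/-- The weak narrow topology: convergence of `∫ f dμ` for `f` bounded and weakly continuous. -/
@[reducible] noncomputable def weakNarrow : TopologicalSpace (InvMeasure H) :=
  ⨅ f : {f : UnitBall H → ℝ // Continuous[ballWeak H, inferInstance] f ∧ ∃ C, ∀ x, |f x| ≤ C},
    TopologicalSpace.induced (fun μ : InvMeasure H => ∫ x, f.1 x ∂(μ.1 : Measure (UnitBall H)))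
      inferInstance

variable {H} [CompleteSpace H]

/-- The map `Φ`, `μ ↦ (∫ |φ^{⊗k}⟩⟨φ^{⊗k}| dμ(φ))_k`, with Bochner integrals in `𝓛¹(∨ᵏ H)`. -/
noncomputable def momentMap (μ : InvMeasure H) (k : ℕ) : TraceClass (symPower H k) :=
  ∫ φ : UnitBall H, TraceClass.dyad (tensorPow k φ.1) ∂(μ.1 : Measure (UnitBall H))

end Measures

end SymHier

/-!
Symmetrised elementary tensors turn an operator on `∨ᵏ H` into a function of `k` pairs of vectors,
and a sequence of operators into a function `ℓ` on multisets of pairs, which determines the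
sequence. For the reduced density matrices of an `N`-particle state, adding a pair `(e i, e i)` and
summing over an orthonormal basis gives back `ℓ`, so the iterated differences of `ℓ` in diagonal
directions are nonnegative up to order `N`. For a hierarchy all of them are: `ℓ` is a completely
monotone function. The normalised functions of this kind form a compact convex set. At an extreme
point the splitting of `ℓ` by one diagonal pair `(a, a)` must be trivial, so `ℓ` is multiplicative,
and it is the list of moments of a single vector `φ` with `‖φ‖ ≤ 1`. By Krein–Milman every
hierarchy is a mixture of such points, and averaging the mixture over `U(1)` gives an invariant
measure.

Injectivity is Stone–Weierstrass on the weakly compact ball: the invariance makes the monomials of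
unequal degrees in `φ` and its conjugate integrate to zero, and the moments give all the others.
That moments form a hierarchy uses the infinite dimension: a vector of the ball is a weak limit of
unit vectors.

In the weak case `Φ` is a continuous bijection from a compact space to a Hausdorff space. In the
strong case the trace of the one-particle component is `∫ ‖φ‖² dμ`, and weak convergence together
with convergence of the second moments implies strong convergence, because the mass far from
finitely many coordinates is then small uniformly along the sequence. Conversely the Bochner
integrals depend continuously on the measure, because bounded continuous functions are close in
mean to functions of finite rank.
-/

namespace SymHier

section Bases

variable {K : Type*} [NormedAddCommGroup K] [InnerProductSpace ℂ K]

lemma countable_of_orthonormal [TopologicalSpace.SeparableSpace K] {ι : Type*} {b : ι → K}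
    (hb : Orthonormal ℂ b) : Countable ι := by
  have one_le_dist : ∀ i j, i ≠ j → 1 ≤ dist (b i) (b j) := fun i j hij => by
    have h : dist (b i) (b j) ^ 2 = 2 := by
      rw [dist_eq_norm, @norm_sub_sq ℂ, hb.1 i, hb.1 j, hb.2 hij]
      norm_num
    nlinarith [dist_nonneg (x := b i) (y := b j)]
  refine Pairwise.countable_of_isOpen_disjoint (s := fun i => Metric.ball (b i) (1 / 2))
    (fun i j hij => Metric.ball_disjoint_ball ?_) (fun _ => Metric.isOpen_ball)
    fun i => ⟨b i, Metric.mem_ball_self (by norm_num)⟩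
  linarith [one_le_dist i j hij]

lemma hasSum_norm_inner_sq {ι : Type*} (b : HilbertBasis ι ℂ K) (x : K) :
    HasSum (fun i => ‖⟪b i, x⟫_ℂ‖ ^ 2) (‖x‖ ^ 2) := by
  have h := Complex.hasSum_re (b.hasSum_inner_mul_inner x x)
  simpa only [← inner_conj_symm x (b _), ← Complex.normSq_eq_conj_mul_self, Complex.ofReal_re,
    Complex.normSq_eq_norm_sq, inner_self_eq_norm_sq_to_K, Complex.coe_algebraMap,
    ← Complex.ofReal_pow] using h

lemma tsum_enorm_inner_sq {ι : Type*} (b : HilbertBasis ι ℂ K) (x : K) :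
    ∑' i, ‖⟪b i, x⟫_ℂ‖ₑ ^ 2 = ‖x‖ₑ ^ 2 := by
  have h := hasSum_norm_inner_sq b x
  simp only [← ofReal_norm, ← ENNReal.ofReal_pow (norm_nonneg _)]
  rw [← ENNReal.ofReal_tsum_of_nonneg (fun i => by positivity) h.summable, h.tsum_eq]

instance countable_basisIndex [CompleteSpace K] [TopologicalSpace.SeparableSpace K] :
    Countable (basisIndex K) :=
  countable_of_orthonormal (basis K).orthonormal

end Bases

section TraceNorm

variable {K : Type*} [NormedAddCommGroup K] [InnerProductSpace ℂ K]

lemma sum_enorm_inner_le_traceNorm (T : K →L[ℂ] K) {ι : Type*} {e f : ι → K}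
    (he : Orthonormal ℂ e) (hf : Orthonormal ℂ f) (s : Finset ι) :
    ∑ i ∈ s, ‖⟪e i, T (f i)⟫_ℂ‖ₑ ≤ traceNorm T := by
  have hs : Function.Injective fun i => (s.equivFin.symm i : ι) :=
    Subtype.val_injective.comp s.equivFin.symm.injective
  refine le_of_eq_of_le ?_ (le_traceNorm T (he.comp _ hs) (hf.comp _ hs))
  rw [← Finset.sum_coe_sort s]
  exact (s.equivFin.symm.sum_comp fun i : s => ‖⟪e i, T (f i)⟫_ℂ‖ₑ).symm

variable [CompleteSpace K]

lemma traceNorm_comp_unitary_le (T : K →L[ℂ] K) {U : K →L[ℂ] K} (hU : U ∈ unitary (K →L[ℂ] K)) :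
    traceNorm (T ∘L U) ≤ traceNorm T := by
  let V : K →ₗᵢ[ℂ] K := ⟨U, fun x => U.norm_map_of_mem_unitary hU x⟩
  exact traceNorm_le fun n e f he hf =>
    le_traceNorm T he (hf.comp_linearIsometry V)

/-- Every bounded operator is a linear combination of unitaries, so the trace-class operators form
a right ideal. -/
lemma exists_traceNorm_comp_le (B : K →L[ℂ] K) :
    ∃ C : ℝ≥0∞, C ≠ ∞ ∧ ∀ T : K →L[ℂ] K, traceNorm (T ∘L B) ≤ C * traceNorm T := by
  have hB : B ∈ Submodule.span ℂ (unitary (K →L[ℂ] K) : Set (K →L[ℂ] K)) := by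
    rw [CStarAlgebra.span_unitary]
    trivial
  induction hB using Submodule.span_induction with
  | mem U hU => exact ⟨1, by simp, fun T => by simpa using traceNorm_comp_unitary_le T hU⟩
  | zero => exact ⟨0, by simp, fun T => by simp [traceNorm_zero]⟩
  | add B₁ B₂ _ _ h₁ h₂ =>
    obtain ⟨C₁, hC₁, h₁⟩ := h₁
    obtain ⟨C₂, hC₂, h₂⟩ := h₂
    refine ⟨C₁ + C₂, by finiteness, fun T => ?_⟩
    rw [ContinuousLinearMap.comp_add, add_mul]
    exact (traceNorm_add_le _ _).trans (add_le_add (h₁ T) (h₂ T))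
  | smul c B _ h =>
    obtain ⟨C, hC, h⟩ := h
    refine ⟨‖c‖ₑ * C, by finiteness, fun T => ?_⟩
    rw [ContinuousLinearMap.comp_smul, traceNorm_smul, mul_assoc]
    gcongr
    exact h T

end TraceNorm

section TraceClassFunctionals

variable {K : Type*} [NormedAddCommGroup K] [InnerProductSpace ℂ K]

/-- The matrix element `T ↦ ⟪x, T y⟫` as a continuous functional on `𝓛¹(K)`. -/
noncomputable def matrixElement (x y : K) : TraceClass K →L[ℂ] ℂ :=
  LinearMap.mkContinuous
    { toFun := fun T => ⟪x, T.op y⟫_ℂ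
      map_add' := fun S T => by simp
      map_smul' := fun c T => by simp } (‖x‖ * ‖y‖) fun T => by
    calc ‖⟪x, T.op y⟫_ℂ‖ ≤ ‖x‖ * (‖T‖ * ‖y‖) :=
          (norm_inner_le_norm _ _).trans <| by
            gcongr
            exact T.op.le_of_opNorm_le T.opNorm_le y
      _ = ‖x‖ * ‖y‖ * ‖T‖ := by ring

@[simp] lemma matrixElement_apply (x y : K) (T : TraceClass K) :
    matrixElement x y T = ⟪x, T.op y⟫_ℂ := rfl

lemma isCompactOperator_rankOne (x y : K) :
    IsCompactOperator (InnerProductSpace.rankOne ℂ x y) := by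
  rw [InnerProductSpace.rankOne_def']
  exact (isCompactOperator_of_locallyCompactSpace_dom (innerSL ℂ y)).clm_comp
    (ContinuousLinearMap.toSpanSingleton ℂ x)

variable [CompleteSpace K]

lemma norm_trace_le {T : K →L[ℂ] K} (hT : traceNorm T < ∞) :
    ‖trace T‖ ≤ (traceNorm T).toReal := by
  have hb := (basis K).orthonormal
  refine (norm_tsum_le_tsum_norm (summable_trace hT hb)).trans ?_
  refine Real.tsum_le_of_sum_le (fun i => norm_nonneg _) fun s => ?_
  have h := ENNReal.toReal_mono hT.ne (sum_enorm_inner_le_traceNorm T hb hb s)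
  rw [ENNReal.toReal_sum fun i _ => enorm_ne_top] at h
  simpa only [toReal_enorm] using h

lemma trace_add {S T : K →L[ℂ] K} (hS : traceNorm S < ∞) (hT : traceNorm T < ∞) :
    trace (S + T) = trace S + trace T := by
  have hb := (basis K).orthonormal
  simp only [trace, _root_.add_apply, inner_add_right]
  exact (summable_trace hS hb).of_norm.tsum_add (summable_trace hT hb).of_norm

lemma trace_smul (c : ℂ) (T : K →L[ℂ] K) : trace (c • T) = c * trace T := by
  simp only [trace, _root_.smul_apply, inner_smul_right]
  exact tsum_mul_left

lemma TraceClass.traceNorm_comp_lt_top (T : TraceClass K) (B : K →L[ℂ] K) :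
    traceNorm (T.op ∘L B) < ∞ := by
  obtain ⟨C, hC, h⟩ := exists_traceNorm_comp_le B
  exact (h _).trans_lt (ENNReal.mul_lt_top hC.lt_top T.traceNorm_op_lt_top)

/-- The functional `T ↦ Tr (T B)` on `𝓛¹(K)`, continuous for the trace norm. -/
noncomputable def traceComp (B : K →L[ℂ] K) : TraceClass K →L[ℂ] ℂ :=
  LinearMap.mkContinuousOfExistsBound
    { toFun := fun T => trace (T.op ∘L B)
      map_add' := fun S T => by
        rw [TraceClass.op_add, ContinuousLinearMap.add_comp,
          trace_add (S.traceNorm_comp_lt_top B) (T.traceNorm_comp_lt_top B)]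
      map_smul' := fun c T => by
        rw [TraceClass.op_smul, ContinuousLinearMap.smul_comp, trace_smul, RingHom.id_apply,
          smul_eq_mul] } <| by
    obtain ⟨C, hC, h⟩ := exists_traceNorm_comp_le B
    refine ⟨C.toReal, fun T => (norm_trace_le (T.traceNorm_comp_lt_top B)).trans ?_⟩
    rw [TraceClass.norm_def, ← ENNReal.toReal_mul]
    exact ENNReal.toReal_mono (ENNReal.mul_ne_top hC T.traceNorm_op_lt_top.ne) (h _)

@[simp] lemma traceComp_apply (B : K →L[ℂ] K) (T : TraceClass K) :
    traceComp B T = trace (T.op ∘L B) := rfl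

lemma trace_rankOne (x y : K) : trace (InnerProductSpace.rankOne ℂ x y) = ⟪y, x⟫_ℂ := by
  rw [trace, ← (basis K).tsum_inner_mul_inner y x]
  simp only [InnerProductSpace.rankOne_apply, inner_smul_right]

lemma trace_comp_rankOne (T : K →L[ℂ] K) (x y : K) :
    trace (T ∘L InnerProductSpace.rankOne ℂ x y) = ⟪y, T x⟫_ℂ := by
  rw [InnerProductSpace.comp_rankOne, trace_rankOne]

end TraceClassFunctionals

section Dyads

variable {K : Type*} [NormedAddCommGroup K] [InnerProductSpace ℂ K]

lemma inner_dyad (x y z : K) : ⟪x, (TraceClass.dyad z).op y⟫_ℂ = ⟪x, z⟫_ℂ * ⟪z, y⟫_ℂ := by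
  rw [TraceClass.dyad_op_apply, inner_smul_right, mul_comm]

lemma norm_dyad_sub_le (x y : K) :
    ‖TraceClass.dyad x - TraceClass.dyad y‖ ≤ (‖x‖ + ‖y‖) * ‖x - y‖ := by
  have split : (TraceClass.dyad x - TraceClass.dyad y).op =
      InnerProductSpace.rankOne ℂ x (x - y) + InnerProductSpace.rankOne ℂ (x - y) y := by
    ext z
    simp
  have h : traceNorm (TraceClass.dyad x - TraceClass.dyad y).op ≤
      ‖x‖ₑ * ‖x - y‖ₑ + ‖x - y‖ₑ * ‖y‖ₑ := by
    rw [split]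
    exact (traceNorm_add_le _ _).trans
      (add_le_add (traceNorm_rankOne_le _ _) (traceNorm_rankOne_le _ _))
  refine (ENNReal.toReal_mono (by finiteness) h).trans_eq ?_
  rw [ENNReal.toReal_add (by finiteness) (by finiteness)]
  simp only [ENNReal.toReal_mul, toReal_enorm]
  ring

lemma continuous_dyad : Continuous (TraceClass.dyad : K → TraceClass K) := by
  refine continuous_iff_continuousAt.2 fun x => tendsto_iff_norm_sub_tendsto_zero.2 <|
    squeeze_zero (fun _ => norm_nonneg _) (fun y => norm_dyad_sub_le y x) ?_
  have : Continuous fun y : K => (‖y‖ + ‖x‖) * ‖y - x‖ := by fun_prop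
  simpa using this.tendsto x

lemma norm_dyad_le (x : K) : ‖TraceClass.dyad x‖ ≤ ‖x‖ ^ 2 := by
  have h0 : TraceClass.dyad (0 : K) = 0 := by ext z; simp
  simpa [h0, sq] using norm_dyad_sub_le x 0

variable [CompleteSpace K]

lemma trace_dyad_comp (x : K) (B : K →L[ℂ] K) :
    trace ((TraceClass.dyad x).op ∘L B) = ⟪x, B x⟫_ℂ := by
  have h : (TraceClass.dyad x).op ∘L B =
      InnerProductSpace.rankOne ℂ x (ContinuousLinearMap.adjoint B x) := by
    ext y
    simp [ContinuousLinearMap.adjoint_inner_left]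
  rw [h, trace_rankOne, ContinuousLinearMap.adjoint_inner_left]

lemma summable_dyad {ι : Type*} {v : ι → K} (hv : Summable fun j => ‖v j‖ ^ 2) :
    Summable fun j => TraceClass.dyad (v j) :=
  .of_norm_bounded hv fun j => norm_dyad_le (v j)

lemma inner_tsum_dyad {ι : Type*} {v : ι → K} (hv : Summable fun j => ‖v j‖ ^ 2) (x y : K) :
    ⟪x, (∑' j, TraceClass.dyad (v j)).op y⟫_ℂ = ∑' j, ⟪x, v j⟫_ℂ * ⟪v j, y⟫_ℂ := by
  rw [← matrixElement_apply, (matrixElement x y).map_tsum (summable_dyad hv)]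
  simp only [matrixElement_apply, inner_dyad]

/-- The vectors are `v j = √ϱ (e j)` for an orthonormal basis `e`. -/
lemma exists_eq_tsum_dyad {ϱ : TraceClass K} (hϱ : ϱ.op.IsPositive) :
    ∃ v : basisIndex K → K, (Summable fun j => ‖v j‖ ^ 2) ∧ ϱ = ∑' j, TraceClass.dyad (v j) := by
  let S := CFC.sqrt ϱ.op
  have sqrt_mul_sqrt : S * S = ϱ.op :=
    CFC.sqrt_mul_sqrt_self _ ((ContinuousLinearMap.nonneg_iff_isPositive _).2 hϱ)
  have isPositive_sqrt : S.IsPositive :=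
    (ContinuousLinearMap.nonneg_iff_isPositive _).1 (CFC.sqrt_nonneg _)
  have inner_sqrt : ∀ x y, ⟪S x, y⟫_ℂ = ⟪x, S y⟫_ℂ := fun x y => isPositive_sqrt.isSymmetric x y
  have inner_op : ∀ x y, ⟪x, ϱ.op y⟫_ℂ = ⟪S x, S y⟫_ℂ := fun x y => by
    rw [inner_sqrt, ← sqrt_mul_sqrt]
    rfl
  have summable_sq : Summable fun j => ‖S (basis K j)‖ ^ 2 := by
    refine (summable_trace ϱ.traceNorm_op_lt_top (basis K).orthonormal).congr fun j => ?_
    rw [inner_op, inner_self_eq_norm_sq_to_K]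
    simp
  refine ⟨fun j => S (basis K j), summable_sq, TraceClass.ext (ContinuousLinearMap.ext fun y => ?_)⟩
  refine ext_inner_left ℂ fun x => ?_
  rw [inner_tsum_dyad summable_sq, inner_op, ← (basis K).tsum_inner_mul_inner]
  simp only [inner_sqrt]

end Dyads

section Ensemble

variable {K : Type*} [NormedAddCommGroup K] [InnerProductSpace ℂ K]
  {X : Type*} [MeasurableSpace X] {μ : Measure X} {F : X → K}

lemma integrable_dyad (hF : MemLp F 2 μ) : Integrable (fun a => TraceClass.dyad (F a)) μ :=
  hF.integrable_norm_pow two_ne_zero |>.mono' (continuous_dyad.comp_aestronglyMeasurable hF.1)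
    (Eventually.of_forall fun _ => norm_dyad_le _)

/-- The mixture `∫ |F⟩⟨F| dμ` of the pure states `F a`, as a Bochner integral in `𝓛¹(K)`. -/
noncomputable def ensemble (μ : Measure X) (F : X → K) : TraceClass K :=
  ∫ a, TraceClass.dyad (F a) ∂μ

variable [CompleteSpace K]

lemma inner_ensemble (hF : MemLp F 2 μ) (x y : K) :
    ⟪x, (ensemble μ F).op y⟫_ℂ = ∫ a, ⟪x, F a⟫_ℂ * ⟪F a, y⟫_ℂ ∂μ := by
  rw [← matrixElement_apply, ensemble,
    ← ContinuousLinearMap.integral_comp_comm _ (integrable_dyad hF)]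
  simp only [matrixElement_apply, inner_dyad]

lemma trace_ensemble_comp (hF : MemLp F 2 μ) (B : K →L[ℂ] K) :
    trace ((ensemble μ F).op ∘L B) = ∫ a, ⟪F a, B (F a)⟫_ℂ ∂μ := by
  rw [← traceComp_apply, ensemble, ← ContinuousLinearMap.integral_comp_comm _ (integrable_dyad hF)]
  simp only [traceComp_apply, trace_dyad_comp]

lemma trace_ensemble (hF : MemLp F 2 μ) :
    trace (ensemble μ F).op = ((∫ a, ‖F a‖ ^ 2 ∂μ : ℝ) : ℂ) := by
  rw [← ContinuousLinearMap.comp_id (ensemble μ F).op, trace_ensemble_comp hF,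
    ← integral_complex_ofReal]
  simp [inner_self_eq_norm_sq_to_K]

lemma isPositive_ensemble (hF : MemLp F 2 μ) : (ensemble μ F).op.IsPositive := by
  have h : ∀ x, ⟪x, (ensemble μ F).op x⟫_ℂ = ((∫ a, ‖⟪x, F a⟫_ℂ‖ ^ 2 ∂μ : ℝ) : ℂ) := fun x => by
    rw [inner_ensemble hF, ← integral_complex_ofReal]
    simp only [← inner_conj_symm (F _) x, Complex.mul_conj, Complex.normSq_eq_norm_sq]
  rw [ContinuousLinearMap.isPositive_iff_complex]
  intro x
  rw [← inner_conj_symm, h x]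
  simp only [Complex.conj_ofReal, RCLike.re_to_complex, Complex.ofReal_re, true_and]
  exact integral_nonneg fun a => by positivity

end Ensemble

lemma exists_perm_of_ofFn_eq {X : Type*} {n : ℕ} {x y : Fin n → X}
    (h : (List.ofFn x : Multiset X) = (List.ofFn y : Multiset X)) :
    ∃ σ : Equiv.Perm (Fin n), y ∘ σ = x := by
  classical
  have hxy : (List.ofFn x).Perm (List.ofFn y) := Multiset.coe_eq_coe.1 h
  let τ : Fin (List.ofFn x).length ≃ Fin (List.ofFn y).length :=
    .ofBijective hxy.idxBij ⟨hxy.idxBij_injective, hxy.idxBij_surjective⟩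
  refine ⟨((finCongr List.length_ofFn).symm.trans τ).trans (finCongr List.length_ofFn),
    funext fun i => ?_⟩
  have := hxy.getElem_idxBij_eq_getElem (Fin.cast List.length_ofFn.symm i)
  simp only [List.getElem_ofFn] at this
  exact this

lemma exists_ofFn {X : Type*} (m : Multiset X) :
    ∃ (n : ℕ) (x : Fin n → X), m = (List.ofFn x : Multiset X) := by
  induction m using Quotient.inductionOn with
  | h l => exact ⟨l.length, l.get, by simp⟩

lemma coe_ofFn_cons {X : Type*} {n : ℕ} (a : X) (x : Fin n → X) :
    (List.ofFn (Fin.cons a x : Fin (n + 1) → X) : Multiset X) =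
      a ::ₘ (List.ofFn x : Multiset X) := by
  rw [List.ofFn_cons, Multiset.cons_coe]

section Tensors

variable {H : Type*} [NormedAddCommGroup H] [InnerProductSpace ℂ H] [CompleteSpace H]

lemma norm_tensor {n : ℕ} (x : Fin n → H) : ‖tensor x‖ = ∏ j, ‖x j‖ := by
  have h := inner_tensor x x
  simp only [inner_self_eq_norm_sq_to_K] at h
  rw [Finset.prod_pow] at h
  exact (pow_left_inj₀ (norm_nonneg _) (Finset.prod_nonneg fun _ _ => norm_nonneg _)
    two_ne_zero).1 (by exact_mod_cast congrArg Complex.re h)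

/-- The map `a ↦ a ⊗ x₀ ⊗ ⋯ ⊗ xₙ₋₁`. -/
noncomputable def tensorCons {n : ℕ} (x : Fin n → H) : H →L[ℂ] TensorPower H (n + 1) :=
  LinearMap.mkContinuous
    { toFun := fun a => tensor (Fin.cons a x : Fin (n + 1) → H)
      map_add' := fun a b => by
        ext I
        change tensor _ I = tensor _ I + tensor _ I
        simp only [tensor_apply, Fin.prod_univ_succ, Fin.cons_zero, Fin.cons_succ,
          inner_add_right, add_mul]
      map_smul' := fun c a => by
        ext I
        change tensor _ I = c * tensor _ I
        simp only [tensor_apply, Fin.prod_univ_succ, Fin.cons_zero, Fin.cons_succ,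
          inner_smul_right, mul_assoc] } (∏ j, ‖x j‖) fun a => by
    refine le_of_eq ((norm_tensor _).trans ?_)
    rw [Fin.prod_univ_succ, mul_comm]
    simp only [Fin.cons_zero, Fin.cons_succ]

/-- The orthogonal projection of an elementary tensor onto the symmetric subspace. -/
noncomputable def symTensor {n : ℕ} (x : Fin n → H) : symPower H n :=
  (symPower H n).orthogonalProjectionOnto (tensor x)

/-- The map `a ↦ symTensor (a, x₀, …, xₙ₋₁)`. -/
noncomputable def symTensorCons {n : ℕ} (x : Fin n → H) : H →L[ℂ] symPower H (n + 1) :=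
  (symPower H (n + 1)).orthogonalProjectionOnto ∘L tensorCons x

lemma inner_symTensor_left {n : ℕ} (x : Fin n → H) (ψ : symPower H n) :
    ⟪symTensor x, ψ⟫_ℂ = ⟪tensor x, (ψ : TensorPower H n)⟫_ℂ :=
  Submodule.inner_orthogonalProjectionOnto_eq_of_mem_right ψ _

lemma symTensor_comp_perm {n : ℕ} (x : Fin n → H) (π : Equiv.Perm (Fin n)) :
    symTensor (x ∘ π) = symTensor x := by
  refine ext_inner_right ℂ fun ψ => ?_
  have h : tensor (x ∘ π) = permOp π (tensor x) := (permOp_tensor π x).symm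
  rw [inner_symTensor_left, inner_symTensor_left, h, ← mem_symPower_iff.1 ψ.2 π,
    LinearIsometry.inner_map_map, mem_symPower_iff.1 ψ.2 π]

lemma symTensor_congr {n : ℕ} {x y : Fin n → H}
    (h : (List.ofFn x : Multiset H) = (List.ofFn y : Multiset H)) : symTensor x = symTensor y := by
  obtain ⟨σ, rfl⟩ := exists_perm_of_ofFn_eq h
  exact symTensor_comp_perm y σ

lemma eq_zero_of_inner_symTensor {n : ℕ} {ψ : symPower H n}
    (h : ∀ x : Fin n → H, ⟪symTensor x, ψ⟫_ℂ = 0) : ψ = 0 := by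
  have span_le : Submodule.span ℂ (Set.range (tensor : (Fin n → H) → TensorPower H n)) ≤
      (ℂ ∙ (ψ : TensorPower H n))ᗮ := Submodule.span_le.2 <| by
    rintro _ ⟨x, rfl⟩
    rw [SetLike.mem_coe, Submodule.mem_orthogonal_singleton_iff_inner_left, ← inner_symTensor_left,
      h]
  have mem_orthogonal : (ψ : TensorPower H n) ∈
      (Submodule.span ℂ (Set.range (tensor : (Fin n → H) → TensorPower H n)))ᗮ := fun u hu =>
    Submodule.mem_orthogonal_singleton_iff_inner_left.1 (span_le hu)
  rw [Submodule.topologicalClosure_eq_top_iff.1 (dense_span_tensor n)] at mem_orthogonal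
  exact Subtype.ext mem_orthogonal

lemma eq_of_inner_symTensor {n : ℕ} {S T : symPower H n →L[ℂ] symPower H n}
    (h : ∀ x y : Fin n → H, ⟪symTensor x, S (symTensor y)⟫_ℂ = ⟪symTensor x, T (symTensor y)⟫_ℂ) :
    S = T := by
  have eq_on_symTensor : ∀ y : Fin n → H, S (symTensor y) = T (symTensor y) := fun y =>
    sub_eq_zero.1 <| eq_zero_of_inner_symTensor fun x => by rw [inner_sub_right, h, sub_self]
  refine ContinuousLinearMap.adjoint.injective (ContinuousLinearMap.ext fun w => ?_)
  refine sub_eq_zero.1 <| eq_zero_of_inner_symTensor fun x => ?_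
  rw [inner_sub_right, ContinuousLinearMap.adjoint_inner_right,
    ContinuousLinearMap.adjoint_inner_right, eq_on_symTensor, sub_self]

lemma inner_tensorPow {n : ℕ} (φ ψ : H) :
    ⟪tensorPow n φ, tensorPow n ψ⟫_ℂ = ⟪φ, ψ⟫_ℂ ^ n :=
  (inner_tensor _ _).trans (Fin.prod_const n _)

lemma norm_tensorPow (n : ℕ) (φ : H) : ‖tensorPow n φ‖ = ‖φ‖ ^ n :=
  (norm_tensor _).trans (Fin.prod_const n _)

lemma inner_symTensor_tensorPow {n : ℕ} (x : Fin n → H) (φ : H) :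
    ⟪symTensor x, tensorPow n φ⟫_ℂ = ∏ j, ⟪x j, φ⟫_ℂ :=
  (inner_symTensor_left _ _).trans (inner_tensor _ _)

lemma continuous_tensorPow (n : ℕ) : Continuous (tensorPow n : H → symPower H n) := by
  have norm_sub_sq : ∀ ψ φ : H, ‖tensorPow n ψ - tensorPow n φ‖ ^ 2 =
      (‖ψ‖ ^ n) ^ 2 - 2 * (⟪ψ, φ⟫_ℂ ^ n).re + (‖φ‖ ^ n) ^ 2 := fun ψ φ => by
    rw [@norm_sub_sq ℂ, inner_tensorPow, norm_tensorPow, norm_tensorPow, RCLike.re_to_complex]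
  refine continuous_iff_continuousAt.2 fun φ => tendsto_iff_norm_sub_tendsto_zero.2 ?_
  have h : Continuous fun ψ : H => ‖tensorPow n ψ - tensorPow n φ‖ ^ 2 := by
    simp only [norm_sub_sq]
    fun_prop
  simpa using (h.tendsto φ).sqrt

end Tensors

section Correlations

variable {H : Type*} [NormedAddCommGroup H] [InnerProductSpace ℂ H] [CompleteSpace H]

/-- The matrix element of `γ n` between the symmetrised elementary tensors of the first and of the
second components of a tuple of length `n`. -/
noncomputable def tupleCorr (γ : ∀ k, TraceClass (symPower H k)) (p : Σ n, Fin n → H × H) : ℂ :=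
  ⟪symTensor (Prod.fst ∘ p.2), (γ p.1).op (symTensor (Prod.snd ∘ p.2))⟫_ℂ

/-- The correlation functions of a sequence of operators: `tupleCorr` depends only on the multiset
of the pairs `(xᵢ, yᵢ)`, which is therefore taken as the argument. By `corr_ofFn` the enumeration
chosen here does not matter. -/
noncomputable def corr (γ : ∀ k, TraceClass (symPower H k)) (m : Multiset (H × H)) : ℂ :=
  tupleCorr γ (List.equivSigmaTuple m.toList)

lemma corr_ofFn (γ : ∀ k, TraceClass (symPower H k)) {n : ℕ} (x : Fin n → H × H) :
    corr γ (List.ofFn x : Multiset (H × H)) =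
      ⟪symTensor (Prod.fst ∘ x), (γ n).op (symTensor (Prod.snd ∘ x))⟫_ℂ := by
  obtain ⟨⟨k, y⟩, hy⟩ := List.equivSigmaTuple.symm.surjective
    (List.ofFn x : Multiset (H × H)).toList
  have enum : List.equivSigmaTuple (List.ofFn x : Multiset (H × H)).toList = ⟨k, y⟩ :=
    (Equiv.symm_apply_eq _).1 hy |>.symm
  have ofFn_y : (List.ofFn y : Multiset (H × H)) = (List.ofFn x : Multiset (H × H)) := by
    rw [← Multiset.coe_toList (List.ofFn x : Multiset (H × H)), ← hy]
    rfl
  obtain rfl : k = n := by simpa using congrArg Multiset.card ofFn_y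
  have ofFn_comp : ∀ p : H × H → H,
      (List.ofFn (p ∘ y) : Multiset H) = (List.ofFn (p ∘ x) : Multiset H) := fun p => by
    simpa only [Multiset.map_coe, List.map_ofFn] using congrArg (Multiset.map p) ofFn_y
  rw [← symTensor_congr (ofFn_comp _), ← symTensor_congr (ofFn_comp _)]
  rw [corr, enum, tupleCorr]

lemma corr_ofFn_cons (γ : ∀ k, TraceClass (symPower H k)) {n : ℕ} (a b : H) (x : Fin n → H × H) :
    corr γ ((a, b) ::ₘ (List.ofFn x : Multiset (H × H))) =
      ⟪symTensorCons (Prod.fst ∘ x) a, (γ (n + 1)).op (symTensorCons (Prod.snd ∘ x) b)⟫_ℂ := by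
  rw [← coe_ofFn_cons, corr_ofFn, Fin.comp_cons, Fin.comp_cons]
  rfl

lemma corr_add_smul_left (γ : ∀ k, TraceClass (symPower H k)) (a a' b : H) (c : ℂ)
    (m : Multiset (H × H)) :
    corr γ ((a + c • a', b) ::ₘ m) =
      corr γ ((a, b) ::ₘ m) + starRingEnd ℂ c * corr γ ((a', b) ::ₘ m) := by
  obtain ⟨n, x, rfl⟩ := exists_ofFn m
  simp only [corr_ofFn_cons, map_add, map_smul, inner_add_left]
  exact congrArg _ (inner_smul_left (𝕜 := ℂ) (E := symPower H (n + 1)) _ _ _)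

lemma corr_add_smul_right (γ : ∀ k, TraceClass (symPower H k)) (a b b' : H) (c : ℂ)
    (m : Multiset (H × H)) :
    corr γ ((a, b + c • b') ::ₘ m) = corr γ ((a, b) ::ₘ m) + c * corr γ ((a, b') ::ₘ m) := by
  obtain ⟨n, x, rfl⟩ := exists_ofFn m
  simp only [corr_ofFn_cons, map_add, map_smul, inner_add_right]
  exact congrArg _ (inner_smul_right (𝕜 := ℂ) (E := symPower H (n + 1)) _ _ _)

lemma corr_exchange (γ : ∀ k, TraceClass (symPower H k)) (a b c d : H) (m : Multiset (H × H)) :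
    corr γ ((a, b) ::ₘ (c, d) ::ₘ m) = corr γ ((a, d) ::ₘ (c, b) ::ₘ m) := by
  obtain ⟨n, x, rfl⟩ := exists_ofFn m
  have swap_right : symTensorCons (Fin.cons d (Prod.snd ∘ x) : Fin (n + 1) → H) b =
      symTensorCons (Fin.cons b (Prod.snd ∘ x) : Fin (n + 1) → H) d := symTensor_congr <| by
    simp only [coe_ofFn_cons]
    exact Multiset.cons_swap _ _ _
  rw [← coe_ofFn_cons (c, d) x, corr_ofFn_cons, ← coe_ofFn_cons (c, b) x, corr_ofFn_cons]
  simp only [Fin.comp_cons, swap_right]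

lemma corr_map_swap {γ : ∀ k, TraceClass (symPower H k)} {m : Multiset (H × H)}
    (h : (γ m.card).op.IsPositive) : corr γ (m.map Prod.swap) = starRingEnd ℂ (corr γ m) := by
  obtain ⟨n, x, rfl⟩ := exists_ofFn m
  rw [Multiset.coe_card, List.length_ofFn] at h
  rw [Multiset.map_coe, List.map_ofFn, corr_ofFn, corr_ofFn]
  exact (h.isSymmetric _ _).symm.trans (inner_conj_symm _ _).symm

lemma eq_of_corr_eq {γ γ' : ∀ k, TraceClass (symPower H k)} (h : corr γ = corr γ') : γ = γ' := by
  funext k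
  refine TraceClass.ext (eq_of_inner_symTensor fun x y => ?_)
  have := congrFun h (List.ofFn fun i => (x i, y i))
  rwa [corr_ofFn, corr_ofFn] at this

end Correlations

section Differences

variable {H : Type*}

/-- The iterated differences `(∏_{b ∈ t} (1 - τ_b)) g`, where `(τ_b g) s = g (b ::ₘ s)`. -/
def iterDiff (g : Multiset H → ℝ) : List H → Multiset H → ℝ
  | [], s => g s
  | b :: t, s => iterDiff g t s - iterDiff g t (b ::ₘ s)

lemma iterDiff_add (g g' : Multiset H → ℝ) (t : List H) (s : Multiset H) :
    iterDiff (g + g') t s = iterDiff g t s + iterDiff g' t s := by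
  induction t generalizing s with
  | nil => rfl
  | cons b t ih => simp only [iterDiff, ih]; ring

lemma iterDiff_const_smul (c : ℝ) (g : Multiset H → ℝ) (t : List H) (s : Multiset H) :
    iterDiff (c • g) t s = c * iterDiff g t s := by
  induction t generalizing s with
  | nil => rfl
  | cons b t ih => simp only [iterDiff, ih]; ring

lemma iterDiff_shift (g : Multiset H → ℝ) (a : H) (t : List H) (s : Multiset H) :
    iterDiff (fun s => g (a ::ₘ s)) t s = iterDiff g t (a ::ₘ s) := by
  induction t generalizing s with
  | nil => rfl
  | cons b t ih => simp only [iterDiff, ih, Multiset.cons_swap a b]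

lemma tendsto_iterDiff {ι : Type*} {l : Filter ι} {g : ι → Multiset H → ℝ} {g' : Multiset H → ℝ}
    (h : ∀ s, Tendsto (fun i => g i s) l (𝓝 (g' s))) (t : List H) (s : Multiset H) :
    Tendsto (fun i => iterDiff (g i) t s) l (𝓝 (iterDiff g' t s)) := by
  induction t generalizing s with
  | nil => exact h s
  | cons b t ih => exact (ih s).sub (ih _)

lemma hasSum_iterDiff {g : Multiset H → ℝ} {N : ℕ} {ι : Type*} {e : ι → H}
    (hg : ∀ s : Multiset H, s.card < N → HasSum (fun i => g (e i ::ₘ s)) (g s))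
    (t : List H) (s : Multiset H) (h : t.length + s.card < N) :
    HasSum (fun i => iterDiff g t (e i ::ₘ s)) (iterDiff g t s) := by
  induction t generalizing s with
  | nil => exact hg s (by simpa using h)
  | cons a t ih =>
    rw [List.length_cons] at h
    simp only [iterDiff, Multiset.cons_swap a]
    exact (ih s (by omega)).sub (ih (a ::ₘ s) (by rw [Multiset.card_cons]; omega))

variable [NormedAddCommGroup H] [InnerProductSpace ℂ H]

lemma iterDiff_smul {g : Multiset H → ℝ}
    (hg : ∀ (c : ℂ) (b : H) (s : Multiset H), g ((c • b) ::ₘ s) = ‖c‖ ^ 2 * g (b ::ₘ s))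
    (t : List H) (c : ℂ) (b : H) (s : Multiset H) :
    iterDiff g t ((c • b) ::ₘ s) = ‖c‖ ^ 2 * iterDiff g t (b ::ₘ s) := by
  induction t generalizing s with
  | nil => exact hg c b s
  | cons a t ih => simp only [iterDiff, Multiset.cons_swap a, ih, mul_sub]

lemma le_of_hasSum_hilbertBasis [CompleteSpace H] {g : H → ℝ} {S : ℝ} (hg : ∀ b, 0 ≤ g b)
    (hsmul : ∀ (c : ℂ) (b : H), g (c • b) = ‖c‖ ^ 2 * g b)
    (hsum : ∀ (w : Set H) (e : HilbertBasis w ℂ H), HasSum (fun i => g (e i)) S)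
    {b : H} (hb : ‖b‖ ≤ 1) : g b ≤ S := by
  rcases eq_or_ne b 0 with rfl | hb0
  · obtain ⟨w, e, -⟩ := exists_hilbertBasis ℂ H
    have g_zero : g 0 = 0 := by simpa using hsmul 0 0
    exact g_zero.trans_le ((hsum w e).nonneg fun i => hg _)
  have norm_ne : (‖b‖ : ℂ) ≠ 0 := by simpa using hb0
  let u : H := (‖b‖ : ℂ)⁻¹ • b
  have orthonormal_u : Orthonormal ℂ ((↑) : ({u} : Set H) → H) :=
    ⟨fun i => by rw [i.2]; exact norm_smul_inv_norm hb0,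
      fun i j hij => (hij (Subsingleton.elim _ _)).elim⟩
  obtain ⟨w, e, hw, he⟩ := orthonormal_u.exists_hilbertBasis_extension
  have g_u_le : g u ≤ S := by
    simpa only [he] using le_hasSum (hsum w e) ⟨u, hw rfl⟩ fun _ _ => hg _
  calc g b = ‖(‖b‖ : ℂ)‖ ^ 2 * g u := by rw [← hsmul, smul_inv_smul₀ norm_ne]
    _ ≤ 1 * g u := by
        gcongr
        · exact hg u
        · exact pow_le_one₀ (norm_nonneg _) (by simpa using hb)
    _ ≤ S := by rwa [one_mul]

lemma iterDiff_nonneg [CompleteSpace H] {g : Multiset H → ℝ} {N : ℕ}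
    (hg : ∀ s : Multiset H, s.card ≤ N → 0 ≤ g s)
    (hsmul : ∀ (c : ℂ) (b : H) (s : Multiset H), g ((c • b) ::ₘ s) = ‖c‖ ^ 2 * g (b ::ₘ s))
    (hsum : ∀ (w : Set H) (e : HilbertBasis w ℂ H) (s : Multiset H), s.card < N →
      HasSum (fun i => g (e i ::ₘ s)) (g s))
    (t : List H) (s : Multiset H) (h : t.length + s.card ≤ N) (ht : ∀ b ∈ t, ‖b‖ ≤ 1) :
    0 ≤ iterDiff g t s := by
  induction t generalizing s with
  | nil => exact hg s (by simpa using h)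
  | cons b t ih =>
    rw [List.length_cons] at h
    rw [List.forall_mem_cons] at ht
    refine sub_nonneg.2 (le_of_hasSum_hilbertBasis (g := fun a => iterDiff g t (a ::ₘ s))
      (fun a => ih _ ?_ ht.2) (fun c a => iterDiff_smul hsmul t c a s)
      (fun w e => hasSum_iterDiff (hsum w e) t s (by omega)) ht.1)
    rw [Multiset.card_cons]
    omega

end Differences

section Slices

variable {H : Type*} [NormedAddCommGroup H] [InnerProductSpace ℂ H] [CompleteSpace H]

lemma apply_congr_of_mem_symPower {n : ℕ} {ψ : TensorPower H n} (hψ : ψ ∈ symPower H n)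
    {I I' : Fin n → basisIndex H}
    (h : (List.ofFn I : Multiset (basisIndex H)) = (List.ofFn I' : Multiset (basisIndex H))) :
    ψ I = ψ I' := by
  obtain ⟨σ, rfl⟩ := exists_perm_of_ofFn_eq h
  rw [← mem_symPower_iff.1 hψ σ, permOp_apply, Function.comp_assoc, Equiv.self_comp_symm,
    Function.comp_id, mem_symPower_iff.1 hψ σ]

lemma slice_mem_symPower {k m : ℕ} (J : Fin m → basisIndex H) {ψ : TensorPower H (k + m)}
    (hψ : ψ ∈ symPower H (k + m)) : slice J ψ ∈ symPower H k := by
  refine mem_symPower_iff.2 fun π => lp.ext (funext fun I => ?_)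
  rw [permOp_apply]
  refine apply_congr_of_mem_symPower hψ ?_
  rw [List.ofFn_fin_append, List.ofFn_fin_append, Multiset.coe_eq_coe]
  exact (Equiv.Perm.ofFn_comp_perm π.symm I).append_right _

lemma hasSum_inner_slice {k m : ℕ} (ψ χ : TensorPower H (k + m)) :
    HasSum (fun J : Fin m → basisIndex H => ⟪slice J ψ, slice J χ⟫_ℂ) ⟪ψ, χ⟫_ℂ :=
  HasSum.prod_fiberwise (((Equiv.prodComm _ _).trans
      (Fin.appendEquiv (α := basisIndex H) k m)).hasSum_iff.2 (lp.hasSum_inner ψ χ))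
    fun J => lp.hasSum_inner (slice J ψ) (slice J χ)

lemma slice_ampliation {k m : ℕ} (A : TensorPower H k →L[ℂ] TensorPower H k)
    (ψ : TensorPower H (k + m)) (J : Fin m → basisIndex H) :
    slice J (ampliation m A ψ) = A (slice J ψ) := by
  ext I
  change ampliation m A ψ (Fin.append I J) = _
  simp only [ampliation_apply, Fin.append_left, Fin.append_right]

lemma slice_tensor_append {k m : ℕ} (x : Fin k → H) (y : Fin m → H) (J : Fin m → basisIndex H) :
    slice J (tensor (Fin.append x y)) = tensor y J • tensor x := by
  ext I
  change tensor (Fin.append x y) (Fin.append I J) = tensor y J * tensor x I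
  simp only [tensor_apply, Fin.prod_univ_add, Fin.append_left, Fin.append_right]
  exact mul_comm _ _

lemma tensor_basis_apply {n : ℕ} (J I : Fin n → basisIndex H) [Decidable (I = J)] :
    tensor (basis H ∘ J) I = if I = J then 1 else 0 := by
  classical
  simp only [tensor_apply, Function.comp_apply, orthonormal_iff_ite.1 (basis H).orthonormal,
    Finset.prod_ite_zero, Finset.prod_const_one, Finset.mem_univ, true_implies, funext_iff]

lemma inner_tensor_basis {n : ℕ} (J : Fin n → basisIndex H) (ψ : TensorPower H n) :
    ⟪tensor (basis H ∘ J), ψ⟫_ℂ = ψ J := by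
  classical
  rw [lp.inner_eq_tsum, tsum_eq_single J fun I hI => by rw [tensor_basis_apply, if_neg hI]; simp,
    tensor_basis_apply, if_pos rfl]
  simp

lemma inner_tensor_append_basis {k m : ℕ} (x : Fin k → H) (J : Fin m → basisIndex H)
    (ψ : TensorPower H (k + m)) :
    ⟪tensor (Fin.append x (basis H ∘ J)), ψ⟫_ℂ = ⟪tensor x, slice J ψ⟫_ℂ := by
  classical
  rw [← (hasSum_inner_slice _ ψ).tsum_eq, tsum_eq_single J fun I hI => by
    rw [slice_tensor_append, tensor_basis_apply, if_neg hI, zero_smul, inner_zero_left],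
    slice_tensor_append, tensor_basis_apply, if_pos rfl, one_smul]

lemma hasSum_inner_ampliation_rankOne {k m : ℕ} (u : TensorPower H k)
    (ψ : TensorPower H (k + m)) :
    HasSum (fun J : Fin m → basisIndex H => ⟪u, slice J ψ⟫_ℂ * ⟪slice J ψ, u⟫_ℂ)
      ⟪ψ, ampliation m (InnerProductSpace.rankOne ℂ u u) ψ⟫_ℂ := by
  simpa only [slice_ampliation, InnerProductSpace.rankOne_apply, inner_smul_right] using
    hasSum_inner_slice ψ (ampliation m (InnerProductSpace.rankOne ℂ u u) ψ)

lemma extendOp_rankOne {k : ℕ} (u : symPower H k) :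
    extendOp (InnerProductSpace.rankOne ℂ u u) =
      InnerProductSpace.rankOne ℂ (u : TensorPower H k) (u : TensorPower H k) := by
  ext1 ψ
  change (((InnerProductSpace.rankOne ℂ u u) ((symPower H k).orthogonalProjectionOnto ψ) :
    symPower H k) : TensorPower H k) = _
  rw [InnerProductSpace.rankOne_apply, InnerProductSpace.rankOne_apply,
    Submodule.inner_orthogonalProjectionOnto_eq_of_mem_left]
  rfl

lemma inner_extendOp {k : ℕ} (A : symPower H k →L[ℂ] symPower H k) (x y : TensorPower H k) :
    ⟪x, extendOp A y⟫_ℂ = ⟪(symPower H k).orthogonalProjectionOnto x,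
      A ((symPower H k).orthogonalProjectionOnto y)⟫_ℂ :=
  (Submodule.inner_orthogonalProjectionOnto_eq_of_mem_right _ _).symm

lemma extendOp_tsum_dyad {n : ℕ} {ι : Type*} {v : ι → symPower H n}
    (hv : Summable fun j => ‖v j‖ ^ 2) :
    extendOp (∑' j, TraceClass.dyad (v j)).op =
      (∑' j, TraceClass.dyad (v j : TensorPower H n)).op := by
  refine ContinuousLinearMap.ext fun y => ext_inner_left ℂ fun x => ?_
  rw [inner_extendOp, inner_tsum_dyad hv,
    inner_tsum_dyad (v := fun j => (v j : TensorPower H n)) hv]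
  refine tsum_congr fun j => ?_
  rw [Submodule.inner_orthogonalProjectionOnto_eq_of_mem_right,
    Submodule.inner_orthogonalProjectionOnto_eq_of_mem_left]

end Slices

section MomentFunctions

variable {H : Type*} [NormedAddCommGroup H] [InnerProductSpace ℂ H]

/-- The restriction of a function of pairs to the diagonal. -/
def diag (ℓ : Multiset (H × H) → ℂ) (s : Multiset H) : ℝ := (ℓ (s.map fun a => (a, a))).re

/-- `ℓ` is conjugate linear in the first and linear in the second component of each pair. -/
structure IsSesquilinear (ℓ : Multiset (H × H) → ℂ) : Prop where
  add_smul_left : ∀ (a a' b : H) (c : ℂ) (m : Multiset (H × H)),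
    ℓ ((a + c • a', b) ::ₘ m) = ℓ ((a, b) ::ₘ m) + starRingEnd ℂ c * ℓ ((a', b) ::ₘ m)
  add_smul_right : ∀ (a b b' : H) (c : ℂ) (m : Multiset (H × H)),
    ℓ ((a, b + c • b') ::ₘ m) = ℓ ((a, b) ::ₘ m) + c * ℓ ((a, b') ::ₘ m)

/-- The properties of `m ↦ ∫ ∏_{(a, b) ∈ m} ⟪a, φ⟫ ⟪φ, b⟫ dμ(φ)`, for a finite measure `μ` on the
unit ball, that characterise such functions (see `exists_measure_of_isMomentFunction`). -/
structure IsMomentFunction (ℓ : Multiset (H × H) → ℂ) : Prop extends IsSesquilinear ℓ where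
  map_swap : ∀ m : Multiset (H × H), ℓ (m.map Prod.swap) = starRingEnd ℂ (ℓ m)
  exchange : ∀ (a b c d : H) (m : Multiset (H × H)),
    ℓ ((a, b) ::ₘ (c, d) ::ₘ m) = ℓ ((a, d) ::ₘ (c, b) ::ₘ m)
  iterDiff_diag_nonneg : ∀ (t : List H) (s : Multiset H), (∀ b ∈ t, ‖b‖ ≤ 1) →
    0 ≤ iterDiff (diag ℓ) t s

namespace IsSesquilinear

variable {ℓ : Multiset (H × H) → ℂ}

/-- The sesquilinear form `(a, b) ↦ ℓ ((a, b) ::ₘ m)`. -/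
def form (h : IsSesquilinear ℓ) (m : Multiset (H × H)) : H →ₗ⋆[ℂ] H →ₗ[ℂ] ℂ :=
  have zero_left : ∀ b, ℓ ((0, b) ::ₘ m) = 0 := fun b => by simpa using h.add_smul_left 0 0 b 1 m
  have zero_right : ∀ a, ℓ ((a, 0) ::ₘ m) = 0 := fun a => by simpa using h.add_smul_right a 0 0 1 m
  LinearMap.mk₂'ₛₗ (starRingEnd ℂ) (RingHom.id ℂ) (fun a b => ℓ ((a, b) ::ₘ m))
    (fun a a' b => by simpa using h.add_smul_left a a' b 1 m)
    (fun c a b => by simpa [zero_left] using h.add_smul_left 0 a b c m)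
    (fun a b b' => by simpa using h.add_smul_right a b b' 1 m)
    (fun c a b => by simpa [zero_right] using h.add_smul_right a 0 b c m)

lemma form_apply (h : IsSesquilinear ℓ) (m : Multiset (H × H)) (a b : H) :
    h.form m a b = ℓ ((a, b) ::ₘ m) := rfl

lemma smul_smul_cons (h : IsSesquilinear ℓ) (c : ℂ) (b : H) (m : Multiset (H × H)) :
    ℓ ((c • b, c • b) ::ₘ m) = (‖c‖ ^ 2 : ℝ) * ℓ ((b, b) ::ₘ m) := by
  simp only [← h.form_apply, map_smul, LinearMap.map_smulₛₗ, LinearMap.smul_apply, smul_eq_mul]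
  rw [← mul_assoc, mul_comm c, ← Complex.normSq_eq_conj_mul_self, Complex.normSq_eq_norm_sq]

lemma diag_smul (h : IsSesquilinear ℓ) (c : ℂ) (b : H) (s : Multiset H) :
    diag ℓ ((c • b) ::ₘ s) = ‖c‖ ^ 2 * diag ℓ (b ::ₘ s) := by
  simp only [diag, Multiset.map_cons, h.smul_smul_cons, Complex.re_ofReal_mul]

lemma polarization (h : IsSesquilinear ℓ) (a b : H) (m : Multiset (H × H)) :
    ℓ ((a, b) ::ₘ m) = 1 / 4 * ∑ k ∈ Finset.range 4, (-Complex.I) ^ k *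
      ℓ ((a + Complex.I ^ k • b, a + Complex.I ^ k • b) ::ₘ m) := by
  have neg_I_cubed : (-Complex.I) ^ 3 = Complex.I := by
    rw [Odd.neg_pow (by decide), Complex.I_pow_three, neg_neg]
  simp only [h.add_smul_left, h.add_smul_right, Finset.sum_range_succ, Finset.sum_range_zero,
    map_pow, Complex.conj_I, Complex.I_pow_three, neg_I_cubed, pow_zero, pow_one, neg_sq,
    Complex.I_sq]
  linear_combination (ℓ ((a, b) ::ₘ m) - ℓ ((b, a) ::ₘ m)) / 2 * Complex.I_sq

end IsSesquilinear

end MomentFunctions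

section ReducedDensities

lemma ofReal_re_eq_tsum {ι : Type*} {f : ι → ℂ} {z : ℂ} (hf : HasSum f z)
    (h0 : ∀ i, 0 ≤ (f i).re) : ENNReal.ofReal z.re = ∑' i, ENNReal.ofReal (f i).re := by
  have h := Complex.hasSum_re hf
  rw [← ENNReal.ofReal_tsum_of_nonneg h0 h.summable, h.tsum_eq]

section Hilbert

variable {K : Type*} [NormedAddCommGroup K] [InnerProductSpace ℂ K]

lemma re_inner_mul_inner_symm (x y : K) : (⟪x, y⟫_ℂ * ⟪y, x⟫_ℂ).re = ‖⟪x, y⟫_ℂ‖ ^ 2 := by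
  rw [← inner_conj_symm y x, Complex.mul_conj, Complex.ofReal_re, Complex.normSq_eq_norm_sq]

lemma ofReal_re_inner_mul_inner_symm (x y : K) :
    ENNReal.ofReal (⟪x, y⟫_ℂ * ⟪y, x⟫_ℂ).re = ‖⟪x, y⟫_ℂ‖ₑ ^ 2 := by
  rw [re_inner_mul_inner_symm, ENNReal.ofReal_pow (norm_nonneg _), ofReal_norm]

lemma ofReal_re_inner_tsum_dyad [CompleteSpace K] {ι : Type*} {v : ι → K}
    (hv : Summable fun j => ‖v j‖ ^ 2) (x : K) :
    ENNReal.ofReal (⟪x, (∑' j, TraceClass.dyad (v j)).op x⟫_ℂ).re = ∑' j, ‖⟪x, v j⟫_ℂ‖ₑ ^ 2 := by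
  have h := (matrixElement x x).hasSum (summable_dyad hv).hasSum
  simp only [matrixElement_apply, inner_dyad] at h
  rw [ofReal_re_eq_tsum h fun j => by rw [re_inner_mul_inner_symm]; positivity]
  simp only [ofReal_re_inner_mul_inner_symm]

lemma ofReal_re_trace_tsum_dyad_comp [CompleteSpace K] {ι : Type*} {v : ι → K}
    (hv : Summable fun j => ‖v j‖ ^ 2) {B : K →L[ℂ] K} (hB : ∀ x, 0 ≤ (⟪x, B x⟫_ℂ).re) :
    ENNReal.ofReal (trace ((∑' j, TraceClass.dyad (v j)).op ∘L B)).re =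
      ∑' j, ENNReal.ofReal (⟪v j, B (v j)⟫_ℂ).re := by
  have h := (traceComp B).hasSum (summable_dyad hv).hasSum
  simp only [traceComp_apply, trace_dyad_comp] at h
  exact ofReal_re_eq_tsum h fun j => hB _

lemma tsum_inner_map_hilbertBasis_eq {L : Type*} [NormedAddCommGroup L] [InnerProductSpace ℂ L]
    [CompleteSpace K] [CompleteSpace L] {ϱ : TraceClass K} (hϱ : ϱ.op.IsPositive) (A : L →L[ℂ] K)
    {ι ι' : Type*} (e : HilbertBasis ι ℂ L) (e' : HilbertBasis ι' ℂ L) :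
    ∑' i, ENNReal.ofReal (⟪A (e i), ϱ.op (A (e i))⟫_ℂ).re =
      ∑' i, ENNReal.ofReal (⟪A (e' i), ϱ.op (A (e' i))⟫_ℂ).re := by
  obtain ⟨v, hv, rfl⟩ := exists_eq_tsum_dyad hϱ
  simp only [ofReal_re_inner_tsum_dyad hv]
  simp only [← ContinuousLinearMap.adjoint_inner_right A]
  rw [ENNReal.tsum_comm, ENNReal.tsum_comm (α := ι')]
  simp only [tsum_enorm_inner_sq]

end Hilbert

variable {H : Type*} [NormedAddCommGroup H] [InnerProductSpace ℂ H] [CompleteSpace H]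

lemma isSesquilinear_corr (γ : ∀ k, TraceClass (symPower H k)) : IsSesquilinear (corr γ) :=
  ⟨corr_add_smul_left γ, corr_add_smul_right γ⟩

lemma diag_corr_ofFn (γ : ∀ k, TraceClass (symPower H k)) {n : ℕ} (x : Fin n → H) :
    diag (corr γ) (List.ofFn x) = (⟪symTensor x, (γ n).op (symTensor x)⟫_ℂ).re := by
  rw [diag, Multiset.map_coe, List.map_ofFn, corr_ofFn]
  rfl

lemma diag_corr_cons_ofFn (γ : ∀ k, TraceClass (symPower H k)) {n : ℕ} (a : H) (x : Fin n → H) :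
    diag (corr γ) (a ::ₘ (List.ofFn x : Multiset H)) =
      (⟪symTensorCons x a, (γ (n + 1)).op (symTensorCons x a)⟫_ℂ).re := by
  rw [← coe_ofFn_cons, diag_corr_ofFn]
  rfl

lemma diag_corr_nonneg {γ : ∀ k, TraceClass (symPower H k)} {s : Multiset H}
    (h : (γ s.card).op.IsPositive) : 0 ≤ diag (corr γ) s := by
  obtain ⟨n, x, rfl⟩ := exists_ofFn s
  rw [Multiset.coe_card, List.length_ofFn] at h
  rw [diag_corr_ofFn]
  exact h.re_inner_nonneg_right _

lemma tsum_diag_corr_cons_hilbertBasis_eq {γ : ∀ k, TraceClass (symPower H k)} {s : Multiset H}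
    (h : (γ (s.card + 1)).op.IsPositive) {ι ι' : Type*} (e : HilbertBasis ι ℂ H)
    (e' : HilbertBasis ι' ℂ H) :
    ∑' i, ENNReal.ofReal (diag (corr γ) (e i ::ₘ s)) =
      ∑' i, ENNReal.ofReal (diag (corr γ) (e' i ::ₘ s)) := by
  obtain ⟨n, x, rfl⟩ := exists_ofFn s
  rw [Multiset.coe_card, List.length_ofFn] at h
  simp only [diag_corr_cons_ofFn]
  exact tsum_inner_map_hilbertBasis_eq h (symTensorCons x) e e'

lemma ofReal_inner_reducedDensity {k m : ℕ} {ϱ : TraceClass (symPower H (k + m))}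
    {r : TraceClass (symPower H k)} (hϱ : ϱ.op.IsPositive) (hr : IsReducedDensity ϱ r)
    (x : Fin k → H) :
    ENNReal.ofReal (⟪symTensor x, r.op (symTensor x)⟫_ℂ).re =
      ∑' J : Fin m → basisIndex H,
        ENNReal.ofReal (⟪symTensor (Fin.append x (basis H ∘ J)),
          ϱ.op (symTensor (Fin.append x (basis H ∘ J)))⟫_ℂ).re := by
  obtain ⟨v, hv, rfl⟩ := exists_eq_tsum_dyad hϱ
  set u : TensorPower H k := ↑(symTensor x : symPower H k)
  have re_inner_nonneg : ∀ (ψ : TensorPower H (k + m)) (J : Fin m → basisIndex H),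
      0 ≤ (⟪u, slice J ψ⟫_ℂ * ⟪slice J ψ, u⟫_ℂ).re := fun ψ J => by
    rw [re_inner_mul_inner_symm]
    positivity
  have inner_slice : ∀ (j) (J : Fin m → basisIndex H),
      ⟪u, slice J (v j : TensorPower H (k + m))⟫_ℂ =
        ⟪symTensor (Fin.append x (basis H ∘ J)), v j⟫_ℂ  := fun j J => by
    rw [inner_symTensor_left, inner_tensor_append_basis]
    exact inner_symTensor_left x ⟨_, slice_mem_symPower J (v j).2⟩
  have trace_eq := hr.2 (InnerProductSpace.rankOne ℂ (symTensor x) (symTensor x))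
  rw [trace_comp_rankOne, extendOp_rankOne, extendOp_tsum_dyad hv] at trace_eq
  rw [← trace_eq, ofReal_re_trace_tsum_dyad_comp (v := fun j => (v j : TensorPower H (k + m))) hv
    fun ψ => (Complex.hasSum_re (hasSum_inner_ampliation_rankOne u ψ)).nonneg (re_inner_nonneg ψ)]
  simp only [ofReal_re_inner_tsum_dyad hv, ← inner_slice]
  rw [ENNReal.tsum_comm]
  refine tsum_congr fun j => ?_
  rw [ofReal_re_eq_tsum (hasSum_inner_ampliation_rankOne u _) (re_inner_nonneg _)]
  simp only [ofReal_re_inner_mul_inner_symm]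

lemma ofReal_diag_corr_reducedDensity {ϱ r : ∀ k, TraceClass (symPower H k)} {s : Multiset H}
    {m : ℕ} (hϱ : (ϱ (s.card + m)).op.IsPositive)
    (hr : IsReducedDensity (ϱ (s.card + m)) (r s.card)) :
    ENNReal.ofReal (diag (corr r) s) = ∑' J : Fin m → basisIndex H,
      ENNReal.ofReal (diag (corr ϱ) (s + (List.ofFn (basis H ∘ J) : Multiset H))) := by
  obtain ⟨k, x, rfl⟩ := exists_ofFn s
  rw [Multiset.coe_card, List.length_ofFn] at hϱ hr
  simp only [Multiset.coe_add, ← List.ofFn_fin_append, diag_corr_ofFn]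
  exact ofReal_inner_reducedDensity hϱ hr x

/-- `r` consists of the reduced density matrices of the `N`-particle state `ϱ N`. The state is given
as a member of a family, and `N` as a variable, so that no transport along `k + m = N` is needed. -/
def IsReducedFamily (ϱ r : ∀ k, TraceClass (symPower H k)) (N : ℕ) : Prop :=
  ∀ k m, k + m = N → IsReducedDensity (ϱ (k + m)) (r k)

lemma hasSum_diag_corr {ϱ r : ∀ k, TraceClass (symPower H k)} {N : ℕ} (hϱ : (ϱ N).op.IsPositive)
    (hr : IsReducedFamily ϱ r N) {ι : Type*} (e : HilbertBasis ι ℂ H) {s : Multiset H}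
    (hs : s.card < N) : HasSum (fun i => diag (corr r) (e i ::ₘ s)) (diag (corr r) s) := by
  obtain ⟨m, rfl⟩ := Nat.exists_eq_add_of_lt hs
  have card_cons : ∀ a, (a ::ₘ s).card + m = s.card + m + 1 := fun a => by
    rw [Multiset.card_cons]; omega
  have nonneg_cons : ∀ a, 0 ≤ diag (corr r) (a ::ₘ s) := fun a =>
    diag_corr_nonneg (hr _ m (card_cons a)).1
  have card_add : ∀ J : Fin m → basisIndex H,
      (s + (List.ofFn (basis H ∘ J) : Multiset H)).card + 1 = s.card + m + 1 := fun J => by simp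
  have tsum_eq : ∑' i, ENNReal.ofReal (diag (corr r) (e i ::ₘ s)) =
      ENNReal.ofReal (diag (corr r) s) := calc
    _ = ∑' (i) (J : Fin m → basisIndex H), ENNReal.ofReal
          (diag (corr ϱ) (e i ::ₘ (s + (List.ofFn (basis H ∘ J) : Multiset H)))) :=
        tsum_congr fun i => by
          rw [ofReal_diag_corr_reducedDensity (by rwa [card_cons]) (hr _ m (card_cons _))]
          simp only [Multiset.cons_add]
    _ = ∑' (J : Fin m → basisIndex H) (i), ENNReal.ofReal
          (diag (corr ϱ) (basis H i ::ₘ (s + (List.ofFn (basis H ∘ J) : Multiset H)))) := by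
        rw [ENNReal.tsum_comm]
        exact tsum_congr fun J =>
          tsum_diag_corr_cons_hilbertBasis_eq (by rwa [card_add]) e (basis H)
    _ = ∑' J : Fin (m + 1) → basisIndex H, ENNReal.ofReal
          (diag (corr ϱ) (s + (List.ofFn (basis H ∘ J) : Multiset H))) := by
        rw [← (Fin.consEquiv fun _ : Fin (m + 1) => (basisIndex H : Type _)).tsum_eq,
          ENNReal.tsum_prod', ENNReal.tsum_comm]
        refine tsum_congr fun i => tsum_congr fun J => ?_
        change _ = ENNReal.ofReal (diag (corr ϱ)
          (s + (List.ofFn (basis H ∘ (Fin.cons i J : Fin (m + 1) → basisIndex H)) : Multiset H)))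
        rw [Fin.comp_cons, coe_ofFn_cons, Multiset.add_cons]
    _ = ENNReal.ofReal (diag (corr r) s) :=
        (ofReal_diag_corr_reducedDensity hϱ (hr s.card (m + 1) rfl)).symm
  have h := ENNReal.hasSum_toReal (tsum_eq.trans_ne ENNReal.ofReal_ne_top)
  rw [← ENNReal.tsum_toReal_eq fun _ => ENNReal.ofReal_ne_top, tsum_eq,
    ENNReal.toReal_ofReal (diag_corr_nonneg (hr s.card (m + 1) rfl).1)] at h
  simpa only [ENNReal.toReal_ofReal (nonneg_cons _)] using h

lemma tsum_ofReal_diag_corr_basis {ϱ : ∀ k, TraceClass (symPower H k)} {N : ℕ}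
    (hϱ : (ϱ N).op.IsPositive) :
    ∑' J : Fin N → basisIndex H,
      ENNReal.ofReal (diag (corr ϱ) (List.ofFn (basis H ∘ J) : Multiset H)) =
      ENNReal.ofReal (trace (ϱ N).op).re := by
  simp only [diag_corr_ofFn]
  generalize ϱ N = ϱ at hϱ
  obtain ⟨v, hv, rfl⟩ := exists_eq_tsum_dyad hϱ
  have trace_eq := ofReal_re_trace_tsum_dyad_comp hv (B := .id ℂ _) fun x =>
    inner_self_nonneg (𝕜 := ℂ) (x := x)
  rw [ContinuousLinearMap.comp_id] at trace_eq
  rw [trace_eq]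
  simp only [ofReal_re_inner_tsum_dyad hv]
  simp only [inner_symTensor_left, inner_tensor_basis]
  rw [ENNReal.tsum_comm]
  refine tsum_congr fun j => ?_
  rw [← enorm_sq_eq_tsum, ← ofReal_norm, ← ENNReal.ofReal_pow (norm_nonneg _)]
  exact congrArg ENNReal.ofReal (norm_sq_eq_re_inner (𝕜 := ℂ) (v j))

lemma diag_corr_zero {ϱ r : ∀ k, TraceClass (symPower H k)} {N : ℕ} (hϱ : IsNormalState (ϱ N))
    (hr : IsReducedFamily ϱ r N) : diag (corr r) 0 = 1 := by
  have h : ENNReal.ofReal (diag (corr r) 0) = 1 := by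
    rw [ofReal_diag_corr_reducedDensity (m := N) (by rw [Multiset.card_zero, zero_add]; exact hϱ.1)
      (hr 0 N (zero_add N))]
    simp only [zero_add, tsum_ofReal_diag_corr_basis hϱ.1, hϱ.2, Complex.one_re, ENNReal.ofReal_one]
  rwa [ENNReal.ofReal_eq_one] at h

lemma iterDiff_diag_corr_nonneg {ϱ r : ∀ k, TraceClass (symPower H k)} {N : ℕ}
    (hϱ : (ϱ N).op.IsPositive) (hr : IsReducedFamily ϱ r N) (t : List H) (s : Multiset H)
    (h : t.length + s.card ≤ N) (ht : ∀ b ∈ t, ‖b‖ ≤ 1) : 0 ≤ iterDiff (diag (corr r)) t s :=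
  iterDiff_nonneg
    (fun s hs => diag_corr_nonneg (hr s.card (N - s.card) (Nat.add_sub_cancel' hs)).1)
    (isSesquilinear_corr r).diag_smul (fun _ e _ hs => hasSum_diag_corr hϱ hr e hs) t s h ht

end ReducedDensities

section Hierarchies

variable {H : Type*} [NormedAddCommGroup H] [InnerProductSpace ℂ H] [CompleteSpace H]

lemma tendsto_corr {ι : Type*} {l : Filter ι} {γ : ι → ∀ k, TraceClass (symPower H k)}
    {γ' : ∀ k, TraceClass (symPower H k)}
    (h : ∀ (k : ℕ) (A : symPower H k →L[ℂ] symPower H k), IsCompactOperator A →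
      Tendsto (fun i => trace ((γ i k).op ∘L A)) l (𝓝 (trace ((γ' k).op ∘L A))))
    (m : Multiset (H × H)) : Tendsto (fun i => corr (γ i) m) l (𝓝 (corr γ' m)) := by
  obtain ⟨n, x, rfl⟩ := exists_ofFn m
  simp only [corr_ofFn, ← trace_comp_rankOne]
  exact h n _ (isCompactOperator_rankOne _ _)

lemma isMomentFunction_of_tendsto_corr {ϱ r : ℕ → ∀ k, TraceClass (symPower H k)}
    {γ : ∀ k, TraceClass (symPower H k)} {N : ℕ → ℕ} (hN : Tendsto N atTop atTop)
    (hϱ : ∀ i, (ϱ i (N i)).op.IsPositive) (hr : ∀ i, IsReducedFamily (ϱ i) (r i) (N i))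
    (h : ∀ m, Tendsto (fun i => corr (r i) m) atTop (𝓝 (corr γ m))) :
    IsMomentFunction (corr γ) where
  toIsSesquilinear := isSesquilinear_corr γ
  exchange := corr_exchange γ
  map_swap m := by
    refine tendsto_nhds_unique_of_eventuallyEq (h _)
      ((Complex.continuous_conj.tendsto _).comp (h m)) ?_
    filter_upwards [hN.eventually_ge_atTop m.card] with i hi
    exact corr_map_swap (hr i m.card (N i - m.card) (Nat.add_sub_cancel' hi)).1
  iterDiff_diag_nonneg t s ht := by
    refine ge_of_tendsto (tendsto_iterDiff
      (fun s => (Complex.continuous_re.tendsto _).comp (h _)) t s) ?_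
    filter_upwards [hN.eventually_ge_atTop (t.length + s.card)] with i hi
    exact iterDiff_diag_corr_nonneg (hϱ i) (hr i) t s hi ht

lemma isMomentFunction_corr {γ : ∀ k, TraceClass (symPower H k)} (hγ : γ ∈ symHierarchies H) :
    IsMomentFunction (corr γ) ∧ corr γ 0 = 1 := by
  obtain ⟨ϱ, r, σ, hϱ, hr, hσ, hlim⟩ := hγ
  have reduced : ∀ N, IsReducedFamily ϱ (r N) N := by
    rintro N k m rfl
    exact hr k m
  have tendsto_corr_r := tendsto_corr hlim
  have isMoment : IsMomentFunction (corr γ) := isMomentFunction_of_tendsto_corr hσ.tendsto_atTop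
    (fun i => (hϱ (σ i)).1) (fun i => reduced (σ i)) tendsto_corr_r
  have re_eq : (corr γ 0).re = 1 := tendsto_nhds_unique
    ((Complex.continuous_re.tendsto _).comp (tendsto_corr_r 0))
    (tendsto_const_nhds.congr fun i => (diag_corr_zero (hϱ (σ i)) (reduced (σ i))).symm)
  refine ⟨isMoment, ?_⟩
  rw [← Complex.conj_eq_iff_re.1 (isMoment.map_swap 0).symm, re_eq, Complex.ofReal_one]

end Hierarchies

section MomentFunctions

variable {H : Type*} [NormedAddCommGroup H] [InnerProductSpace ℂ H]

namespace IsMomentFunction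

variable {ℓ ℓ' : Multiset (H × H) → ℂ}

lemma add (h : IsMomentFunction ℓ) (h' : IsMomentFunction ℓ') : IsMomentFunction (ℓ + ℓ') where
  add_smul_left a a' b c m := by simp only [Pi.add_apply, h.add_smul_left, h'.add_smul_left]; ring
  add_smul_right a b b' c m := by
    simp only [Pi.add_apply, h.add_smul_right, h'.add_smul_right]; ring
  map_swap m := by simp only [Pi.add_apply, h.map_swap, h'.map_swap, map_add]
  exchange a b c d m := by simp only [Pi.add_apply, h.exchange a b, h'.exchange a b]
  iterDiff_diag_nonneg t s ht := by
    have diag_add : diag (ℓ + ℓ') = diag ℓ + diag ℓ' := by funext s; simp [diag]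
    rw [diag_add, iterDiff_add]
    exact add_nonneg (h.iterDiff_diag_nonneg t s ht) (h'.iterDiff_diag_nonneg t s ht)

lemma smul {c : ℝ} (hc : 0 ≤ c) (h : IsMomentFunction ℓ) : IsMomentFunction (c • ℓ) where
  add_smul_left a a' b d m := by simp only [Pi.smul_apply, h.add_smul_left, Complex.real_smul]; ring
  add_smul_right a b b' d m := by
    simp only [Pi.smul_apply, h.add_smul_right, Complex.real_smul]; ring
  map_swap m := by simp [h.map_swap]
  exchange a b d e m := by simp only [Pi.smul_apply, h.exchange a b]
  iterDiff_diag_nonneg t s ht := by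
    have diag_const_smul : diag (c • ℓ) = c • diag ℓ := by funext s; simp [diag]
    rw [diag_const_smul, iterDiff_const_smul]
    exact mul_nonneg hc (h.iterDiff_diag_nonneg t s ht)

lemma shift (h : IsMomentFunction ℓ) (a : H) : IsMomentFunction fun m => ℓ ((a, a) ::ₘ m) where
  add_smul_left b b' d c m := by simp only [Multiset.cons_swap (a, a), h.add_smul_left]
  add_smul_right b d d' c m := by simp only [Multiset.cons_swap (a, a), h.add_smul_right]
  map_swap m := by rw [← h.map_swap, Multiset.map_cons, Prod.swap_prod_mk]
  exchange b c d e m := by simp only [Multiset.cons_swap (a, a), h.exchange b c]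
  iterDiff_diag_nonneg t s ht := by
    have diag_shift : (diag fun m => ℓ ((a, a) ::ₘ m)) = fun s => diag ℓ (a ::ₘ s) := by
      funext s; simp [diag]
    rw [diag_shift, iterDiff_shift]
    exact h.iterDiff_diag_nonneg t _ ht

lemma sub_shift (h : IsMomentFunction ℓ) {a : H} (ha : ‖a‖ ≤ 1) :
    IsMomentFunction (ℓ - fun m => ℓ ((a, a) ::ₘ m)) where
  add_smul_left b b' d c m := by
    simp only [Pi.sub_apply, (h.shift a).add_smul_left, h.add_smul_left]; ring
  add_smul_right b d d' c m := by
    simp only [Pi.sub_apply, (h.shift a).add_smul_right, h.add_smul_right]; ring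
  map_swap m := by simp only [Pi.sub_apply, (h.shift a).map_swap, h.map_swap, map_sub]
  exchange b c d e m := by simp only [Pi.sub_apply, (h.shift a).exchange b c, h.exchange b c]
  iterDiff_diag_nonneg t s ht := by
    have diag_sub_shift : diag (ℓ - fun m => ℓ ((a, a) ::ₘ m)) =
        diag ℓ + (-1 : ℝ) • fun s => diag ℓ (a ::ₘ s) := by
      funext s; simp [diag, sub_eq_add_neg]
    have iterDiff_cons_nonneg := h.iterDiff_diag_nonneg (a :: t) s (by simpa [ha] using ht)
    rw [diag_sub_shift, iterDiff_add, iterDiff_const_smul, iterDiff_shift, neg_one_mul,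
      ← sub_eq_add_neg]
    exact iterDiff_cons_nonneg

lemma coe_diag (h : IsMomentFunction ℓ) (s : Multiset H) :
    (diag ℓ s : ℂ) = ℓ (s.map fun a => (a, a)) := by
  have real := h.map_swap (s.map fun a => (a, a))
  rw [Multiset.map_map, eq_comm] at real
  exact Complex.conj_eq_iff_re.1 real

lemma coe_diag_singleton (h : IsMomentFunction ℓ) (a : H) : (diag ℓ {a} : ℂ) = ℓ {(a, a)} := by
  rw [h.coe_diag, Multiset.map_singleton]

lemma diag_nonneg (h : IsMomentFunction ℓ) (s : Multiset H) : 0 ≤ diag ℓ s :=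
  h.iterDiff_diag_nonneg [] s fun _ h => (List.not_mem_nil h).elim

lemma diag_cons_le (h : IsMomentFunction ℓ) (a : H) (s : Multiset H) :
    diag ℓ (a ::ₘ s) ≤ ‖a‖ ^ 2 * diag ℓ s := by
  rcases eq_or_ne a 0 with rfl | ha
  · have diag_zero_cons := h.diag_smul 0 0 s
    rw [smul_zero, norm_zero, zero_pow two_ne_zero, zero_mul] at diag_zero_cons
    rw [diag_zero_cons, norm_zero, zero_pow two_ne_zero, zero_mul]
  have norm_ne : (‖a‖ : ℂ) ≠ 0 := by simpa using ha
  have diag_unit_le := h.iterDiff_diag_nonneg [(‖a‖ : ℂ)⁻¹ • a] s fun b hb => by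
    rw [List.mem_singleton.1 hb]
    exact (norm_smul_inv_norm (𝕜 := ℂ) ha).le
  calc diag ℓ (a ::ₘ s) = ‖(‖a‖ : ℂ)‖ ^ 2 * diag ℓ (((‖a‖ : ℂ)⁻¹ • a) ::ₘ s) := by
        rw [← h.diag_smul, smul_inv_smul₀ norm_ne]
    _ ≤ ‖a‖ ^ 2 * diag ℓ s := by
        rw [Complex.norm_real, norm_norm]
        gcongr
        exact sub_nonneg.1 diag_unit_le

lemma diag_le_prod (h : IsMomentFunction ℓ) (h0 : ℓ 0 = 1) (s : Multiset H) :
    diag ℓ s ≤ (s.map fun a => ‖a‖ ^ 2).prod := by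
  induction s using Multiset.induction_on with
  | empty => simp [diag, h0]
  | cons a s ih =>
    rw [Multiset.map_cons, Multiset.prod_cons]
    exact (h.diag_cons_le a s).trans (by gcongr)

lemma diag_singleton_le (h : IsMomentFunction ℓ) (h0 : ℓ 0 = 1) (a : H) :
    diag ℓ {a} ≤ ‖a‖ ^ 2 := by
  simpa using h.diag_le_prod h0 {a}

lemma exists_forall_norm_add_diag_le (m : Multiset (H × H)) (s : Multiset H) :
    ∃ C : ℝ, ∀ ℓ : Multiset (H × H) → ℂ, IsMomentFunction ℓ → ℓ 0 = 1 →
      ‖ℓ (m + s.map fun a => (a, a))‖ ≤ C := by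
  induction m using Multiset.induction_on generalizing s with
  | empty =>
    refine ⟨(s.map fun a => ‖a‖ ^ 2).prod, fun ℓ h h0 => ?_⟩
    rw [zero_add, ← h.coe_diag, Complex.norm_real, Real.norm_of_nonneg (h.diag_nonneg s)]
    exact h.diag_le_prod h0 s
  | cons p m ih =>
    choose C hC using fun k : ℕ => ih ((p.1 + Complex.I ^ k • p.2) ::ₘ s)
    simp only [Multiset.map_cons, Multiset.add_cons] at hC
    refine ⟨1 / 4 * ∑ k ∈ Finset.range 4, C k, fun ℓ h h0 => ?_⟩
    rw [Multiset.cons_add, ← Prod.mk.eta (p := p), h.polarization, norm_mul]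
    gcongr
    · norm_num
    refine norm_sum_le_of_le _ fun k _ => ?_
    rw [norm_mul, norm_pow, norm_neg, Complex.norm_I, one_pow, one_mul]
    exact hC k ℓ h h0

end IsMomentFunction

variable (H) in
/-- The normalised moment functions. -/
def momentFunctions : Set (Multiset (H × H) → ℂ) := {ℓ | IsMomentFunction ℓ ∧ ℓ 0 = 1}

lemma isClosed_momentFunctions : IsClosed (momentFunctions H) := by
  refine isClosed_iff_forall_filter.2 fun ℓ F _ hF hlim => ?_
  have tendsto_eval : ∀ m, Tendsto (fun f : Multiset (H × H) → ℂ => f m) F (𝓝 (ℓ m)) := fun m =>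
    ((continuous_apply m).tendsto ℓ).mono_left hlim
  have mem : ∀ᶠ f in F, f ∈ momentFunctions H := le_principal_iff.1 hF
  have isMoment : ∀ᶠ f in F, IsMomentFunction f := mem.mono fun f hf => hf.1
  refine ⟨⟨⟨fun a a' b c m => ?_, fun a b b' c m => ?_⟩, fun m => ?_, fun a b c d m => ?_,
    fun t s ht => ?_⟩, ?_⟩
  · exact tendsto_nhds_unique_of_eventuallyEq (tendsto_eval _)
      ((tendsto_eval _).add ((tendsto_eval _).const_mul _))
      (isMoment.mono fun f hf => hf.add_smul_left a a' b c m)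
  · exact tendsto_nhds_unique_of_eventuallyEq (tendsto_eval _)
      ((tendsto_eval _).add ((tendsto_eval _).const_mul _))
      (isMoment.mono fun f hf => hf.add_smul_right a b b' c m)
  · exact tendsto_nhds_unique_of_eventuallyEq (tendsto_eval _)
      ((Complex.continuous_conj.tendsto _).comp (tendsto_eval _))
      (isMoment.mono fun f hf => hf.map_swap m)
  · exact tendsto_nhds_unique_of_eventuallyEq (tendsto_eval _) (tendsto_eval _)
      (isMoment.mono fun f hf => hf.exchange a b c d m)
  · exact ge_of_tendsto (tendsto_iterDiff
      (fun s => (Complex.continuous_re.tendsto _).comp (tendsto_eval _)) t s)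
      (isMoment.mono fun f hf => hf.iterDiff_diag_nonneg t s ht)
  · exact tendsto_nhds_unique_of_eventuallyEq (tendsto_eval 0) tendsto_const_nhds
      (mem.mono fun f hf => hf.2)

lemma isCompact_momentFunctions : IsCompact (momentFunctions H) := by
  choose C hC using fun m : Multiset (H × H) => IsMomentFunction.exists_forall_norm_add_diag_le m 0
  refine (isCompact_univ_pi fun m => isCompact_closedBall (0 : ℂ) (C m)).of_isClosed_subset
    isClosed_momentFunctions fun ℓ hℓ m _ => ?_
  simpa using hC m ℓ hℓ.1 hℓ.2

lemma convex_momentFunctions : Convex ℝ (momentFunctions H) := by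
  intro ℓ h ℓ' h' a b ha hb hab
  refine ⟨(h.1.smul ha).add (h'.1.smul hb), ?_⟩
  simp only [Pi.add_apply, Pi.smul_apply, h.2, h'.2, Complex.real_smul, mul_one]
  exact_mod_cast hab

end MomentFunctions

section ExtremePoints

variable {H : Type*} [NormedAddCommGroup H] [InnerProductSpace ℂ H] {ℓ : Multiset (H × H) → ℂ}

lemma apply_cons_self_of_mem_extremePoints_of_norm_le
    (h : ℓ ∈ (momentFunctions H).extremePoints ℝ) {a : H} (ha : ‖a‖ ≤ 1) (m : Multiset (H × H)) :
    ℓ ((a, a) ::ₘ m) = ℓ {(a, a)} * ℓ m := by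
  obtain ⟨⟨hℓ, h0⟩, extreme⟩ := h
  set c := diag ℓ {a}
  have le_one : c ≤ 1 := (hℓ.diag_singleton_le h0 a).trans (pow_le_one₀ (norm_nonneg _) ha)
  set ℓa := fun m => ℓ ((a, a) ::ₘ m)
  have ℓa_zero : ℓa 0 = c := (hℓ.coe_diag_singleton a).symm
  -- Neither summand of `ℓ = (ℓ - ℓa) + ℓa` is normalised, but these two convex partners are.
  have mem₁ : (1 - c) • ℓ + ℓa ∈ momentFunctions H :=
    ⟨(hℓ.smul (sub_nonneg.2 le_one)).add (hℓ.shift a), by simp [h0, ℓa_zero]⟩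
  have mem₂ : c • ℓ + (ℓ - ℓa) ∈ momentFunctions H :=
    ⟨(hℓ.smul (hℓ.diag_nonneg _)).add (hℓ.sub_shift ha), by simp [h0, ℓa_zero]⟩
  have midpoint : ℓ ∈ openSegment ℝ ((1 - c) • ℓ + ℓa) (c • ℓ + (ℓ - ℓa)) :=
    ⟨1 / 2, 1 / 2, by norm_num, by norm_num, by norm_num, by module⟩
  have eq_ℓ := congrFun (extreme mem₁ mem₂ midpoint) m
  simp only [Pi.add_apply, Pi.smul_apply, Complex.real_smul, Complex.ofReal_sub,
    Complex.ofReal_one] at eq_ℓ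
  rw [← hℓ.coe_diag_singleton]
  linear_combination eq_ℓ

lemma apply_cons_self_of_mem_extremePoints (h : ℓ ∈ (momentFunctions H).extremePoints ℝ) (a : H)
    (m : Multiset (H × H)) : ℓ ((a, a) ::ₘ m) = ℓ {(a, a)} * ℓ m := by
  rcases eq_or_ne a 0 with rfl | ha
  · exact apply_cons_self_of_mem_extremePoints_of_norm_le h (by simp) m
  have norm_ne : (‖a‖ : ℂ) ≠ 0 := by simpa using ha
  set u := (‖a‖ : ℂ)⁻¹ • a
  have cons_a : ∀ m, ℓ ((a, a) ::ₘ m) = (‖(‖a‖ : ℂ)‖ ^ 2 : ℝ) * ℓ ((u, u) ::ₘ m) := fun m => by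
    rw [← h.1.1.smul_smul_cons, smul_inv_smul₀ norm_ne]
  rw [← Multiset.cons_zero, cons_a, cons_a,
    apply_cons_self_of_mem_extremePoints_of_norm_le h (a := u) (norm_smul_inv_norm ha).le,
    Multiset.cons_zero, mul_assoc]

lemma apply_cons_of_mem_extremePoints (h : ℓ ∈ (momentFunctions H).extremePoints ℝ) (a b : H)
    (m : Multiset (H × H)) : ℓ ((a, b) ::ₘ m) = ℓ {(a, b)} * ℓ m := by
  rw [← Multiset.cons_zero, h.1.1.polarization a b m, h.1.1.polarization a b 0]
  simp only [apply_cons_self_of_mem_extremePoints h _ m, Multiset.cons_zero, mul_assoc,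
    Finset.sum_mul]

lemma exists_inner_mul_inner_eq_of_apply_self_eq_one [CompleteSpace H]
    {Γ : H →ₗ⋆[ℂ] H →ₗ[ℂ] ℂ} (herm : ∀ a b, Γ b a = starRingEnd ℂ (Γ a b))
    (exchange : ∀ a b c d, Γ a b * Γ c d = Γ a d * Γ c b) (le : ∀ a, (Γ a a).re ≤ ‖a‖ ^ 2)
    {c : H} (hc : Γ c c = 1) : ∃ φ : H, ‖φ‖ ≤ 1 ∧ ∀ a b, ⟪a, φ⟫_ℂ * ⟪φ, b⟫_ℂ = Γ a b := by
  have conj_mul : ∀ a b, starRingEnd ℂ (Γ c a) * Γ c b = Γ a b := fun a b => by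
    rw [← herm, ← exchange, hc, mul_one]
  have norm_le : ∀ b, ‖Γ c b‖ ≤ 1 * ‖b‖ := fun b => by
    have h := le b
    rw [← conj_mul, ← Complex.normSq_eq_conj_mul_self, Complex.ofReal_re,
      Complex.normSq_eq_norm_sq] at h
    rw [one_mul]
    exact le_of_sq_le_sq h (norm_nonneg b)
  refine ⟨(InnerProductSpace.toDual ℂ H).symm ((Γ c).mkContinuous 1 norm_le), ?_, fun a b => ?_⟩
  · rw [LinearIsometryEquiv.norm_map]
    exact LinearMap.mkContinuous_norm_le _ zero_le_one _
  · rw [← inner_conj_symm a, InnerProductSpace.toDual_symm_apply,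
      InnerProductSpace.toDual_symm_apply]
    exact conj_mul a b

lemma exists_inner_mul_inner_eq [CompleteSpace H]
    {Γ : H →ₗ⋆[ℂ] H →ₗ[ℂ] ℂ} (herm : ∀ a b, Γ b a = starRingEnd ℂ (Γ a b))
    (exchange : ∀ a b c d, Γ a b * Γ c d = Γ a d * Γ c b) (nonneg : ∀ a, 0 ≤ (Γ a a).re)
    (le : ∀ a, (Γ a a).re ≤ ‖a‖ ^ 2) :
    ∃ φ : H, ‖φ‖ ≤ 1 ∧ ∀ a b, ⟪a, φ⟫_ℂ * ⟪φ, b⟫_ℂ = Γ a b := by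
  by_cases zero : ∀ c, Γ c c = 0
  · refine ⟨0, by simp, fun a b => ?_⟩
    have mul_conj := exchange a b b a
    rw [herm a b, zero, zero_mul, Complex.mul_conj, Complex.ofReal_eq_zero,
      Complex.normSq_eq_zero] at mul_conj
    rw [mul_conj, inner_zero_right, zero_mul]
  obtain ⟨c, hc⟩ := not_forall.1 zero
  have coe_re : ((Γ c c).re : ℂ) = Γ c c := Complex.conj_eq_iff_re.1 (herm c c).symm
  set g : ℂ := (Real.sqrt (Γ c c).re : ℂ)
  have mul_self_g : g * g = Γ c c := by
    rw [← Complex.ofReal_mul, Real.mul_self_sqrt (nonneg c), coe_re]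
  have conj_g : starRingEnd ℂ g⁻¹ = g⁻¹ := by rw [map_inv₀, Complex.conj_ofReal]
  refine exists_inner_mul_inner_eq_of_apply_self_eq_one herm exchange le (c := g⁻¹ • c) ?_
  rw [map_smul, LinearMap.map_smulₛₗ, LinearMap.smul_apply, smul_smul, conj_g, smul_eq_mul,
    ← mul_inv, mul_self_g, inv_mul_cancel₀ hc]

/-- The product `∏_{(a, b) ∈ m} ⟪a, φ⟫ ⟪φ, b⟫`. -/
noncomputable def pointMoment (φ : H) (m : Multiset (H × H)) : ℂ :=
  (m.map fun p => ⟪p.1, φ⟫_ℂ * ⟪φ, p.2⟫_ℂ).prod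

lemma exists_pointMoment_of_mem_extremePoints [CompleteSpace H]
    (h : ℓ ∈ (momentFunctions H).extremePoints ℝ) : ∃ φ : H, ‖φ‖ ≤ 1 ∧ pointMoment φ = ℓ := by
  obtain ⟨hℓ, h0⟩ := h.1
  have mul := apply_cons_of_mem_extremePoints h
  obtain ⟨φ, norm_le, hφ⟩ := exists_inner_mul_inner_eq (Γ := hℓ.form 0)
    (fun a b => hℓ.map_swap {(a, b)})
    (fun a b c d => by
      have exchange := hℓ.exchange a b c d 0
      rwa [mul, mul a d] at exchange)
    (fun a => (hℓ.diag_nonneg {a}).trans_eq (by simp [diag, hℓ.form_apply]))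
    (fun a => (hℓ.diag_singleton_le h0 a).trans_eq' (by simp [diag, hℓ.form_apply]))
  refine ⟨φ, norm_le, funext fun m => ?_⟩
  induction m using Multiset.induction_on with
  | empty => rw [h0, pointMoment, Multiset.map_zero, Multiset.prod_zero]
  | cons p m ih =>
    rw [← Prod.mk.eta (p := p), mul, ← ih, pointMoment, Multiset.map_cons, Multiset.prod_cons, hφ]
    rfl

end ExtremePoints

section WeakBall

/-- The closed unit ball with the weak topology, and the Borel sets of the norm topology. -/
def WeakBall (H : Type*) [NormedAddCommGroup H] : Type _ := UnitBall H

/-- The identity map from the closed unit ball with its norm to the one with the weak topology. -/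
def toWeakBall {H : Type*} [NormedAddCommGroup H] (x : UnitBall H) : WeakBall H := x

namespace WeakBall

lemma norm_le {H : Type*} [NormedAddCommGroup H] (x : WeakBall H) : ‖x.1‖ ≤ 1 :=
  mem_closedBall_zero_iff.1 x.2

variable {H : Type*} [NormedAddCommGroup H] [InnerProductSpace ℂ H]

noncomputable instance : TopologicalSpace (WeakBall H) := ballWeak H

instance [MeasurableSpace H] : MeasurableSpace (WeakBall H) :=
  inferInstanceAs (MeasurableSpace (UnitBall H))

lemma continuous_inner_right (y : H) : Continuous fun x : WeakBall H => ⟪y, x.1⟫_ℂ :=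
  (WeakBilin.eval_continuous (topDualPairing ℂ H).flip (innerSL ℂ y)).comp continuous_induced_dom

lemma continuous_inner_left (y : H) : Continuous fun x : WeakBall H => ⟪x.1, y⟫_ℂ := by
  simpa only [Function.comp_def, inner_conj_symm] using
    Complex.continuous_conj.comp (continuous_inner_right y)

lemma continuous_pointMoment (m : Multiset (H × H)) :
    Continuous fun φ : WeakBall H => pointMoment φ.1 m := by
  induction m using Multiset.induction_on with
  | empty => simpa [pointMoment] using continuous_const
  | cons p m ih =>
    simp only [pointMoment, Multiset.map_cons, Multiset.prod_cons] at ih ⊢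
    exact ((continuous_inner_right _).mul (continuous_inner_left _)).mul ih

variable [CompleteSpace H]

lemma continuous_of_continuous_inner {X : Type*} [TopologicalSpace X] {f : X → WeakBall H}
    (h : ∀ y, Continuous fun x => ⟪y, (f x).1⟫_ℂ) : Continuous f :=
  continuous_induced_rng.2 <| WeakBilin.continuous_of_continuous_eval _ fun l =>
    (h ((InnerProductSpace.toDual ℂ H).symm l)).congr fun _ =>
      InnerProductSpace.toDual_symm_apply

lemma continuous_toWeakBall : Continuous (toWeakBall : UnitBall H → WeakBall H) :=
  continuous_of_continuous_inner fun _ => continuous_const.inner continuous_subtype_val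

instance : CompactSpace (WeakBall H) := by
  let dualBall := WeakDual.toStrongDual ⁻¹' Metric.closedBall (0 : StrongDual ℂ H) 1
  have : CompactSpace dualBall :=
    isCompact_iff_compactSpace.1 (WeakDual.isCompact_closedBall (𝕜 := ℂ) (E := H) 0 1)
  let riesz : dualBall → WeakBall H := fun l =>
    ⟨(InnerProductSpace.toDual ℂ H).symm (WeakDual.toStrongDual l.1), by
      rw [mem_closedBall_zero_iff, LinearIsometryEquiv.norm_map]
      exact mem_closedBall_zero_iff.1 l.2⟩
  have inner_riesz : ∀ y l, ⟪y, (riesz l).1⟫_ℂ = starRingEnd ℂ (l.1 y) := fun y l => by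
    rw [← inner_conj_symm]
    exact congrArg _ InnerProductSpace.toDual_symm_apply
  have continuous_riesz : Continuous riesz := continuous_of_continuous_inner fun y => by
    simp only [inner_riesz]
    exact Complex.continuous_conj.comp ((WeakDual.eval_continuous y).comp continuous_subtype_val)
  have riesz_surjective : Function.Surjective riesz := fun x =>
    ⟨⟨WeakDual.toStrongDual.symm (InnerProductSpace.toDual ℂ H x.1), by
      simpa [dualBall] using x.norm_le⟩, Subtype.ext (by simp [riesz])⟩
  exact riesz_surjective.compactSpace continuous_riesz

/-- The coordinates of a vector of the unit ball in the fixed orthonormal basis. -/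
noncomputable def coords (x : WeakBall H) (i : basisIndex H) : ℂ := ⟪basis H i, x.1⟫_ℂ

lemma continuous_coords : Continuous (coords : WeakBall H → _) :=
  continuous_pi fun _ => continuous_inner_right _

lemma coords_injective : Function.Injective (coords : WeakBall H → _) := fun x y h => by
  refine Subtype.ext ((basis H).repr.injective (lp.ext (funext fun i => ?_)))
  rw [HilbertBasis.repr_apply_apply, HilbertBasis.repr_apply_apply]
  exact congrFun h i

instance : T2Space (WeakBall H) :=
  T2Space.of_injective_continuous coords_injective continuous_coords

variable [SecondCountableTopology H]

instance : TopologicalSpace.MetrizableSpace (WeakBall H) :=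
  (continuous_coords.isClosedEmbedding coords_injective).isEmbedding.metrizableSpace

/-- By the Lusin–Souslin theorem, the weak and the norm topology have the same Borel sets. -/
instance [MeasurableSpace H] [BorelSpace H] : BorelSpace (WeakBall H) := by
  have : PolishSpace (UnitBall H) := Metric.isClosed_closedBall.polishSpace
  have : SecondCountableTopology (WeakBall H) := by
    let _ := TopologicalSpace.metrizableSpaceMetric (WeakBall H)
    infer_instance
  exact ⟨continuous_toWeakBall.map_eq_borel Function.surjective_id⟩

end WeakBall

end WeakBall

section Representation

lemma continuous_integral_of_compactSpace {X 𝕜 : Type*} [TopologicalSpace X] [CompactSpace X]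
    [MeasurableSpace X] [OpensMeasurableSpace X] [RCLike 𝕜] {f : X → 𝕜} (hf : Continuous f) :
    Continuous fun ρ : ProbabilityMeasure X => ∫ x, f x ∂(ρ : Measure X) :=
  continuous_iff_continuousAt.2 fun _ =>
    (ProbabilityMeasure.tendsto_iff_forall_integral_rclike_tendsto 𝕜).1 tendsto_id
      (BoundedContinuousFunction.mkOfCompact ⟨f, hf⟩)

variable {H : Type*} [NormedAddCommGroup H] [InnerProductSpace ℂ H] [CompleteSpace H]
  [SecondCountableTopology H] [MeasurableSpace H] [BorelSpace H]

/-- The moments `∫ ∏_{(a, b) ∈ m} ⟪a, φ⟫ ⟪φ, b⟫ dμ(φ)` of a probability measure. -/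
noncomputable def moments (μ : ProbabilityMeasure (WeakBall H)) (m : Multiset (H × H)) : ℂ :=
  ∫ φ, pointMoment φ.1 m ∂(μ : Measure (WeakBall H))

lemma continuous_moments : Continuous (moments (H := H)) :=
  continuous_pi fun m =>
    continuous_integral_of_compactSpace (WeakBall.continuous_pointMoment m)

lemma convex_range_moments : Convex ℝ (Set.range (moments (H := H))) := by
  rintro _ ⟨μ, rfl⟩ _ ⟨ν, rfl⟩ a b ha hb hab
  have isProbabilityMeasure : IsProbabilityMeasure
      (ENNReal.ofReal a • (μ : Measure (WeakBall H)) +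
        ENNReal.ofReal b • (ν : Measure (WeakBall H))) := ⟨by
    simp only [Measure.add_apply, Measure.smul_apply, measure_univ, smul_eq_mul, mul_one]
    rw [← ENNReal.ofReal_add ha hb, hab, ENNReal.ofReal_one]⟩
  refine ⟨⟨_, isProbabilityMeasure⟩, funext fun m => ?_⟩
  have integrable (μ : ProbabilityMeasure (WeakBall H)) :
      Integrable (fun φ => pointMoment φ.1 m) (μ : Measure (WeakBall H)) :=
    (BoundedContinuousFunction.mkOfCompact ⟨_, WeakBall.continuous_pointMoment m⟩).integrable _
  refine (integral_add_measure ((integrable μ).smul_measure ENNReal.ofReal_ne_top)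
    ((integrable ν).smul_measure ENNReal.ofReal_ne_top)).trans ?_
  rw [integral_smul_measure, integral_smul_measure, ENNReal.toReal_ofReal ha,
    ENNReal.toReal_ofReal hb]
  rfl

lemma extremePoints_momentFunctions_subset_range_moments :
    (momentFunctions H).extremePoints ℝ ⊆ Set.range (moments (H := H)) := by
  intro ℓ hℓ
  obtain ⟨φ, hφ, rfl⟩ := exists_pointMoment_of_mem_extremePoints hℓ
  let x : WeakBall H := ⟨φ, mem_closedBall_zero_iff.2 hφ⟩
  exact ⟨⟨Measure.dirac x, inferInstance⟩, funext fun m =>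
    integral_dirac (fun φ : WeakBall H => pointMoment φ.1 m) x⟩

theorem exists_measure_of_isMomentFunction {ℓ : Multiset (H × H) → ℂ}
    (h : IsMomentFunction ℓ) (h0 : ℓ 0 = 1) :
    ∃ μ : ProbabilityMeasure (WeakBall H), moments μ = ℓ := by
  have mem : ℓ ∈ closure (convexHull ℝ ((momentFunctions H).extremePoints ℝ)) := by
    rw [closure_convexHull_extremePoints isCompact_momentFunctions convex_momentFunctions]
    exact ⟨h, h0⟩
  exact closure_minimal (convexHull_min extremePoints_momentFunctions_subset_range_moments
    convex_range_moments) (isCompact_range continuous_moments).isClosed mem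

end Representation

section CircleAverage

lemma norm_le_one_of_mem_unitBall {H : Type*} [NormedAddCommGroup H] (x : UnitBall H) :
    ‖x.1‖ ≤ 1 :=
  mem_closedBall_zero_iff.1 x.2

variable {H : Type*} [NormedAddCommGroup H] [InnerProductSpace ℂ H]

lemma continuous_rotate (θ : ℝ) : Continuous (rotate θ : UnitBall H → UnitBall H) :=
  (continuous_const.smul continuous_subtype_val).subtype_mk _

/-- The rotation of the closed unit ball by an element `c` of the unit circle. -/
noncomputable def circleAct (c : Circle) (x : UnitBall H) : UnitBall H :=
  ⟨(c : ℂ) • x.1, by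
    rw [mem_closedBall_zero_iff, norm_smul, Circle.norm_coe, one_mul]
    exact norm_le_one_of_mem_unitBall x⟩

lemma rotate_circleAct (θ : ℝ) (c : Circle) (x : UnitBall H) :
    rotate θ (circleAct c x) = circleAct (Circle.exp θ * c) x :=
  Subtype.ext <| by simp [rotate, circleAct, smul_smul]

lemma pointMoment_circleAct (c : Circle) (x : UnitBall H) (m : Multiset (H × H)) :
    pointMoment (circleAct c x).1 m = pointMoment x.1 m := by
  have mul_conj : (c : ℂ) * starRingEnd ℂ c = 1 := by simp [Complex.mul_conj]
  refine congrArg Multiset.prod (Multiset.map_congr rfl fun p _ => ?_)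
  rw [circleAct, inner_smul_left, inner_smul_right]
  linear_combination ⟪p.1, x.1⟫_ℂ * ⟪x.1, p.2⟫_ℂ * mul_conj

lemma continuous_circleAct_toCircle : Continuous fun p : UnitAddCircle × UnitBall H =>
    circleAct (AddCircle.toCircle p.1) p.2 := by
  have := AddCircle.continuous_toCircle (T := 1)
  unfold circleAct
  fun_prop

lemma rotate_circleAct_toCircle (θ : ℝ) (t : UnitAddCircle) (x : UnitBall H) :
    rotate θ (circleAct (AddCircle.toCircle t) x) =
      circleAct (AddCircle.toCircle (((θ / (2 * Real.pi) : ℝ) : UnitAddCircle) + t)) x := by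
  rw [rotate_circleAct, AddCircle.toCircle_add, AddCircle.toCircle_apply_mk]
  congr 3
  field_simp

variable [MeasurableSpace H] [BorelSpace H] [SecondCountableTopology H]

/-- The average over `U(1)` of a probability measure on the closed unit ball. -/
noncomputable def circleAverage (μ : ProbabilityMeasure (UnitBall H)) : InvMeasure H :=
  ⟨⟨Measure.map (fun p : UnitAddCircle × UnitBall H => circleAct (AddCircle.toCircle p.1) p.2)
      (AddCircle.haarAddCircle.prod (μ : Measure (UnitBall H))),
      Measure.isProbabilityMeasure_map continuous_circleAct_toCircle.measurable.aemeasurable⟩, by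
    intro θ
    have shift_comp : rotate θ ∘ (fun p : UnitAddCircle × UnitBall H =>
          circleAct (AddCircle.toCircle p.1) p.2) =
        (fun p => circleAct (AddCircle.toCircle p.1) p.2) ∘
          Prod.map (fun t => ((θ / (2 * Real.pi) : ℝ) : UnitAddCircle) + t) id :=
      funext fun p => rotate_circleAct_toCircle θ p.1 p.2
    change Measure.map _ (Measure.map _ _) = Measure.map _ _
    rw [Measure.map_map (continuous_rotate θ).measurable continuous_circleAct_toCircle.measurable,
      shift_comp, ← Measure.map_map continuous_circleAct_toCircle.measurable (by fun_prop),
      ((measurePreserving_add_left _ _).prod (MeasurePreserving.id _)).map_eq]⟩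

lemma integral_circleAverage (μ : ProbabilityMeasure (UnitBall H)) {f : UnitBall H → ℂ}
    (hf : Continuous f) (h : ∀ c x, f (circleAct c x) = f x) :
    ∫ φ, f φ ∂((circleAverage μ).1 : Measure (UnitBall H)) =
      ∫ φ, f φ ∂(μ : Measure (UnitBall H)) := by
  refine (integral_map continuous_circleAct_toCircle.measurable.aemeasurable
    hf.stronglyMeasurable.aestronglyMeasurable).trans ?_
  simp only [h]
  rw [integral_fun_snd, probReal_univ, one_smul]

end CircleAverage

section Moments

variable {H : Type*} [NormedAddCommGroup H] [InnerProductSpace ℂ H] [CompleteSpace H]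
  [MeasurableSpace H] [BorelSpace H] [SecondCountableTopology H]

lemma memLp_tensorPow (μ : Measure (UnitBall H)) [IsFiniteMeasure μ] (k : ℕ) (p : ℝ≥0∞) :
    MemLp (fun φ : UnitBall H => tensorPow k φ.1) p μ := by
  refine .of_bound ((continuous_tensorPow k).comp
    continuous_subtype_val).stronglyMeasurable.aestronglyMeasurable 1
    (Eventually.of_forall fun φ => ?_)
  rw [norm_tensorPow]
  exact pow_le_one₀ (norm_nonneg _) (norm_le_one_of_mem_unitBall φ)

lemma trace_momentMap_comp (μ : InvMeasure H) (k : ℕ) (A : symPower H k →L[ℂ] symPower H k) :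
    trace ((momentMap μ k).op ∘L A) =
      ∫ φ : UnitBall H, ⟪tensorPow k φ.1, A (tensorPow k φ.1)⟫_ℂ ∂(μ.1 : Measure (UnitBall H)) :=
  trace_ensemble_comp (memLp_tensorPow _ k 2) A

lemma corr_momentMap (μ : InvMeasure H) (m : Multiset (H × H)) :
    corr (momentMap μ) m = ∫ φ : UnitBall H, pointMoment φ.1 m ∂(μ.1 : Measure (UnitBall H)) := by
  obtain ⟨n, x, rfl⟩ := exists_ofFn m
  rw [corr_ofFn]
  refine (inner_ensemble (memLp_tensorPow _ n 2) _ _).trans (integral_congr_ae (.of_forall ?_))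
  intro φ
  have inner_tensorPow_symTensor (y : Fin n → H) :
      ⟪tensorPow n φ.1, symTensor y⟫_ℂ = ∏ j, ⟪φ.1, y j⟫_ℂ := by
    rw [← inner_conj_symm (𝕜 := ℂ) (E := symPower H n), inner_symTensor_tensorPow, map_prod]
    simp only [inner_conj_symm]
  simp only [inner_symTensor_tensorPow, inner_tensorPow_symTensor, pointMoment, Multiset.map_coe,
    Multiset.prod_coe, List.map_ofFn, List.prod_ofFn, Function.comp_apply, Finset.prod_mul_distrib]

theorem exists_momentMap_eq {γ : ∀ k, TraceClass (symPower H k)} (hγ : γ ∈ symHierarchies H) :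
    ∃ μ : InvMeasure H, momentMap μ = γ := by
  obtain ⟨isMoment, corr_zero⟩ := isMomentFunction_corr hγ
  obtain ⟨μ, hμ⟩ := exists_measure_of_isMomentFunction isMoment corr_zero
  let ν : ProbabilityMeasure (UnitBall H) := ⟨(μ : Measure (WeakBall H)),
    inferInstanceAs (IsProbabilityMeasure (μ : Measure (WeakBall H)))⟩
  refine ⟨circleAverage ν, eq_of_corr_eq (funext fun m => ?_)⟩
  rw [corr_momentMap, ← hμ]
  exact integral_circleAverage ν (f := fun φ => pointMoment φ.1 m)
    ((WeakBall.continuous_pointMoment m).comp WeakBall.continuous_toWeakBall)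
    fun c x => pointMoment_circleAct c x m

end Moments

section Monomials

lemma exists_map_fst_map_snd {α β : Type*} (s : Multiset α) (t : Multiset β)
    (h : s.card = t.card) : ∃ m : Multiset (α × β), m.map Prod.fst = s ∧ m.map Prod.snd = t := by
  induction s using Quotient.inductionOn with | _ l =>
  induction t using Quotient.inductionOn with | _ l' =>
  have length_eq : l.length = l'.length := h
  exact ⟨(l.zip l' : List _), by simp [List.map_fst_zip, length_eq.le],
    by simp [List.map_snd_zip, length_eq.ge]⟩

variable {H : Type*} [NormedAddCommGroup H] [InnerProductSpace ℂ H]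

/-- The coordinate function `φ ↦ ⟪a, φ⟫` on the unit ball. -/
noncomputable def coordFun (a : H) : BoundedContinuousFunction (UnitBall H) ℂ :=
  .ofNormedAddCommGroup (fun φ => ⟪a, φ.1⟫_ℂ) (by fun_prop) ‖a‖ fun φ =>
    (norm_inner_le_norm _ _).trans
      (mul_le_of_le_one_right (norm_nonneg a) (norm_le_one_of_mem_unitBall φ))

/-- The monomial `∏_{a ∈ s} ⟪a, φ⟫ ∏_{b ∈ t} ⟪φ, b⟫` in the coordinate functions. -/
noncomputable def monomial (s t : Multiset H) : BoundedContinuousFunction (UnitBall H) ℂ :=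
  (s.map coordFun).prod * star (t.map coordFun).prod

lemma monomial_apply (s t : Multiset H) (φ : UnitBall H) :
    monomial s t φ = (s.map fun a => ⟪a, φ.1⟫_ℂ).prod * (t.map fun b => ⟪φ.1, b⟫_ℂ).prod := by
  have prod_coordFun (u : Multiset H) :
      (u.map coordFun).prod φ = (u.map fun a => ⟪a, φ.1⟫_ℂ).prod := by
    induction u using Multiset.induction_on with
    | empty => simp
    | cons a u ih => simp [ih, coordFun]
  rw [monomial, BoundedContinuousFunction.mul_apply, BoundedContinuousFunction.star_apply,
    prod_coordFun, prod_coordFun, ← starRingEnd_apply, map_multiset_prod, Multiset.map_map]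
  simp only [Function.comp_def, inner_conj_symm]

lemma monomial_rotate (s t : Multiset H) (θ : ℝ) (φ : UnitBall H) :
    monomial s t (rotate θ φ) =
      Complex.exp (((s.card : ℝ) - t.card : ℝ) * θ * Complex.I) * monomial s t φ := by
  have inner_rotate_right (a : H) :
      ⟪a, (rotate θ φ).1⟫_ℂ = Complex.exp (θ * Complex.I) * ⟪a, φ.1⟫_ℂ := inner_smul_right _ _ _
  have inner_rotate_left (b : H) :
      ⟪(rotate θ φ).1, b⟫_ℂ = Complex.exp (-(θ * Complex.I)) * ⟪φ.1, b⟫_ℂ := by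
    rw [rotate, inner_smul_left, ← Complex.exp_conj]
    simp
  simp only [monomial_apply, inner_rotate_right, inner_rotate_left, Multiset.prod_map_mul,
    Multiset.map_const', Multiset.prod_replicate, ← Complex.exp_nat_mul]
  rw [mul_mul_mul_comm, ← Complex.exp_add]
  congr 2
  push_cast
  ring

lemma exists_eq_monomial {f : BoundedContinuousFunction (UnitBall H) ℂ}
    (hf : f ∈ Submonoid.closure (Set.range coordFun ∪ star (Set.range coordFun))) :
    ∃ s t : Multiset H, f = monomial s t := by
  induction hf using Submonoid.closure_induction with
  | mem f hf =>
    rcases hf with ⟨a, rfl⟩ | ⟨a, ha⟩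
    · exact ⟨{a}, 0, by simp [monomial]⟩
    · exact ⟨0, {a}, by simp [monomial, ha]⟩
  | one => exact ⟨0, 0, by simp [monomial]⟩
  | mul f g _ _ hf hg =>
    obtain ⟨s, t, rfl⟩ := hf
    obtain ⟨s', t', rfl⟩ := hg
    exact ⟨s + s', t + t', by simp [monomial, mul_mul_mul_comm]⟩

variable [MeasurableSpace H] [BorelSpace H]

lemma integral_monomial_of_card_ne (μ : InvMeasure H) {s t : Multiset H} (h : s.card ≠ t.card) :
    ∫ φ, monomial s t φ ∂(μ.1 : Measure (UnitBall H)) = 0 := by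
  have sub_ne : ((s.card : ℝ) - t.card) ≠ 0 := sub_ne_zero.2 (by exact_mod_cast h)
  let θ : ℝ := Real.pi / ((s.card : ℝ) - t.card)
  have rotate_eq_neg (φ : UnitBall H) : monomial s t (rotate θ φ) = -monomial s t φ := by
    rw [monomial_rotate, ← Complex.ofReal_mul, mul_div_cancel₀ _ sub_ne, Complex.exp_pi_mul_I,
      neg_one_mul]
  have invariance : ∫ φ, monomial s t φ ∂(μ.1 : Measure (UnitBall H)) =
      ∫ φ, monomial s t (rotate θ φ) ∂(μ.1 : Measure (UnitBall H)) := by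
    conv_lhs => rw [← μ.2 θ]
    exact integral_map (continuous_rotate θ).measurable.aemeasurable
      (monomial s t).continuous.stronglyMeasurable.aestronglyMeasurable
  simp only [rotate_eq_neg, integral_neg] at invariance
  exact self_eq_neg.1 invariance

variable [CompleteSpace H] [SecondCountableTopology H]

lemma integral_monomial_eq {μ ν : InvMeasure H} (h : momentMap μ = momentMap ν)
    (s t : Multiset H) : ∫ φ, monomial s t φ ∂(μ.1 : Measure (UnitBall H)) =
      ∫ φ, monomial s t φ ∂(ν.1 : Measure (UnitBall H)) := by
  by_cases hst : s.card = t.card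
  · obtain ⟨m, rfl, rfl⟩ := exists_map_fst_map_snd s t hst
    have monomial_eq (φ : UnitBall H) :
        monomial (m.map Prod.fst) (m.map Prod.snd) φ = pointMoment φ.1 m := by
      simp [monomial_apply, pointMoment, Multiset.map_map, Multiset.prod_map_mul]
    simp only [monomial_eq, ← corr_momentMap, h]
  · rw [integral_monomial_of_card_ne μ hst, integral_monomial_of_card_ne ν hst]

theorem momentMap_injective : Function.Injective (momentMap : InvMeasure H → _) := by
  intro μ ν h
  have : PolishSpace (UnitBall H) := Metric.isClosed_closedBall.polishSpace
  let A : StarSubalgebra ℂ (BoundedContinuousFunction (UnitBall H) ℂ) :=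
    StarAlgebra.adjoin ℂ (Set.range coordFun)
  refine Subtype.ext (Subtype.ext
    (ext_of_forall_mem_subalgebra_integral_eq_of_polish (P := (μ.1 : Measure (UnitBall H)))
      (P' := (ν.1 : Measure (UnitBall H))) (A := A) ?_ fun g hg => ?_))
  · intro x y hxy
    by_contra! h_eq
    refine hxy (Subtype.ext (ext_inner_left ℂ fun a => ?_))
    exact h_eq _ ⟨_, ⟨coordFun a, StarAlgebra.subset_adjoin ℂ _ ⟨a, rfl⟩, rfl⟩, rfl⟩
  · have mem_span : g ∈ Subalgebra.toSubmodule A.toSubalgebra := hg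
    rw [StarAlgebra.adjoin_eq_span] at mem_span
    clear hg
    induction mem_span using Submodule.span_induction with
    | mem f hf =>
      obtain ⟨s, t, rfl⟩ := exists_eq_monomial hf
      exact integral_monomial_eq h s t
    | zero => simp
    | add f g _ _ hf hg =>
      exact (integral_add (f.integrable _) (g.integrable _)).trans
        ((congrArg₂ _ hf hg).trans (integral_add (f.integrable _) (g.integrable _)).symm)
    | smul c f _ hf =>
      exact (integral_const_mul c _).trans
        ((congrArg _ hf).trans (integral_const_mul c _).symm)

end Monomials

section CompactOperators

lemma continuous_of_isCompact_of_separating {X Y Z ι : Type*} [TopologicalSpace X]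
    [TopologicalSpace Y] [TopologicalSpace Z] [T2Space Z] {S : Set Y} (hS : IsCompact S)
    {f : X → Y} (hf : ∀ x, f x ∈ S) {g : ι → Y → Z} (hg : ∀ i, Continuous (g i))
    (hsep : ∀ y y', (∀ i, g i y = g i y') → y = y') (h : ∀ i, Continuous fun x => g i (f x)) :
    Continuous f := by
  refine continuous_iff_continuousAt.2 fun x =>
    hS.tendsto_nhds_of_unique_mapClusterPt (Eventually.of_forall hf) fun y _ hy => ?_
  obtain ⟨U, hU, tendsto_y⟩ := mapClusterPt_iff_ultrafilter.1 hy
  exact hsep _ _ fun i => tendsto_nhds_unique (((hg i).tendsto y).comp tendsto_y)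
    (((h i).tendsto x).mono_left hU)

variable {K : Type*} [NormedAddCommGroup K] [InnerProductSpace ℂ K] [CompleteSpace K]

lemma continuous_weakBall_compactOperator {A : K →L[ℂ] K} (hA : IsCompactOperator A) :
    Continuous fun x : WeakBall K => A x.1 := by
  obtain ⟨S, hS, image_subset⟩ := IsCompactOperator.image_closedBall_subset_compact
    (f := (A : K →ₗ[ℂ] K)) hA 1
  refine continuous_of_isCompact_of_separating hS (fun x => image_subset ⟨x.1, x.2, rfl⟩)
    (g := fun z y => ⟪z, y⟫_ℂ) (fun z => continuous_const.inner continuous_id)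
    (fun y y' h => ext_inner_left ℂ h) fun z => ?_
  simp only [← ContinuousLinearMap.adjoint_inner_left]
  exact WeakBall.continuous_inner_right _

lemma continuous_inner_compactOperator {A : K →L[ℂ] K} (hA : IsCompactOperator A) :
    Continuous fun x : WeakBall K => ⟪x.1, A x.1⟫_ℂ := by
  refine continuous_iff_continuousAt.2 fun x => ?_
  have tendsto_inner_sub : Tendsto (fun y : WeakBall K => ⟪y.1, A y.1 - A x.1⟫_ℂ) (𝓝 x) (𝓝 0) :=
    squeeze_zero_norm
      (fun y => (norm_inner_le_norm _ _).trans (mul_le_of_le_one_left (norm_nonneg _) y.norm_le))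
      (tendsto_iff_norm_sub_tendsto_zero.1 ((continuous_weakBall_compactOperator hA).tendsto x))
  have tendsto_add := tendsto_inner_sub.add ((WeakBall.continuous_inner_left (A x.1)).tendsto x)
  rw [zero_add] at tendsto_add
  refine tendsto_add.congr fun y => ?_
  rw [← inner_add_right, sub_add_cancel]

variable {H : Type*} [NormedAddCommGroup H] [InnerProductSpace ℂ H] [CompleteSpace H]

/-- The map `φ ↦ φ^{⊗k}` between unit balls. -/
noncomputable def ballPow (k : ℕ) (φ : WeakBall H) : WeakBall (symPower H k) :=
  ⟨tensorPow k φ.1, by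
    rw [mem_closedBall_zero_iff, norm_tensorPow]
    exact pow_le_one₀ (norm_nonneg _) φ.norm_le⟩

lemma continuous_ballPow (k : ℕ) :
    Continuous (ballPow k : WeakBall H → WeakBall (symPower H k)) := by
  refine continuous_of_isCompact_of_separating isCompact_univ (fun _ => Set.mem_univ _)
    (g := fun (x : Fin k → H) (y : WeakBall (symPower H k)) => ⟪symTensor x, y.1⟫_ℂ)
    (fun x => WeakBall.continuous_inner_right _) (fun y y' h => ?_) fun x => ?_
  · refine Subtype.ext (sub_eq_zero.1 (eq_zero_of_inner_symTensor fun x => ?_))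
    exact (inner_sub_right _ _ _).trans (sub_eq_zero.2 (h x))
  · exact (continuous_finsetProd Finset.univ fun j _ => WeakBall.continuous_inner_right (x j)).congr
      fun φ => (inner_symTensor_tensorPow x φ.1).symm

lemma continuous_inner_tensorPow_compactOperator {k : ℕ} {A : symPower H k →L[ℂ] symPower H k}
    (hA : IsCompactOperator A) :
    Continuous fun φ : WeakBall H => ⟪tensorPow k φ.1, A (tensorPow k φ.1)⟫_ℂ :=
  (continuous_inner_compactOperator hA).comp (continuous_ballPow k)

end CompactOperators

section SphereApproximation

variable {H : Type*} [NormedAddCommGroup H] [InnerProductSpace ℂ H]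

/-- The vector of the unit sphere obtained from `φ`, `‖φ‖ ≤ 1`, by replacing its component
`⟪b, φ⟫` along the unit vector `b` by a nonnegative number. -/
noncomputable def sphereLift (b φ : H) : H :=
  φ + ((√(1 - ‖φ‖ ^ 2 + ‖⟪b, φ⟫_ℂ‖ ^ 2) : ℂ) - ⟪b, φ⟫_ℂ) • b

lemma continuous_sphereLift (b : H) : Continuous (sphereLift b) := by
  unfold sphereLift
  fun_prop

lemma norm_sphereLift {b φ : H} (hb : ‖b‖ = 1) (hφ : ‖φ‖ ≤ 1) : ‖sphereLift b φ‖ = 1 := by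
  have radicand_nonneg : 0 ≤ 1 - ‖φ‖ ^ 2 + ‖⟪b, φ⟫_ℂ‖ ^ 2 :=
    add_nonneg (sub_nonneg.2 (pow_le_one₀ (norm_nonneg φ) hφ)) (sq_nonneg _)
  rw [← sq_eq_sq₀ (norm_nonneg _) zero_le_one, sphereLift, @norm_add_sq ℂ, inner_smul_right,
    ← inner_conj_symm φ b, norm_smul, hb, mul_one, ← Complex.normSq_eq_norm_sq (_ - _),
    Complex.normSq_sub, sub_mul, Complex.mul_conj, map_sub, Complex.normSq_ofReal,
    Real.mul_self_sqrt radicand_nonneg, Complex.normSq_eq_norm_sq, RCLike.re_to_complex,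
    RCLike.re_to_complex, Complex.ofReal_re]
  ring

lemma tendsto_inner_sphereLift {b : ℕ → H} (hb : Orthonormal ℂ b) {φ : H} (hφ : ‖φ‖ ≤ 1) (y : H) :
    Tendsto (fun n => ⟪y, sphereLift (b n) φ⟫_ℂ) atTop (𝓝 ⟪y, φ⟫_ℂ) := by
  have tendsto_inner_b : Tendsto (fun n => ‖⟪y, b n⟫_ℂ‖) atTop (𝓝 0) := by
    have := (hb.inner_products_summable y).tendsto_atTop_zero.sqrt
    simpa only [Real.sqrt_sq (norm_nonneg _), Real.sqrt_zero, norm_inner_symm] using this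
  let c : ℕ → ℂ := fun n => √(1 - ‖φ‖ ^ 2 + ‖⟪b n, φ⟫_ℂ‖ ^ 2) - ⟪b n, φ⟫_ℂ
  have norm_c_le (n : ℕ) : ‖c n‖ ≤ 2 := by
    have norm_c : ‖c n‖ = ‖sphereLift (b n) φ - φ‖ := by
      rw [sphereLift, add_sub_cancel_left, norm_smul, hb.1 n, mul_one]
    rw [norm_c]
    exact (norm_sub_le _ _).trans (by linarith [norm_sphereLift (hb.1 n) hφ])
  have tendsto_mul : Tendsto (fun n => c n * ⟪y, b n⟫_ℂ) atTop (𝓝 0) := by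
    refine squeeze_zero_norm (a := fun n => 2 * ‖⟪y, b n⟫_ℂ‖) (fun n => ?_)
      (by simpa using tendsto_inner_b.const_mul 2)
    rw [norm_mul]
    gcongr
    exact norm_c_le n
  simpa only [sphereLift, inner_add_right, inner_smul_right, add_zero] using
    tendsto_mul.const_add ⟪y, φ⟫_ℂ

variable [CompleteSpace H]

lemma exists_orthonormal_nat (hH : ¬ FiniteDimensional ℂ H) : ∃ b : ℕ → H, Orthonormal ℂ b := by
  have : Infinite (basisIndex H) := by
    by_contra hfin
    have := not_infinite_iff_finite.1 hfin
    have := Fintype.ofFinite (basisIndex H)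
    exact hH (basis H).toOrthonormalBasis.toBasis.finiteDimensional_of_finite
  exact ⟨_, (basis H).orthonormal.comp _ (Infinite.natEmbedding (basisIndex H)).injective⟩

lemma WeakBall.tendsto_of_tendsto_inner {α : Type*} {l : Filter α} {f : α → WeakBall H}
    {x : WeakBall H} (h : ∀ y, Tendsto (fun a => ⟪y, (f a).1⟫_ℂ) l (𝓝 ⟪y, x.1⟫_ℂ)) :
    Tendsto f l (𝓝 x) :=
  (continuous_coords.isClosedEmbedding coords_injective).isEmbedding.tendsto_nhds_iff.2
    (tendsto_pi_nhds.2 fun _ => h _)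

lemma exists_sphere_approximation (hH : ¬ FiniteDimensional ℂ H) :
    ∃ T : ℕ → UnitBall H → UnitBall H, (∀ n, Continuous (T n)) ∧ (∀ n φ, ‖(T n φ).1‖ = 1) ∧
      ∀ φ, Tendsto (fun n => toWeakBall (T n φ)) atTop (𝓝 (toWeakBall φ)) := by
  obtain ⟨b, hb⟩ := exists_orthonormal_nat hH
  have norm_eq_one (n : ℕ) (φ : UnitBall H) : ‖sphereLift (b n) φ.1‖ = 1 :=
    norm_sphereLift (hb.1 n) (norm_le_one_of_mem_unitBall φ)
  exact ⟨fun n φ => ⟨sphereLift (b n) φ.1, mem_closedBall_zero_iff.2 (norm_eq_one n φ).le⟩,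
    fun n => ((continuous_sphereLift _).comp continuous_subtype_val).subtype_mk _, norm_eq_one,
    fun φ => WeakBall.tendsto_of_tendsto_inner
      (tendsto_inner_sphereLift hb (norm_le_one_of_mem_unitBall φ))⟩

end SphereApproximation

section PureStates

variable {H : Type*} [NormedAddCommGroup H] [InnerProductSpace ℂ H] [CompleteSpace H]

lemma slice_tensorPow {k m : ℕ} (φ : H) (J : Fin m → basisIndex H) :
    slice J (tensorPow (k + m) φ : TensorPower H (k + m)) =
      tensor (fun _ => φ) J • (tensorPow k φ : TensorPower H k) :=
  (congrArg (slice J) (congrArg tensor Fin.append_castAdd_natAdd.symm)).trans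
    (slice_tensor_append _ _ J)

lemma inner_tensorPow_ampliation {k m : ℕ} {φ : H} (hφ : ‖φ‖ = 1)
    (A : symPower H k →L[ℂ] symPower H k) :
    ⟪(tensorPow (k + m) φ : TensorPower H (k + m)), ampliation m (extendOp A)
      (tensorPow (k + m) φ)⟫_ℂ = ⟪tensorPow k φ, A (tensorPow k φ)⟫_ℂ := by
  have inner_self : ⟪(tensor fun _ : Fin m => φ), tensor fun _ => φ⟫_ℂ = 1 := by
    simp [inner_self_eq_norm_sq_to_K, norm_tensor, hφ]
  have inner_extendOp_eq : ⟪(tensorPow k φ : TensorPower H k), extendOp A (tensorPow k φ)⟫_ℂ =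
      ⟪tensorPow k φ, A (tensorPow k φ)⟫_ℂ := by
    rw [inner_extendOp, Submodule.orthogonalProjectionOnto_mem_subspace_eq_self]
  rw [← (hasSum_inner_slice _ _).tsum_eq, ← one_mul ⟪tensorPow k φ, _⟫_ℂ, ← inner_self,
    lp.inner_eq_tsum, ← tsum_mul_right]
  refine tsum_congr fun J => ?_
  rw [slice_ampliation, slice_tensorPow, map_smul, inner_smul_left, inner_smul_right,
    inner_extendOp_eq, ← mul_assoc, mul_comm (starRingEnd ℂ _)]
  rfl

variable {X : Type*} [MeasurableSpace X] {μ : Measure X}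

lemma extendOp_ensemble {n : ℕ} {F : X → symPower H n} (hF : MemLp F 2 μ) :
    extendOp (ensemble μ F).op = (ensemble μ fun a => (F a : TensorPower H n)).op := by
  refine ContinuousLinearMap.ext fun y => ext_inner_left ℂ fun x => ?_
  rw [inner_extendOp, inner_ensemble hF]
  refine (integral_congr_ae (.of_forall fun a => ?_)).trans
    (inner_ensemble ((symPower H n).subtypeL.comp_memLp' hF) x y).symm
  exact congrArg₂ (· * ·) (Submodule.inner_orthogonalProjectionOnto_eq_of_mem_right _ _)
    (Submodule.inner_orthogonalProjectionOnto_eq_of_mem_left _ _)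

variable {F : X → H}

lemma memLp_tensorPow_of_norm_eq_one [IsFiniteMeasure μ] (hF : AEStronglyMeasurable F μ)
    (norm_eq_one : ∀ a, ‖F a‖ = 1) (n : ℕ) : MemLp (fun a => tensorPow n (F a)) 2 μ :=
  .of_bound ((continuous_tensorPow n).comp_aestronglyMeasurable hF) 1
    (.of_forall fun a => by rw [norm_tensorPow, norm_eq_one, one_pow])

lemma isReducedDensity_ensemble [IsFiniteMeasure μ] (hF : AEStronglyMeasurable F μ)
    (norm_eq_one : ∀ a, ‖F a‖ = 1) (k m : ℕ) :
    IsReducedDensity (ensemble μ fun a => tensorPow (k + m) (F a))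
      (ensemble μ fun a => tensorPow k (F a)) := by
  have memLp := memLp_tensorPow_of_norm_eq_one hF norm_eq_one
  refine ⟨isPositive_ensemble (memLp k), fun A => ?_⟩
  rw [extendOp_ensemble (memLp (k + m)), trace_ensemble_comp (memLp k)]
  refine (trace_ensemble_comp ((symPower H (k + m)).subtypeL.comp_memLp' (memLp (k + m))) _).trans
    (integral_congr_ae (.of_forall fun a => ?_))
  exact inner_tensorPow_ampliation (norm_eq_one a) A

lemma isNormalState_ensemble [IsProbabilityMeasure μ] (hF : AEStronglyMeasurable F μ)
    (norm_eq_one : ∀ a, ‖F a‖ = 1) (n : ℕ) :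
    IsNormalState (ensemble μ fun a => tensorPow n (F a)) := by
  have memLp := memLp_tensorPow_of_norm_eq_one hF norm_eq_one n
  refine ⟨isPositive_ensemble memLp, ?_⟩
  rw [trace_ensemble memLp]
  simp only [norm_tensorPow, norm_eq_one, one_pow, integral_const, probReal_univ, smul_eq_mul,
    mul_one, Complex.ofReal_one]

variable [MeasurableSpace H] [BorelSpace H] [SecondCountableTopology H]

theorem momentMap_mem_symHierarchies (hH : ¬ FiniteDimensional ℂ H) (μ : InvMeasure H) :
    momentMap μ ∈ symHierarchies H := by
  obtain ⟨T, continuous_T, norm_T, tendsto_T⟩ := exists_sphere_approximation hH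
  have measurable_T (n : ℕ) :
      AEStronglyMeasurable (fun φ => (T n φ).1) (μ.1 : Measure (UnitBall H)) :=
    (continuous_subtype_val.comp (continuous_T n)).stronglyMeasurable.aestronglyMeasurable
  have memLp (n k : ℕ) := memLp_tensorPow_of_norm_eq_one (measurable_T n) (norm_T n) k
  let r : ℕ → ∀ k : ℕ, TraceClass (symPower H k) := fun n k =>
    ensemble (μ.1 : Measure (UnitBall H)) fun φ => tensorPow k (T n φ).1
  refine ⟨fun n => r n n, r, id, fun n => isNormalState_ensemble (measurable_T n) (norm_T n) n,
    fun k m => isReducedDensity_ensemble (measurable_T (k + m)) (norm_T (k + m)) k m,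
    strictMono_id, fun k A hA => ?_⟩
  simp only [id, r, trace_ensemble_comp (memLp _ k), trace_momentMap_comp]
  refine tendsto_integral_of_dominated_convergence (fun _ => ‖A‖)
    (fun n => (memLp n k).1.inner (A.continuous.comp_aestronglyMeasurable (memLp n k).1))
    (integrable_const _) (fun n => .of_forall fun φ => ?_) (.of_forall fun φ => ?_)
  · refine (norm_inner_le_norm (𝕜 := ℂ) (E := symPower H k) _ _).trans ?_
    simpa only [norm_tensorPow, norm_T, one_pow, one_mul, mul_one] using
      A.le_opNorm (tensorPow k (T n φ).1)
  · exact ((continuous_inner_tensorPow_compactOperator hA).tendsto _).comp (tendsto_T φ)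

end PureStates

section WeakNarrow

variable {H : Type*} [NormedAddCommGroup H] [InnerProductSpace ℂ H]

/-- The invariant measure `μ`, as a measure on the closed unit ball with its weak topology. -/
noncomputable def InvMeasure.weak [MeasurableSpace H] (μ : InvMeasure H) :
    ProbabilityMeasure (WeakBall H) :=
  ⟨(μ.1 : Measure (UnitBall H)),
    inferInstanceAs (IsProbabilityMeasure (μ.1 : Measure (UnitBall H)))⟩

variable [CompleteSpace H]

lemma continuous_toWeakBall_rotate (θ : ℝ) :
    Continuous fun x : WeakBall H => toWeakBall (rotate θ x) := by
  refine WeakBall.continuous_of_continuous_inner fun y => ?_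
  exact ((WeakBall.continuous_inner_right y).const_mul (Complex.exp (θ * Complex.I))).congr
    fun x => (inner_smul_right _ _ _).symm

variable [SecondCountableTopology H] [MeasurableSpace H] [BorelSpace H]

lemma range_weak : Set.range (InvMeasure.weak : InvMeasure H → _) =
    ⋂ θ : ℝ, {ρ | ρ.map (continuous_toWeakBall_rotate θ).measurable.aemeasurable = ρ} := by
  refine Set.Subset.antisymm (Set.range_subset_iff.2 fun μ => Set.mem_iInter.2 fun θ =>
    Subtype.ext (μ.2 θ)) fun ρ hρ => ?_
  exact ⟨⟨⟨(ρ : Measure (WeakBall H)),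
    inferInstanceAs (IsProbabilityMeasure (ρ : Measure (WeakBall H)))⟩,
    fun θ => congrArg Subtype.val (Set.mem_iInter.1 hρ θ)⟩, rfl⟩

lemma weakNarrow_eq_induced : weakNarrow H = .induced InvMeasure.weak inferInstance := by
  refine le_antisymm ?_ (le_iInf fun f => continuous_iff_le_induced.1 ?_)
  · let _ := weakNarrow H
    refine continuous_iff_le_induced.1 (continuous_iff_continuousAt.2 fun μ =>
      ProbabilityMeasure.tendsto_iff_forall_integral_tendsto.2 fun f => ?_)
    have bounded : ∃ C, ∀ x, |f x| ≤ C := ⟨‖f‖, f.norm_coe_le_norm⟩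
    have continuous_integral : Continuous[weakNarrow H, inferInstance] fun μ : InvMeasure H =>
        ∫ φ : UnitBall H, f (toWeakBall φ) ∂(μ.1 : Measure (UnitBall H)) :=
      continuous_iInf_dom (i := ⟨fun φ => f (toWeakBall φ), f.continuous, bounded⟩)
        continuous_induced_dom
    exact continuous_integral.tendsto μ
  · have continuous_integral : Continuous fun ρ : ProbabilityMeasure (WeakBall H) =>
        ∫ x, f.1 x ∂(ρ : Measure (WeakBall H)) := continuous_integral_of_compactSpace f.2.1
    let _ : TopologicalSpace (InvMeasure H) := .induced InvMeasure.weak inferInstance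
    exact continuous_integral.comp continuous_induced_dom

lemma compactSpace_weakNarrow : @CompactSpace _ (weakNarrow H) := by
  let _ := weakNarrow H
  have isInducing : IsInducing (InvMeasure.weak : InvMeasure H → _) := ⟨weakNarrow_eq_induced⟩
  refine ⟨isInducing.isCompact_iff.2 ?_⟩
  rw [Set.image_univ, range_weak]
  exact (isClosed_iInter fun θ => isClosed_eq
    (ProbabilityMeasure.continuous_map (continuous_toWeakBall_rotate θ)) continuous_id).isCompact

lemma continuous_integral_weakNarrow {𝕜 : Type*} [RCLike 𝕜] {f : WeakBall H → 𝕜}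
    (hf : Continuous f) : Continuous[weakNarrow H, inferInstance] fun μ : InvMeasure H =>
      ∫ φ : UnitBall H, f (toWeakBall φ) ∂(μ.1 : Measure (UnitBall H)) := by
  rw [weakNarrow_eq_induced]
  let _ : TopologicalSpace (InvMeasure H) := .induced InvMeasure.weak inferInstance
  exact (continuous_integral_of_compactSpace hf).comp continuous_induced_dom

end WeakNarrow

section WeakHomeomorphism

lemma continuous_induced_pi {W Z ι : Type*} {E : ι → Type*} [∀ i, TopologicalSpace (E i)]
    [TopologicalSpace Z] (f : W → ∀ i, E i) {i : ι} {g : E i → Z} (hg : Continuous g) :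
    Continuous[.induced f Pi.topologicalSpace, inferInstance] fun w => g (f w i) :=
  let _ : TopologicalSpace W := .induced f Pi.topologicalSpace
  (hg.comp (continuous_apply i)).comp continuous_induced_dom

variable {H : Type*} [NormedAddCommGroup H] [InnerProductSpace ℂ H] [CompleteSpace H]

variable (H) in
/-- The topology of pointwise convergence of the correlation functions. It is Hausdorff and coarser
than both topologies of the theorem on the symmetric hierarchies. -/
@[reducible] noncomputable def corrTopology : TopologicalSpace (symHierarchies H) :=
  .induced (fun γ => corr γ.1) inferInstance

lemma t2Space_corrTopology : @T2Space _ (corrTopology H) :=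
  let _ := corrTopology H
  .of_injective_continuous (fun _ _ h => Subtype.ext (eq_of_corr_eq h)) continuous_induced_dom

lemma induced_le_corrTopology (t : ∀ k, TopologicalSpace (TraceClass (symPower H k)))
    (ht : ∀ k x y, Continuous[t k, inferInstance]
      fun T : TraceClass (symPower H k) => ⟪x, T.op y⟫_ℂ) :
    .induced Subtype.val (@Pi.topologicalSpace _ _ t) ≤ corrTopology H := by
  let _ : TopologicalSpace (symHierarchies H) := .induced Subtype.val (@Pi.topologicalSpace _ _ t)
  refine continuous_iff_le_induced.1 (continuous_pi fun m => ?_)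
  obtain ⟨n, x, rfl⟩ := exists_ofFn m
  simp only [corr_ofFn]
  exact @continuous_induced_pi _ _ _ _ t _ Subtype.val _ _ (ht n _ _)

lemma hierarchyWeakStar_le_corrTopology : hierarchyWeakStar H ≤ corrTopology H := by
  refine induced_le_corrTopology _ fun k x y => ?_
  simp only [← trace_comp_rankOne]
  exact continuous_iInf_dom (i := ⟨_, isCompactOperator_rankOne y x⟩) continuous_induced_dom

lemma hierarchyNorm_le_corrTopology : hierarchyNorm H ≤ corrTopology H :=
  induced_le_corrTopology _ fun _ x y => (matrixElement x y).continuous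

variable [SecondCountableTopology H] [MeasurableSpace H] [BorelSpace H]
  (hH : ¬ FiniteDimensional ℂ H)

/-- The map `Φ` of the theorem, as a bijection. -/
noncomputable def momentEquiv : InvMeasure H ≃ symHierarchies H :=
  Equiv.ofBijective (fun μ => ⟨momentMap μ, momentMap_mem_symHierarchies hH μ⟩)
    ⟨fun _ _ h => momentMap_injective (congrArg Subtype.val h), fun γ =>
      (exists_momentMap_eq γ.2).imp fun _ => Subtype.ext⟩

lemma continuous_momentEquiv_corrTopology :
    Continuous[weakNarrow H, corrTopology H] (momentEquiv hH) := by
  let _ := weakNarrow H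
  refine continuous_induced_rng.2 (continuous_pi fun m => ?_)
  exact (continuous_integral_weakNarrow (WeakBall.continuous_pointMoment m)).congr
    fun μ => (corr_momentMap μ m).symm

lemma continuous_momentEquiv_symm_corrTopology :
    Continuous[corrTopology H, weakNarrow H] (momentEquiv hH).symm := by
  let _ := weakNarrow H
  let _ := corrTopology H
  have := compactSpace_weakNarrow (H := H)
  have := t2Space_corrTopology (H := H)
  exact (continuous_momentEquiv_corrTopology hH).continuous_symm_of_equiv_compact_to_t2

lemma continuous_momentEquiv_weakStar :
    Continuous[weakNarrow H, hierarchyWeakStar H] (momentEquiv hH) := by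
  let _ := weakNarrow H
  let _ (k : ℕ) := weakStarTopology (symPower H k)
  refine continuous_induced_rng.2 (continuous_pi fun k =>
    continuous_iInf_rng.2 fun A => continuous_induced_rng.2 ?_)
  exact (continuous_integral_weakNarrow (continuous_inner_tensorPow_compactOperator A.2)).congr
    fun μ => (trace_momentMap_comp μ k A.1).symm

theorem isHomeomorph_momentEquiv_weak :
    @IsHomeomorph _ _ (weakNarrow H) (hierarchyWeakStar H) (momentEquiv hH) := by
  let _ := weakNarrow H
  let _ := hierarchyWeakStar H
  exact (Homeomorph.mk (momentEquiv hH) (continuous_momentEquiv_weakStar hH) (continuous_le_dom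
    hierarchyWeakStar_le_corrTopology (continuous_momentEquiv_symm_corrTopology hH))).isHomeomorph

end WeakHomeomorphism

section IntegralTendsto

/-- The function `F` is integrable for all the measures `ν a` and for `μ`, and its integrals for
`ν a` converge along `l` to its integral for `μ`. -/
structure IntegralTendsto {α X E : Type*} [MeasurableSpace X] [NormedAddCommGroup E]
    [NormedSpace ℝ E] (ν : α → Measure X) (l : Filter α) (μ : Measure X) (F : X → E) : Prop where
  integrable : ∀ a, Integrable F (ν a)
  integrable_limit : Integrable F μ
  tendsto : Tendsto (fun a => ∫ x, F x ∂ν a) l (𝓝 (∫ x, F x ∂μ))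

variable {α X E : Type*} [MeasurableSpace X] [NormedAddCommGroup E] [NormedSpace ℝ E]
  {ν : α → Measure X} {l : Filter α} {μ : Measure X}

namespace IntegralTendsto

lemma sub {F G : X → E} (hF : IntegralTendsto ν l μ F) (hG : IntegralTendsto ν l μ G) :
    IntegralTendsto ν l μ fun x => F x - G x where
  integrable a := (hF.integrable a).sub (hG.integrable a)
  integrable_limit := hF.integrable_limit.sub hG.integrable_limit
  tendsto := by
    simp only [integral_sub (hF.integrable _) (hG.integrable _),
      integral_sub hF.integrable_limit hG.integrable_limit]
    exact hF.tendsto.sub hG.tendsto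

lemma const_smul {F : X → E} (hF : IntegralTendsto ν l μ F) (c : ℝ) :
    IntegralTendsto ν l μ fun x => c • F x where
  integrable a := (hF.integrable a).smul c
  integrable_limit := hF.integrable_limit.smul c
  tendsto := by
    simp only [integral_smul]
    exact hF.tendsto.const_smul c

lemma smul_const [CompleteSpace E] {c : X → ℝ} (hc : IntegralTendsto ν l μ c) (e : E) :
    IntegralTendsto ν l μ fun x => c x • e where
  integrable a := (hc.integrable a).smul_const e
  integrable_limit := hc.integrable_limit.smul_const e
  tendsto := by
    simp only [integral_smul_const]
    exact hc.tendsto.smul_const e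

lemma finset_sum {ι : Type*} (s : Finset ι) {F : ι → X → E}
    (hF : ∀ i, IntegralTendsto ν l μ (F i)) :
    IntegralTendsto ν l μ fun x => ∑ i ∈ s, F i x where
  integrable a := integrable_finsetSum s fun i _ => (hF i).integrable a
  integrable_limit := integrable_finsetSum s fun i _ => (hF i).integrable_limit
  tendsto := by
    rw [integral_finsetSum s fun i _ => (hF i).integrable_limit]
    exact (tendsto_finsetSum s fun i _ => (hF i).tendsto).congr fun a =>
      (integral_finsetSum s fun i _ => (hF i).integrable a).symm

end IntegralTendsto

lemma dist_integral_le_of_norm_sub_le [IsProbabilityMeasure μ] {F G : X → E} {s : X → ℝ}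
    (hF : Integrable F μ) (hG : Integrable G μ) (hs : Integrable s μ) {C ε : ℝ}
    (h : ∀ x, ‖F x - G x‖ ≤ C * (ε + s x)) :
    dist (∫ x, F x ∂μ) (∫ x, G x ∂μ) ≤ C * (ε + ∫ x, s x ∂μ) := by
  rw [dist_eq_norm, ← integral_sub hF hG]
  refine (norm_integral_le_of_norm_le (((integrable_const ε).add hs).const_mul C)
    (.of_forall h)).trans_eq ?_
  rw [integral_const_mul, integral_add' (integrable_const ε) hs, integral_const, probReal_univ,
    one_smul]

/-- The error function `s` is controlled in mean only, and its mean for `ν a` is small because its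
mean for `μ` is. -/
theorem integralTendsto_of_approximation [∀ a, IsProbabilityMeasure (ν a)]
    [IsProbabilityMeasure μ] {F : X → E} (hF : ∀ a, Integrable F (ν a)) (hFμ : Integrable F μ)
    {C : ℝ} (hC : 0 ≤ C)
    (h : ∀ ε > 0, ∃ (G : X → E) (s : X → ℝ), IntegralTendsto ν l μ G ∧ IntegralTendsto ν l μ s ∧
      ∫ x, s x ∂μ < ε ∧ ∀ x, ‖F x - G x‖ ≤ C * (ε + s x)) :
    IntegralTendsto ν l μ F := by
  refine ⟨hF, hFμ, Metric.tendsto_nhds.2 fun ε' hε' => ?_⟩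
  obtain ⟨ε, hε, ε_lt⟩ : ∃ ε > 0, (4 * C + 1) * ε = ε' :=
    ⟨ε' / (4 * C + 1), by positivity, by field_simp⟩
  obtain ⟨G, s, hG, hs, integral_s_lt, norm_sub_le⟩ := h ε hε
  filter_upwards [hs.tendsto.eventually_lt_const integral_s_lt,
    Metric.tendsto_nhds.1 hG.tendsto ε hε] with a integral_s_lt_a dist_lt
  calc dist (∫ x, F x ∂ν a) (∫ x, F x ∂μ)
      ≤ dist (∫ x, F x ∂ν a) (∫ x, G x ∂ν a) + dist (∫ x, G x ∂ν a) (∫ x, G x ∂μ) +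
          dist (∫ x, G x ∂μ) (∫ x, F x ∂μ) := dist_triangle4 _ _ _ _
    _ < C * (ε + ε) + ε + C * (ε + ε) := by
      rw [dist_comm (∫ x, G x ∂μ)]
      refine add_lt_add_of_lt_of_le (add_lt_add_of_le_of_lt ?_ dist_lt) ?_
      · exact (dist_integral_le_of_norm_sub_le (hF a) (hG.integrable a) (hs.integrable a)
          norm_sub_le).trans (by gcongr)
      · exact (dist_integral_le_of_norm_sub_le hFμ hG.integrable_limit hs.integrable_limit
          norm_sub_le).trans (by gcongr)
    _ = ε' := by linarith

end IntegralTendsto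

section FiniteRankApproximation

variable {E : Type*} [NormedAddCommGroup E]

/-- The tent function of height `ε` supported in the ball of radius `ε` around `e`. -/
noncomputable def tent (ε : ℝ) (e y : E) : ℝ := max 0 (ε - ‖y - e‖)

lemma tent_nonneg (ε : ℝ) (e y : E) : 0 ≤ tent ε e y := le_max_left _ _

lemma continuous_tent (ε : ℝ) (e : E) : Continuous (tent ε e) := by
  unfold tent
  fun_prop

/-- The part of the unit mass that is not distributed to the tents around `e 0, …, e (n - 1)`. The
factor `n` makes it tend to `0` wherever one of the tents is positive. -/
noncomputable def defect (ε : ℝ) (e : ℕ → E) (n : ℕ) (y : E) : ℝ :=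
  (1 + n * ∑ j ∈ Finset.range n, tent ε (e j) y)⁻¹

lemma one_le_one_add_sum_tent (ε : ℝ) (e : ℕ → E) (n : ℕ) (y : E) :
    1 ≤ 1 + n * ∑ j ∈ Finset.range n, tent ε (e j) y :=
  le_add_of_nonneg_right
    (mul_nonneg n.cast_nonneg (Finset.sum_nonneg fun _ _ => tent_nonneg _ _ _))

lemma defect_nonneg (ε : ℝ) (e : ℕ → E) (n : ℕ) (y : E) : 0 ≤ defect ε e n y :=
  inv_nonneg.2 (zero_le_one.trans (one_le_one_add_sum_tent ε e n y))

lemma norm_defect_le_one (ε : ℝ) (e : ℕ → E) (n : ℕ) (y : E) : ‖defect ε e n y‖ ≤ 1 := by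
  rw [Real.norm_of_nonneg (defect_nonneg ε e n y)]
  exact inv_le_one_of_one_le₀ (one_le_one_add_sum_tent ε e n y)

lemma continuous_defect (ε : ℝ) (e : ℕ → E) (n : ℕ) : Continuous (defect ε e n) :=
  (continuous_const.add (continuous_const.mul
    (continuous_finsetSum _ fun j _ => continuous_tent ε (e j)))).inv₀ fun y =>
      (zero_lt_one.trans_le (one_le_one_add_sum_tent ε e n y)).ne'

lemma tendsto_defect {ε : ℝ} (hε : 0 < ε) {e : ℕ → E} {y : E} (hy : y ∈ closure (Set.range e)) :
    Tendsto (fun n => defect ε e n y) atTop (𝓝 0) := by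
  obtain ⟨_, ⟨j, rfl⟩, dist_lt⟩ := Metric.mem_closure_iff.1 hy ε hε
  have tent_pos : 0 < tent ε (e j) y := lt_max_of_lt_right (by rwa [sub_pos, ← dist_eq_norm])
  refine squeeze_zero' (.of_forall fun n => defect_nonneg ε e n y)
    (g := fun n : ℕ => (n * tent ε (e j) y)⁻¹) ?_
    (tendsto_natCast_atTop_atTop.atTop_mul_const tent_pos).inv_tendsto_atTop
  filter_upwards [eventually_gt_atTop j] with n hn
  have n_pos : (0 : ℝ) < n := by exact_mod_cast (Nat.zero_le j).trans_lt hn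
  refine inv_anti₀ (by positivity) (le_add_of_nonneg_of_le zero_le_one ?_)
  gcongr
  exact Finset.single_le_sum (f := fun j => tent ε (e j) y) (fun i _ => tent_nonneg _ _ _)
    (Finset.mem_range.2 hn)

/-- The mass distributed to the tent around `e j`. -/
noncomputable def tentWeight (ε : ℝ) (e : ℕ → E) (n j : ℕ) (y : E) : ℝ :=
  n * tent ε (e j) y * defect ε e n y

lemma tentWeight_nonneg (ε : ℝ) (e : ℕ → E) (n j : ℕ) (y : E) : 0 ≤ tentWeight ε e n j y :=
  mul_nonneg (mul_nonneg n.cast_nonneg (tent_nonneg _ _ _)) (defect_nonneg _ _ _ _)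

lemma continuous_tentWeight (ε : ℝ) (e : ℕ → E) (n j : ℕ) : Continuous (tentWeight ε e n j) :=
  (continuous_const.mul (continuous_tent ε (e j))).mul (continuous_defect ε e n)

lemma norm_tentWeight_le {ε : ℝ} (hε : 0 ≤ ε) (e : ℕ → E) (n j : ℕ) (y : E) :
    ‖tentWeight ε e n j y‖ ≤ n * ε := by
  have tent_le : tent ε (e j) y ≤ ε := max_le hε (sub_le_self _ (norm_nonneg _))
  rw [tentWeight, norm_mul, norm_mul, Real.norm_natCast, Real.norm_of_nonneg (tent_nonneg _ _ _)]
  exact (mul_le_of_le_one_right (mul_nonneg n.cast_nonneg (tent_nonneg _ _ _))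
    (norm_defect_le_one ε e n y)).trans (by gcongr)

lemma sum_tentWeight_add_defect (ε : ℝ) (e : ℕ → E) (n : ℕ) (y : E) :
    ∑ j ∈ Finset.range n, tentWeight ε e n j y + defect ε e n y = 1 := by
  simp only [tentWeight]
  rw [← Finset.sum_mul, ← Finset.mul_sum, ← add_one_mul, add_comm, defect]
  exact mul_inv_cancel₀ (zero_lt_one.trans_le (one_le_one_add_sum_tent ε e n y)).ne'

variable [NormedSpace ℝ E]

lemma norm_sub_sum_tentWeight_le {ε : ℝ} (hε : 0 ≤ ε) (e : ℕ → E) (n : ℕ) (y : E) :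
    ‖y - ∑ j ∈ Finset.range n, tentWeight ε e n j y • e j‖ ≤ ε + ‖y‖ * defect ε e n y := by
  have sub_eq : y - ∑ j ∈ Finset.range n, tentWeight ε e n j y • e j =
      ∑ j ∈ Finset.range n, tentWeight ε e n j y • (y - e j) + defect ε e n y • y := by
    simp only [smul_sub, Finset.sum_sub_distrib, ← Finset.sum_smul]
    rw [sub_add_eq_add_sub, ← add_smul, sum_tentWeight_add_defect, one_smul]
  have norm_smul_le (j : ℕ) :
      ‖tentWeight ε e n j y • (y - e j)‖ ≤ tentWeight ε e n j y * ε := by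
    rw [norm_smul, Real.norm_of_nonneg (tentWeight_nonneg _ _ _ _ _)]
    by_cases h : ‖y - e j‖ ≤ ε
    · exact mul_le_mul_of_nonneg_left h (tentWeight_nonneg _ _ _ _ _)
    · simp [tentWeight, tent, max_eq_left (sub_nonpos.2 (not_le.1 h).le)]
  have sum_le_one : ∑ j ∈ Finset.range n, tentWeight ε e n j y ≤ 1 :=
    (le_add_of_nonneg_right (defect_nonneg ε e n y)).trans_eq (sum_tentWeight_add_defect ε e n y)
  rw [sub_eq]
  refine (norm_add_le _ _).trans (add_le_add ?_ ?_)
  · refine (norm_sum_le_of_le _ fun j _ => norm_smul_le j).trans ?_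
    rw [← Finset.sum_mul]
    exact mul_le_of_le_one_left hε sum_le_one
  · rw [norm_smul, Real.norm_of_nonneg (defect_nonneg ε e n y), mul_comm]

end FiniteRankApproximation

section BochnerContinuity

variable {X : Type*} [TopologicalSpace X] [MeasurableSpace X] [OpensMeasurableSpace X]

lemma integralTendsto_nhds_real {f : X → ℝ} (hf : Continuous f) {C : ℝ} (hC : ∀ x, ‖f x‖ ≤ C)
    (μ : ProbabilityMeasure X) :
    IntegralTendsto (fun ν : ProbabilityMeasure X => (ν : Measure X)) (𝓝 μ) μ f :=
  let g : BoundedContinuousFunction X ℝ := .ofNormedAddCommGroup f hf C hC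
  ⟨fun _ => g.integrable _, g.integrable _,
    ProbabilityMeasure.tendsto_iff_forall_integral_tendsto.1 tendsto_id g⟩

variable [SecondCountableTopology X] {E : Type*} [NormedAddCommGroup E] [NormedSpace ℝ E]
  [CompleteSpace E]

theorem continuous_integral_of_bounded {F : X → E} (hF : Continuous F) {M : ℝ}
    (hM : ∀ x, ‖F x‖ ≤ M) :
    Continuous fun ν : ProbabilityMeasure X => ∫ x, F x ∂(ν : Measure X) := by
  refine continuous_iff_continuousAt.2 fun μ => ?_
  have := μ.nonempty
  have M_nonneg : 0 ≤ M := (norm_nonneg _).trans (hM this.some)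
  have integrable (ν : ProbabilityMeasure X) : Integrable F (ν : Measure X) :=
    .of_bound hF.stronglyMeasurable.aestronglyMeasurable M (.of_forall hM)
  refine (integralTendsto_of_approximation integrable (integrable μ) (C := 1 + M) (by positivity)
    fun ε hε => ?_).tendsto
  let e : ℕ → E := F ∘ TopologicalSpace.denseSeq X
  have mem_closure (x : X) : F x ∈ closure (Set.range e) := by
    rw [Set.range_comp]
    exact image_closure_subset_closure_image hF
      ⟨x, TopologicalSpace.denseRange_denseSeq X x, rfl⟩
  have tendsto_integral_defect :
      Tendsto (fun n => ∫ x, defect ε e n (F x) ∂(μ : Measure X)) atTop (𝓝 0) := by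
    rw [← integral_zero X ℝ (μ := (μ : Measure X))]
    exact tendsto_integral_of_dominated_convergence (fun _ => 1)
      (fun n => ((continuous_defect ε e n).comp hF).stronglyMeasurable.aestronglyMeasurable)
      (integrable_const _) (fun n => .of_forall fun x => norm_defect_le_one _ _ _ _)
      (.of_forall fun x => tendsto_defect hε (mem_closure x))
  obtain ⟨n, integral_defect_lt⟩ := (tendsto_integral_defect.eventually_lt_const hε).exists
  refine ⟨_, fun x => defect ε e n (F x), .finset_sum (Finset.range n) fun j =>
    .smul_const (integralTendsto_nhds_real ((continuous_tentWeight ε e n j).comp hF)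
      (fun x => norm_tentWeight_le hε.le e n j (F x)) μ) (e j),
    integralTendsto_nhds_real ((continuous_defect ε e n).comp hF)
      (fun x => norm_defect_le_one _ _ _ _) μ, integral_defect_lt, fun x => ?_⟩
  refine (norm_sub_sum_tentWeight_le hε.le e n (F x)).trans ?_
  nlinarith [mul_le_mul_of_nonneg_right (hM x) (defect_nonneg ε e n (F x)),
    defect_nonneg ε e n (F x), mul_nonneg M_nonneg hε.le]

end BochnerContinuity

section Truncation

variable {H : Type*} [NormedAddCommGroup H] [InnerProductSpace ℂ H] [CompleteSpace H]

/-- The squared norm of the projection of `φ` to the span of the basis vectors in `s`. -/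
noncomputable def truncNormSq (s : Finset (basisIndex H)) (φ : H) : ℝ :=
  ∑ i ∈ s, ‖⟪basis H i, φ⟫_ℂ‖ ^ 2

lemma truncNormSq_nonneg (s : Finset (basisIndex H)) (φ : H) : 0 ≤ truncNormSq s φ :=
  Finset.sum_nonneg fun _ _ => by positivity

lemma truncNormSq_le (s : Finset (basisIndex H)) (φ : H) : truncNormSq s φ ≤ ‖φ‖ ^ 2 :=
  (basis H).orthonormal.sum_inner_products_le φ

lemma continuous_truncNormSq (s : Finset (basisIndex H)) :
    Continuous fun φ : WeakBall H => truncNormSq s φ.1 :=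
  continuous_finsetSum _ fun i _ => (WeakBall.continuous_inner_right (basis H i)).norm.pow 2

lemma norm_sum_inner_smul_sq (s : Finset (basisIndex H)) (φ : H) :
    ‖∑ i ∈ s, ⟪basis H i, φ⟫_ℂ • basis H i‖ ^ 2 = truncNormSq s φ := by
  refine Complex.ofReal_injective ?_
  rw [Complex.ofReal_pow, truncNormSq, Complex.ofReal_sum]
  refine (inner_self_eq_norm_sq_to_K (𝕜 := ℂ) (E := H) _).symm.trans ?_
  rw [(basis H).orthonormal.inner_sum]
  exact Finset.sum_congr rfl fun i _ => by rw [RCLike.conj_mul, Complex.ofReal_pow]; rfl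

lemma norm_sub_sum_inner_smul_sq (s : Finset (basisIndex H)) (φ : H) :
    ‖φ - ∑ i ∈ s, ⟪basis H i, φ⟫_ℂ • basis H i‖ ^ 2 = ‖φ‖ ^ 2 - truncNormSq s φ := by
  have inner_eq : ⟪φ, ∑ i ∈ s, ⟪basis H i, φ⟫_ℂ • basis H i⟫_ℂ = (truncNormSq s φ : ℂ) := by
    rw [inner_sum, truncNormSq, Complex.ofReal_sum]
    refine Finset.sum_congr rfl fun i _ => ?_
    rw [inner_smul_right, ← inner_conj_symm φ, RCLike.mul_conj, Complex.ofReal_pow]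
    rfl
  rw [norm_sub_sq (𝕜 := ℂ), inner_eq, norm_sum_inner_smul_sq, RCLike.re_to_complex,
    Complex.ofReal_re]
  ring

/-- The projection to the span of the basis vectors in `s`, on the unit ball. It is continuous from
the weak to the norm topology because it has finite rank. -/
noncomputable def trunc (s : Finset (basisIndex H)) (φ : WeakBall H) : UnitBall H :=
  ⟨∑ i ∈ s, ⟪basis H i, φ.1⟫_ℂ • basis H i, by
    rw [mem_closedBall_zero_iff, ← sq_le_one_iff₀ (norm_nonneg _), norm_sum_inner_smul_sq]
    exact (truncNormSq_le s φ.1).trans (pow_le_one₀ (norm_nonneg _) φ.norm_le)⟩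

lemma continuous_trunc (s : Finset (basisIndex H)) :
    Continuous (trunc s : WeakBall H → UnitBall H) :=
  .subtype_mk (continuous_finsetSum _ fun i _ =>
    (WeakBall.continuous_inner_right (basis H i)).smul continuous_const) _

lemma dist_trunc_le (s : Finset (basisIndex H)) (φ : UnitBall H) {ε : ℝ} (hε : 0 < ε) :
    dist φ (trunc s (toWeakBall φ)) ≤ ε + ε⁻¹ * (‖φ.1‖ ^ 2 - truncNormSq s φ.1) := by
  rw [Subtype.dist_eq, dist_eq_norm, ← norm_sub_sum_inner_smul_sq]
  change ‖φ.1 - ∑ i ∈ s, ⟪basis H i, φ.1⟫_ℂ • basis H i‖ ≤ _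
  set t := ‖φ.1 - ∑ i ∈ s, ⟪basis H i, φ.1⟫_ℂ • basis H i‖
  have completed_square : ε + ε⁻¹ * t ^ 2 - t = ε⁻¹ * ((t - ε / 2) ^ 2 + 3 / 4 * ε ^ 2) := by
    field_simp
    ring
  have completed_square_nonneg : 0 ≤ ε⁻¹ * ((t - ε / 2) ^ 2 + 3 / 4 * ε ^ 2) := by positivity
  linarith

end Truncation

section StrongHomeomorphism

lemma integrable_norm_sq {H : Type*} [NormedAddCommGroup H] [MeasurableSpace H] [BorelSpace H]
    (μ : Measure (UnitBall H)) [IsFiniteMeasure μ] :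
    Integrable (fun φ : UnitBall H => ‖φ.1‖ ^ 2) μ :=
  .of_bound (continuous_subtype_val.norm.pow 2).aestronglyMeasurable 1 <| .of_forall fun φ => by
    rw [Real.norm_of_nonneg (by positivity)]
    exact pow_le_one₀ (norm_nonneg _) (norm_le_one_of_mem_unitBall φ)

variable {H : Type*} [NormedAddCommGroup H] [InnerProductSpace ℂ H] [CompleteSpace H]
  [MeasurableSpace H] [BorelSpace H]

lemma integrable_truncNormSq (s : Finset (basisIndex H)) (μ : Measure (UnitBall H))
    [IsFiniteMeasure μ] : Integrable (fun φ : UnitBall H => truncNormSq s φ.1) μ :=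
  (integrable_norm_sq μ).mono'
    ((continuous_truncNormSq s).comp WeakBall.continuous_toWeakBall).aestronglyMeasurable
    (.of_forall fun φ => by
      rw [Real.norm_of_nonneg (truncNormSq_nonneg _ _)]
      exact truncNormSq_le s φ.1)

variable [SecondCountableTopology H]

lemma tendsto_integral_truncNormSq (μ : Measure (UnitBall H)) [IsFiniteMeasure μ] :
    Tendsto (fun s : Finset (basisIndex H) => ∫ φ : UnitBall H, truncNormSq s φ.1 ∂μ) atTop
      (𝓝 (∫ φ : UnitBall H, ‖φ.1‖ ^ 2 ∂μ)) := by
  refine tendsto_integral_filter_of_dominated_convergence (fun φ => ‖φ.1‖ ^ 2)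
    (.of_forall fun s => (integrable_truncNormSq s μ).aestronglyMeasurable)
    (.of_forall fun s => .of_forall fun φ => ?_) (integrable_norm_sq μ)
    (.of_forall fun φ => hasSum_norm_inner_sq (basis H) φ.1)
  rw [Real.norm_of_nonneg (truncNormSq_nonneg _ _)]
  exact truncNormSq_le s φ.1

lemma integralTendsto_of_tendsto_weakNarrow {α : Type*} {l : Filter α} {ν : α → InvMeasure H}
    {μ : InvMeasure H} (hν : Tendsto ν l (@nhds _ (weakNarrow H) μ)) {f : WeakBall H → ℝ}
    (hf : Continuous f) :
    IntegralTendsto (fun a => ((ν a).1 : Measure (UnitBall H))) l (μ.1 : Measure (UnitBall H))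
      fun φ => f (toWeakBall φ) :=
  have integrable (ρ : InvMeasure H) :
      Integrable (fun φ => f (toWeakBall φ)) (ρ.1 : Measure (UnitBall H)) :=
    (BoundedContinuousFunction.mkOfCompact ⟨f, hf⟩).integrable (ρ.weak : Measure (WeakBall H))
  let _ := weakNarrow H
  ⟨fun a => integrable (ν a), integrable μ, ((continuous_integral_weakNarrow hf).tendsto μ).comp hν⟩

/-- A Lipschitz function is close in mean to its composition with a truncation, with an error that
the difference of the second moments controls. -/
theorem tendsto_of_tendsto_weakNarrow {α : Type*} {l : Filter α} [l.IsCountablyGenerated]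
    {ν : α → InvMeasure H} {μ : InvMeasure H} (hν : Tendsto ν l (@nhds _ (weakNarrow H) μ))
    (h_sq : Tendsto (fun a => ∫ φ, ‖φ.1‖ ^ 2 ∂((ν a).1 : Measure (UnitBall H))) l
      (𝓝 (∫ φ, ‖φ.1‖ ^ 2 ∂(μ.1 : Measure (UnitBall H))))) :
    Tendsto (fun a => (ν a).1) l (𝓝 μ.1) := by
  rw [tendsto_iff_forall_lipschitz_integral_tendsto]
  rintro f ⟨C, hC⟩ ⟨L, hL⟩
  let g : BoundedContinuousFunction (UnitBall H) ℝ := ⟨⟨f, hL.continuous⟩, C, hC⟩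
  refine (integralTendsto_of_approximation (fun a => g.integrable _) (g.integrable _) L.2
    fun ε hε => ?_).tendsto
  have tendsto_error := (tendsto_integral_truncNormSq (μ.1 : Measure (UnitBall H))).const_sub
    (∫ φ, ‖φ.1‖ ^ 2 ∂(μ.1 : Measure (UnitBall H)))
  rw [sub_self] at tendsto_error
  obtain ⟨s, error_lt⟩ := (tendsto_error.eventually_lt_const (pow_pos hε 2)).exists
  have norm_sq : IntegralTendsto (fun a => ((ν a).1 : Measure (UnitBall H))) l
      (μ.1 : Measure (UnitBall H)) fun φ => ‖φ.1‖ ^ 2 :=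
    ⟨fun a => integrable_norm_sq _, integrable_norm_sq _, h_sq⟩
  refine ⟨fun φ => f (trunc s (toWeakBall φ)),
    fun φ => ε⁻¹ • (‖φ.1‖ ^ 2 - truncNormSq s φ.1),
    integralTendsto_of_tendsto_weakNarrow hν (hL.continuous.comp (continuous_trunc s)),
    (norm_sq.sub (integralTendsto_of_tendsto_weakNarrow hν
      (continuous_truncNormSq s))).const_smul ε⁻¹, ?_, fun φ => ?_⟩
  · rw [integral_smul, integral_sub (integrable_norm_sq _) (integrable_truncNormSq s _),
      smul_eq_mul, inv_mul_lt_iff₀ hε, ← pow_two]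
    exact error_lt
  · exact (dist_eq_norm (f φ) _).symm.trans_le <| (hL.dist_le_mul _ _).trans <|
      mul_le_mul_of_nonneg_left (dist_trunc_le s φ hε) L.2

variable (hH : ¬ FiniteDimensional ℂ H)

lemma continuous_momentEquiv_norm :
    Continuous[strongNarrow H, hierarchyNorm H] (momentEquiv hH) := by
  let _ : TopologicalSpace (InvMeasure H) := strongNarrow H
  refine continuous_induced_rng.2 (continuous_pi fun k => ?_)
  have norm_dyad_tensorPow_le (φ : UnitBall H) : ‖TraceClass.dyad (tensorPow k φ.1)‖ ≤ 1 := by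
    refine (norm_dyad_le _).trans ?_
    rw [norm_tensorPow]
    exact pow_le_one₀ (by positivity)
      (pow_le_one₀ (norm_nonneg _) (norm_le_one_of_mem_unitBall φ))
  exact (continuous_integral_of_bounded
    (continuous_dyad.comp ((continuous_tensorPow k).comp continuous_subtype_val))
    norm_dyad_tensorPow_le).comp continuous_induced_dom

lemma integral_norm_sq_eq_trace (μ : InvMeasure H) :
    ∫ φ, ‖φ.1‖ ^ 2 ∂(μ.1 : Measure (UnitBall H)) = (trace (momentMap μ 1).op).re := by
  have trace_eq := trace_ensemble (memLp_tensorPow (μ.1 : Measure (UnitBall H)) 1 2)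
  simp only [norm_tensorPow, pow_one] at trace_eq
  exact (congrArg Complex.re trace_eq).symm

lemma continuous_momentEquiv_symm_norm :
    Continuous[hierarchyNorm H, strongNarrow H] (momentEquiv hH).symm := by
  let _ := hierarchyNorm H
  have : FirstCountableTopology (symHierarchies H) :=
    TopologicalSpace.firstCountableTopology_induced _ _ _
  have continuous_weak : Continuous[hierarchyNorm H, weakNarrow H] (momentEquiv hH).symm :=
    continuous_le_dom hierarchyNorm_le_corrTopology (continuous_momentEquiv_symm_corrTopology hH)
  have continuous_trace : Continuous fun γ : symHierarchies H => (trace (γ.1 1).op).re :=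
    continuous_induced_pi (E := fun k => TraceClass (symPower H k)) Subtype.val
      (Complex.continuous_re.comp (traceComp 1).continuous)
  refine continuous_induced_rng.2 (continuous_iff_continuousAt.2 fun γ => ?_)
  refine tendsto_of_tendsto_weakNarrow
    (@Continuous.tendsto _ _ _ (weakNarrow H) _ continuous_weak γ) ?_
  have momentMap_symm (γ : symHierarchies H) : momentMap ((momentEquiv hH).symm γ) = γ.1 :=
    congrArg Subtype.val ((momentEquiv hH).apply_symm_apply γ)
  simp only [integral_norm_sq_eq_trace, momentMap_symm]
  exact continuous_trace.tendsto γ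

theorem isHomeomorph_momentEquiv_strong :
    @IsHomeomorph _ _ (strongNarrow H) (hierarchyNorm H) (momentEquiv hH) := by
  let _ := strongNarrow H
  let _ := hierarchyNorm H
  exact (Homeomorph.mk (momentEquiv hH) (continuous_momentEquiv_norm hH)
    (continuous_momentEquiv_symm_norm hH)).isHomeomorph

end StrongHomeomorphism

end SymHier

theorem mainTheorem5 {H : Type*} [NormedAddCommGroup H] [InnerProductSpace ℂ H] [CompleteSpace H]
    [TopologicalSpace.SeparableSpace H] [MeasurableSpace H] [BorelSpace H]
    (hH : ¬ FiniteDimensional ℂ H) :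
    (∀ (μ : SymHier.InvMeasure H) (k : ℕ),
      Integrable (fun φ : SymHier.UnitBall H => SymHier.TraceClass.dyad (SymHier.tensorPow k φ.1))
        (μ.1 : Measure (SymHier.UnitBall H))) ∧
    ∃ Φ : SymHier.InvMeasure H ≃ SymHier.symHierarchies H,
      (∀ μ : SymHier.InvMeasure H, (Φ μ).1 = SymHier.momentMap μ) ∧
      @IsHomeomorph _ _ (SymHier.weakNarrow H) (SymHier.hierarchyWeakStar H) Φ ∧
      @IsHomeomorph _ _ (SymHier.strongNarrow H) (SymHier.hierarchyNorm H) Φ := by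
  have : SecondCountableTopology H := UniformSpace.secondCountable_of_separable H
  exact ⟨fun μ k => SymHier.integrable_dyad (SymHier.memLp_tensorPow _ k 2),
    SymHier.momentEquiv hH, fun _ => rfl, SymHier.isHomeomorph_momentEquiv_weak hH,
    SymHier.isHomeomorph_momentEquiv_strong hH⟩
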